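/- Let $\mathfrak g=\mathfrak{sl}_2(\mathbb C)$ with standard basis $e,h,f$. For $n\ge 0$ let $L(n)$ be the simple $\mathfrak g$-module of dimension $n+1$, and let $\mathfrak L^4=\mathfrak{sl}_2\ltimes\mathfrak r$, where $\mathfrak r=L(4)$ is an abelian ideal with basis $v_4,v_2,v_0,v_{-2},v_{-4}$ of weight vectors such that $[e,v_{4-2i}]=(5-i)v_{6-2i}$ for $1\le i\le 4$. In $U=U(\mathfrak L^4)$ put $$C_2=v_0^2-3v_{-2}v_2+12v_{-4}v_4,\qquad C_3=v_0^3-\tfrac92 v_{-2}v_0v_2+\tfrac{27}2v_{-2}^2v_4+\tfrac{27}2v_{-4}v_2^2-36v_{-4}v_0v_4 .$$ For a linear functional $\lambda$ on $\tilde{\mathfrak h}=\mathbb Ch\oplus\mathbb Cv_0$ let $\Delta(\lambda)$ be the Verma module, i.e. the quotient of $U$ by the left ideal generated by $e,v_2,v_4,h-\lambda(h),v_0-\lambda(v_0)$, and let $\mathbf L(\lambda)$ be its simple quotient. Let $U_{(f)}$ be the localization of $U$ at the powers of $f$. For an $\mathfrak L^4$-module $M$, the Enright–Arkhipov completion $\mathbf{EA}(M)$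 is the submodule of $(U_{(f)}/U)\otimes_U M$ consisting of all elements on which $e$ acts locally finitely. Let $\mathcal F$ be the class of all $\mathfrak L^4$-modules that are finite direct sums of simple subquotients of modules $\mathbf{EA}(\mathbf L(\lambda))$, $\lambda\in\tilde{\mathfrak h}^*$; its simple objects are those members that are simple modules. A $\mathfrak g$-Harish-Chandra module is an $\mathfrak L^4$-module whose restriction to $\mathfrak g$ is a direct sum of simple finite-dimensional $\mathfrak g$-modules, each isomorphism class occurring with finite multiplicity. Say that an $\mathfrak L^4$-module has character $\tilde\lambda\in\mathbb C\setminus\{0\}$ if $C_2$ and $C_3$ act on it by the scalars $\tilde\lambda^2$ and $\tilde\lambda^3$. **Theorem.** (a) For each $\tilde\lambda\in\mathbb C\setminus\{0\}$ and each integer $i>0$ there is, up to isomorphism, a unique simple object $V(i,\tilde\lambda)$ of $\mathcal F$ that has character $\tilde\lambda$ and is isomorphic, as a $\mathfrak g$-module, to $L(i)\oplus L(i+2)\oplus L(i+4)\oplus\cdots$. (b) For each $\tilde\lambda\in\mathbb C\setminus\{0\}$ there is, up to isomorphism, a unique simple object $V'(0,\tilde\lambda)$ of $\mathcal F$ that has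 character $\tilde\lambda$ and is isomorphic, as a $\mathfrak g$-module, to $L(0)\oplus L(4)\oplus L(8)\oplus\cdots$. (c) For each $\tilde\lambda\in\mathbb C\setminus\{0\}$ there is, up to isomorphism, a unique simple object $V'(2,\tilde\lambda)$ of $\mathcal F$ that has character $\tilde\lambda$ and is isomorphic, as a $\mathfrak g$-module, to $L(2)\oplus L(6)\oplus L(10)\oplus\cdots$. (d) For each $\tilde\lambda\in\mathbb C\setminus\{0\}$, every simple object of $\mathcal F$ with character $\tilde\lambda$ is isomorphic to $V'(0,\tilde\lambda)$, to $V'(2,\tilde\lambda)$ or to $V(i,\tilde\lambda)$ for some $i>0$. Moreover, every simple object of $\mathcal F$ on which $\mathfrak r$ does not act by zero is isomorphic to one of the modules in (a)–(c) for some $\tilde\lambda\in\mathbb C\setminus\{0\}$. The modules in (a)–(c), for all $\tilde\lambda$ and $i$, are pairwise non-isomorphic. (e) For each $\tilde\lambda\in\mathbb C\setminus\{0\}$, every simple $\mathfrak g$-Harish-Chandra module with character $\tilde\lambda$ belongs to $\mathcal F$. -/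

import Mathlib

universe u

namespace ConformalGalilei

section

attribute [local instance 100] LieRing.ofAssociativeRing

/-! ### The Lie algebra `𝔤 = 𝔰𝔩₂` and its modules `L(n)` -/

/-- The Lie algebra `𝔤 = 𝔰𝔩₂(ℂ)` of traceless `2 × 2` complex matrices. -/
abbrev Sl2 : Type := LieAlgebra.SpecialLinear.sl (Fin 2) ℂ

theorem mem_sl2_iff (A : Matrix (Fin 2) (Fin 2) ℂ) :
    A ∈ LieAlgebra.SpecialLinear.sl (Fin 2) ℂ ↔ A.trace = 0 := Iff.rfl

/-- The universal enveloping algebra `U(𝔤)`. -/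
abbrev Ug : Type := UniversalEnvelopingAlgebra ℂ Sl2

/-- The standard element `e` of `𝔰𝔩₂`. -/
def sl2E : Sl2 := ⟨!![0, 1; 0, 0], by
  rw [mem_sl2_iff]; simp [Matrix.trace_fin_two]⟩

/-- The standard element `h` of `𝔰𝔩₂`. -/
def sl2H : Sl2 := ⟨!![1, 0; 0, -1], by
  rw [mem_sl2_iff]; simp [Matrix.trace_fin_two]⟩

/-- The standard element `f` of `𝔰𝔩₂`. -/
def sl2F : Sl2 := ⟨!![0, 0; 1, 0], by
  rw [mem_sl2_iff]; simp [Matrix.trace_fin_two]⟩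

/-- The underlying space of `L(n)`. The coordinate vectors `x₀, …, xₙ` are the basis vectors
`v_n, v_{n-2}, …, v_{-n}` of weights `n, n-2, …, -n`; that is `x_i = v_{n-2i}`. -/
def Irrep (n : ℕ) : Type := Fin (n + 1) → ℂ

instance (n : ℕ) : AddCommGroup (Irrep n) := inferInstanceAs (AddCommGroup (Fin (n + 1) → ℂ))

noncomputable instance (n : ℕ) : Module ℂ (Irrep n) :=
  inferInstanceAs (Module ℂ (Fin (n + 1) → ℂ))

instance (n : ℕ) : FiniteDimensional ℂ (Irrep n) :=
  inferInstanceAs (FiniteDimensional ℂ (Fin (n + 1) → ℂ))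

/-- The basis vector `x_i = v_{n-2i}` of `L(n)`. -/
noncomputable def Irrep.basisVec (n : ℕ) (i : Fin (n + 1)) : Irrep n :=
  (Pi.single i 1 : Fin (n + 1) → ℂ)

/-- The matrix of `e` on `L(n)`: `e • v_{n-2j} = (n - j + 1) • v_{n-2(j-1)}`. -/
def matE (n : ℕ) : Matrix (Fin (n + 1)) (Fin (n + 1)) ℂ :=
  Matrix.of fun i j => if (j : ℕ) = i + 1 then (n : ℂ) - (i : ℕ) else 0

/-- The matrix of `h` on `L(n)`: `h • v_{n-2j} = (n - 2 j) • v_{n-2j}`. -/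
def matH (n : ℕ) : Matrix (Fin (n + 1)) (Fin (n + 1)) ℂ :=
  Matrix.diagonal fun i => (n : ℂ) - 2 * (i : ℕ)

/-- The matrix of `f` on `L(n)`: `f • v_{n-2j} = (j + 1) • v_{n-2(j+1)}`. -/
def matF (n : ℕ) : Matrix (Fin (n + 1)) (Fin (n + 1)) ℂ :=
  Matrix.of fun i j => if (i : ℕ) = j + 1 then ((i : ℕ) : ℂ) else 0

theorem matE_mul_matF (n : ℕ) :
    matE n * matF n = Matrix.diagonal fun i : Fin (n + 1) => ((n : ℂ) - (i : ℕ)) * ((i : ℕ) + 1) := by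
  ext i k
  rw [Matrix.mul_apply, Matrix.diagonal_apply]
  by_cases hi : (i : ℕ) + 1 < n + 1
  · rw [Finset.sum_eq_single (⟨(i : ℕ) + 1, hi⟩ : Fin (n + 1))]
    · by_cases hik : i = k
      · subst hik; simp [matE, matF]
      · have : (i : ℕ) ≠ k := fun h => hik (Fin.ext h)
        simp [matE, matF, hik, this]
    · intro j _ hj
      have : (j : ℕ) ≠ i + 1 := fun h => hj (Fin.ext h)
      simp [matE, this]
    · simp
  · have hin : (i : ℕ) = n := by omega
    rw [Finset.sum_eq_zero]
    · simp [hin]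
    · intro j _
      have : (j : ℕ) ≠ i + 1 := by omega
      simp [matE, this]

theorem matF_mul_matE (n : ℕ) :
    matF n * matE n = Matrix.diagonal fun i : Fin (n + 1) => ((i : ℕ) : ℂ) * ((n : ℂ) - (i : ℕ) + 1) := by
  ext i k
  rw [Matrix.mul_apply, Matrix.diagonal_apply]
  by_cases hi : (i : ℕ) = 0
  · rw [Finset.sum_eq_zero]
    · simp [hi]
    · intro j _
      simp [matF, hi]
  · rw [Finset.sum_eq_single (⟨(i : ℕ) - 1, by omega⟩ : Fin (n + 1))]
    · have h1 : (i : ℕ) = (i : ℕ) - 1 + 1 := by omega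
      have h2 : (((i : ℕ) - 1 : ℕ) : ℂ) = (i : ℕ) - 1 := by
        rw [Nat.cast_sub (by omega)]; simp
      by_cases hik : i = k
      · subst hik; simp only [matE, matF, Matrix.of_apply, ← h1, h2, if_true]; ring
      · have : (k : ℕ) ≠ i := fun h => hik (Fin.ext h.symm)
        simp [matE, matF, hik, ← h1, this]
    · intro j _ hj
      have : (i : ℕ) ≠ j + 1 := fun h => hj (Fin.ext (by simp; omega))
      simp [matF, this]
    · simp

theorem matE_matF (n : ℕ) : matE n * matF n - matF n * matE n = matH n := by
  rw [matE_mul_matF, matF_mul_matE, matH, Matrix.diagonal_sub]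
  congr 1; funext i; ring

theorem matH_matE (n : ℕ) : matH n * matE n - matE n * matH n = (2 : ℂ) • matE n := by
  ext i j
  simp only [matH, Matrix.sub_apply, Matrix.diagonal_mul, Matrix.mul_diagonal, Matrix.smul_apply,
    matE, Matrix.of_apply, smul_eq_mul]
  split_ifs with h
  · rw [h]; push_cast; ring
  · ring

theorem matH_matF (n : ℕ) : matH n * matF n - matF n * matH n = (-2 : ℂ) • matF n := by
  ext i j
  simp only [matH, Matrix.sub_apply, Matrix.diagonal_mul, Matrix.mul_diagonal, Matrix.smul_apply,
    matF, Matrix.of_apply, smul_eq_mul]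
  split_ifs with h
  · rw [h]; push_cast; ring
  · ring

/-- The matrix of `x ∈ 𝔰𝔩₂` on `L(n)`; here `x = x₀₁ e + x₀₀ h + x₁₀ f`. -/
def matSl2 (n : ℕ) (x : Sl2) : Matrix (Fin (n + 1)) (Fin (n + 1)) ℂ :=
  x.1 0 1 • matE n + x.1 0 0 • matH n + x.1 1 0 • matF n

theorem matSl2_lie (n : ℕ) (x y : Sl2) :
    matSl2 n ⁅x, y⁆ = matSl2 n x * matSl2 n y - matSl2 n y * matSl2 n x := by
  have hx : x.1 1 1 = -x.1 0 0 := by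
    have := (mem_sl2_iff x.1).1 x.2
    rw [Matrix.trace_fin_two] at this; linear_combination this
  have hy : y.1 1 1 = -y.1 0 0 := by
    have := (mem_sl2_iff y.1).1 y.2
    rw [Matrix.trace_fin_two] at this; linear_combination this
  have key : matSl2 n x * matSl2 n y - matSl2 n y * matSl2 n x =
      (x.1 0 1 * y.1 1 0 - x.1 1 0 * y.1 0 1) • (matE n * matF n - matF n * matE n)
      + (x.1 0 0 * y.1 0 1 - x.1 0 1 * y.1 0 0) • (matH n * matE n - matE n * matH n)
      + (x.1 0 0 * y.1 1 0 - x.1 1 0 * y.1 0 0) • (matH n * matF n - matF n * matH n) := by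
    simp only [matSl2, add_mul, mul_add, smul_mul_assoc, mul_smul_comm]
    module
  rw [key, matE_matF, matH_matE, matH_matF]
  simp only [matSl2, LieAlgebra.SpecialLinear.sl_bracket, Matrix.sub_apply, Matrix.mul_apply,
    Fin.sum_univ_two, hx, hy]
  module

/-- The representation of `𝔰𝔩₂` on `ℂⁿ⁺¹` by the matrices above. -/
noncomputable def coordHom (n : ℕ) : Sl2 →ₗ⁅ℂ⁆ Module.End ℂ (Fin (n + 1) → ℂ) where
  toFun x := Matrix.toLin' (matSl2 n x)
  map_add' x y := by
    rw [← map_add]; congr 1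
    have h : ∀ i j, (x + y).1 i j = x.1 i j + y.1 i j := fun _ _ => rfl
    simp only [matSl2, h]; module
  map_smul' c x := by
    rw [RingHom.id_apply, ← map_smul]; congr 1
    have h : ∀ i j, (c • x).1 i j = c * x.1 i j := fun _ _ => rfl
    simp only [matSl2, h]; module
  map_lie' {x y} := by
    rw [matSl2_lie, map_sub, Matrix.toLin'_mul, Matrix.toLin'_mul]; rfl

/-- The representation of `𝔰𝔩₂` on `L(n)`. -/
noncomputable def irrepHom (n : ℕ) : Sl2 →ₗ⁅ℂ⁆ Module.End ℂ (Irrep n) := coordHom n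

/-- `L(n)` as a module over `U(𝔤)`. -/
noncomputable instance (n : ℕ) : Module Ug (Irrep n) :=
  Module.compHom _ (UniversalEnvelopingAlgebra.lift ℂ (irrepHom n)).toRingHom

/-! ### The conformal Galilei algebra `𝔏ⁿ = 𝔰𝔩₂ ⋉ L(n)` -/

/-- `L(n)` as an abelian Lie algebra. -/
instance (n : ℕ) : LieRing (Irrep n) where
  bracket _ _ := 0
  add_lie _ _ _ := by simp
  lie_add _ _ _ := by simp
  lie_self _ := rfl
  leibniz_lie _ _ _ := by simp

theorem irrep_lie (n : ℕ) (v w : Irrep n) : ⁅v, w⁆ = 0 := rfl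

noncomputable instance (n : ℕ) : LieAlgebra ℂ (Irrep n) where
  lie_smul _ _ _ := by simp [irrep_lie]

/-- The action of `𝔰𝔩₂` by derivations on the abelian Lie algebra `L(n)`. -/
noncomputable def irrepDer (n : ℕ) : Sl2 →ₗ⁅ℂ⁆ LieDerivation ℂ (Irrep n) (Irrep n) where
  toFun x :=
    { toLinearMap := irrepHom n x
      leibniz' := fun a b => by simp [irrep_lie] }
  map_add' x y := by ext v; simp
  map_smul' c x := by ext v; simp
  map_lie' {x y} := by
    ext v
    simp [LieDerivation.lie_apply, LieRing.of_associative_ring_bracket]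

/-- The conformal Galilei algebra `𝔏ⁿ = 𝔰𝔩₂ ⋉ L(n)`, with `𝔯 = L(n)` an abelian ideal. -/
abbrev Galilei (n : ℕ) : Type := LieAlgebra.SemiDirectSum (Irrep n) Sl2 (irrepDer n)

/-- The Lie algebra `𝔏⁴ = 𝔰𝔩₂ ⋉ L(4)`. -/
abbrev L4 : Type := Galilei 4

/-- The universal enveloping algebra `U(𝔏⁴)`. An `𝔏⁴`-module is the same as a module over it. -/
abbrev U4 : Type := UniversalEnvelopingAlgebra ℂ L4

/-- The inclusion `U(𝔤) → U(𝔏⁴)` induced by `𝔤 ⊆ 𝔏⁴`. -/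
noncomputable def ugToU4 : Ug →ₐ[ℂ] U4 :=
  UniversalEnvelopingAlgebra.lift ℂ
    ((UniversalEnvelopingAlgebra.ι ℂ).comp (LieAlgebra.SemiDirectSum.inr (irrepDer 4)))

/-- An element of `𝔤`, viewed in `U(𝔏⁴)`. -/
noncomputable def gU (x : Sl2) : U4 :=
  UniversalEnvelopingAlgebra.ι ℂ (LieAlgebra.SemiDirectSum.inr (irrepDer 4) x)

/-- An element of `𝔯 = L(4)`, viewed in `U(𝔏⁴)`. -/
noncomputable def rU (v : Irrep 4) : U4 :=
  UniversalEnvelopingAlgebra.ι ℂ (LieAlgebra.SemiDirectSum.inl (irrepDer 4) v)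

/-- `e ∈ U(𝔏⁴)`. -/
noncomputable def eU : U4 := gU sl2E
/-- `h ∈ U(𝔏⁴)`. -/
noncomputable def hU : U4 := gU sl2H
/-- `f ∈ U(𝔏⁴)`. -/
noncomputable def fU : U4 := gU sl2F

/-- `v₄ ∈ U(𝔏⁴)`. -/
noncomputable def v4 : U4 := rU (Irrep.basisVec 4 0)
/-- `v₂ ∈ U(𝔏⁴)`. -/
noncomputable def v2 : U4 := rU (Irrep.basisVec 4 1)
/-- `v₀ ∈ U(𝔏⁴)`. -/
noncomputable def v0 : U4 := rU (Irrep.basisVec 4 2)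
/-- `v₋₂ ∈ U(𝔏⁴)`. -/
noncomputable def vm2 : U4 := rU (Irrep.basisVec 4 3)
/-- `v₋₄ ∈ U(𝔏⁴)`. -/
noncomputable def vm4 : U4 := rU (Irrep.basisVec 4 4)

/-- `C₂ = v₀² - 3 v₋₂ v₂ + 12 v₋₄ v₄`. -/
noncomputable def C2 : U4 :=
  v0 ^ 2 - (3 : ℂ) • (vm2 * v2) + (12 : ℂ) • (vm4 * v4)

/-- `C₃ = v₀³ - (9/2) v₋₂ v₀ v₂ + (27/2) v₋₂² v₄ + (27/2) v₋₄ v₂² - 36 v₋₄ v₀ v₄`. -/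
noncomputable def C3 : U4 :=
  v0 ^ 3 - (9 / 2 : ℂ) • (vm2 * v0 * v2) + (27 / 2 : ℂ) • (vm2 ^ 2 * v4)
    + (27 / 2 : ℂ) • (vm4 * v2 ^ 2) - (36 : ℂ) • (vm4 * v0 * v4)

/-- `C₂` and `C₃` act on the `𝔏⁴`-module `V` by the scalars `c²` and `c³`. -/
def HasCharacter (c : ℂ) (V : Type*) [AddCommGroup V] [Module U4 V] : Prop :=
  (∀ v : V, C2 • v = algebraMap ℂ U4 (c ^ 2) • v) ∧
    (∀ v : V, C3 • v = algebraMap ℂ U4 (c ^ 3) • v)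

/-! ### Restriction to `𝔤`, Harish-Chandra modules and `𝔤`-types -/

/-- The restriction of an `𝔏⁴`-module to `𝔤`, as a `U(𝔤)`-module. -/
def ResG (V : Type*) : Type _ := V

instance (V : Type*) [AddCommGroup V] : AddCommGroup (ResG V) := inferInstanceAs (AddCommGroup V)

noncomputable instance (V : Type*) [AddCommGroup V] [Module U4 V] : Module Ug (ResG V) :=
  Module.compHom V ugToU4.toRingHom

/-- Finite-dimensionality over `ℂ` of a module over a complex algebra `A`. -/
def IsFinDim (A : Type*) [Ring A] [Algebra ℂ A] (W : Type*) [AddCommGroup W] [Module A W] : Prop :=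
  letI : Module ℂ W := Module.restrictScalars ℂ A W
  FiniteDimensional ℂ W

/-- An `𝔏⁴`-module is `𝔤`-Harish-Chandra if, over `𝔤`, it is a direct sum of simple
finite-dimensional submodules in which every isomorphism class occurs finitely often. -/
def IsHarishChandra (V : Type u) [AddCommGroup V] [Module U4 V] : Prop :=
  ∃ (I : Type u) (W : I → Submodule Ug (ResG V)),
    iSupIndep W ∧ iSup W = ⊤ ∧
    (∀ i, IsSimpleModule Ug (W i)) ∧ (∀ i, IsFinDim Ug (W i)) ∧
    ∀ i, {j | Nonempty (W j ≃ₗ[Ug] W i)}.Finite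

/-- The `𝔤`-types of `V` are `L(t 0), L(t 1), L(t 2), …`, that is, the restriction of `V` to `𝔤`
is isomorphic to `⨁ₖ L(t k)`. -/
def HasGTypes (t : ℕ → ℕ) (V : Type*) [AddCommGroup V] [Module U4 V] : Prop :=
  Nonempty (ResG V ≃ₗ[Ug] DirectSum ℕ fun k => Irrep (t k))

/-! ### Simple highest weight modules -/

/-- The left ideal of `U(𝔏⁴)` generated by `e, v₂, v₄` (a basis of `𝔫̃₊`) and by
`h - λ(h)`, `v₀ - λ(v₀)`, where `h, v₀` is a basis of the generalized Cartan subalgebra `𝔥̃`.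
A weight `λ ∈ 𝔥̃*` is given by `l = (λ(h), λ(v₀))`. -/
noncomputable def vermaIdeal (l : ℂ × ℂ) : Submodule U4 U4 :=
  Submodule.span U4 {eU, v2, v4, hU - algebraMap ℂ U4 l.1, v0 - algebraMap ℂ U4 l.2}

/-- The Verma module `Δ(λ) = U(𝔏⁴) ⊗_{U(𝔟̃)} ℂ_λ`, presented as the quotient of `U(𝔏⁴)` by the
left ideal generated by the annihilator of `ℂ_λ` in `U(𝔟̃)`. -/
abbrev Verma (l : ℂ × ℂ) : Type := U4 ⧸ vermaIdeal l

/-! ### Localization at `f` -/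

section Ore

variable {A : Type*} [Ring A] [Algebra ℂ A]

/-- The inner derivation `u ↦ a u - u a`. -/
def innerDer (a : A) : Module.End ℂ A := LinearMap.mulLeft ℂ a - LinearMap.mulRight ℂ a

theorem innerDer_apply (a u : A) : innerDer a u = a * u - u * a := rfl

theorem innerDer_mul (a u v : A) :
    innerDer a (u * v) = innerDer a u * v + u * innerDer a v := by
  simp only [innerDer_apply]; noncomm_ring

theorem innerDer_mul_pow (a u : A) (n : ℕ) :
    innerDer a (u * a ^ n) = innerDer a u * a ^ n := by
  have h : innerDer a (a ^ n) = 0 := by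
    rw [innerDer_apply, ← pow_succ, ← pow_succ', sub_self]
  rw [innerDer_mul, h, mul_zero, add_zero]

theorem innerDer_pow_mul_self (a u : A) (N : ℕ) :
    (innerDer a ^ N) (u * a) = (innerDer a ^ N) u * a := by
  induction N generalizing u with
  | zero => rfl
  | succ N ih =>
    have h := innerDer_mul_pow a u 1
    rw [pow_one] at h
    rw [pow_succ, Module.End.mul_apply, Module.End.mul_apply, h, ih]

theorem innerDer_pow_mul_eq_zero (a : A) (s : ℕ) : ∀ (p q : ℕ) (u v : A), p + q = s →
    (innerDer a ^ p) u = 0 → (innerDer a ^ q) v = 0 → (innerDer a ^ s) (u * v) = 0 := by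
  induction s with
  | zero =>
    intro p q u v hpq hu hv
    obtain rfl : p = 0 := by omega
    have hu' : u = 0 := hu
    simp [hu']
  | succ s ih =>
    intro p q u v hpq hu hv
    rcases p with _ | p
    · have hu' : u = 0 := hu
      simp [hu']
    rcases q with _ | q
    · have hv' : v = 0 := hv
      simp [hv']
    rw [pow_succ, Module.End.mul_apply, innerDer_mul, map_add,
      ih p (q + 1) _ _ (by omega) (by rwa [pow_succ] at hu) hv,
      ih (p + 1) q _ _ (by omega) hu (by rwa [pow_succ] at hv), add_zero]

theorem exists_pow_mul_eq (a : A) (N : ℕ) : ∀ (u : A), (innerDer a ^ N) u = 0 →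
    ∀ n : ℕ, ∃ w, a ^ (N + n) * u = w * a ^ n := by
  induction N with
  | zero => intro u hu n; exact ⟨0, by simp [show u = 0 from hu]⟩
  | succ N ih =>
    intro u hu n
    have hd : (innerDer a ^ N) (innerDer a u) = 0 := by rwa [pow_succ] at hu
    induction n with
    | zero => exact ⟨a ^ (N + 1) * u, by simp⟩
    | succ n ihn =>
      obtain ⟨w, hw⟩ := ihn
      obtain ⟨w', hw'⟩ := ih _ hd (n + 1)
      refine ⟨w + w', ?_⟩
      have h1 : a ^ (N + 1 + (n + 1)) * u
          = a ^ (N + 1 + n) * u * a + a ^ (N + (n + 1)) * innerDer a u := by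
        rw [innerDer_apply, show N + 1 + (n + 1) = (N + 1 + n) + 1 by ring,
          show N + (n + 1) = N + 1 + n by ring, pow_succ]
        noncomm_ring
      rw [h1, hw, hw', add_mul, mul_assoc, ← pow_succ]

theorem pow_mul_eq_zero (a : A) (N : ℕ) : ∀ (n : ℕ) (u : A), (innerDer a ^ N) u = 0 →
    u * a ^ n = 0 → a ^ (N + n) * u = 0 := by
  induction N with
  | zero => intro n u hu _; simp [show u = 0 from hu]
  | succ N ih =>
    intro n
    induction n with
    | zero => intro u _ h; simp [show u = 0 by simpa using h]
    | succ n ihn =>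
      intro u hu h
      have hd : (innerDer a ^ N) (innerDer a u) = 0 := by rwa [pow_succ] at hu
      have h1 : a ^ (N + 1 + (n + 1)) * u
          = a ^ (N + 1 + n) * (u * a) + a ^ (N + (n + 1)) * innerDer a u := by
        rw [innerDer_apply, show N + 1 + (n + 1) = (N + 1 + n) + 1 by ring,
          show N + (n + 1) = N + 1 + n by ring, pow_succ]
        noncomm_ring
      rw [h1, ihn (u * a) (by rw [innerDer_pow_mul_self, hu, zero_mul])
          (by rwa [mul_assoc, ← pow_succ']),
        ih (n + 1) _ hd (by rw [← innerDer_mul_pow, h, map_zero]), add_zero]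

/-- The powers of an element with locally nilpotent inner derivation form a left Ore set. -/
@[reducible]
noncomputable def oreSetPowers (a : A) (ha : ∀ u : A, ∃ N : ℕ, (innerDer a ^ N) u = 0) :
    OreLocalization.OreSet (Submonoid.powers a) :=
  have key : ∀ (r : A) (s : Submonoid.powers a), ∃ p : A × Submonoid.powers a,
      (p.2 : A) * r = p.1 * s := by
    rintro r ⟨_, n, rfl⟩
    obtain ⟨N, hN⟩ := ha r
    obtain ⟨w, hw⟩ := exists_pow_mul_eq a N r hN n
    exact ⟨(w, ⟨a ^ (N + n), N + n, rfl⟩), hw⟩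
  { ore_right_cancel := by
      rintro r₁ r₂ ⟨_, n, rfl⟩ h
      obtain ⟨N, hN⟩ := ha (r₁ - r₂)
      refine ⟨⟨a ^ (N + n), N + n, rfl⟩, ?_⟩
      have := pow_mul_eq_zero a N n (r₁ - r₂) hN (by rw [sub_mul]; exact sub_eq_zero.2 h)
      rw [mul_sub] at this
      exact sub_eq_zero.1 this
    oreNum := fun r s => (key r s).choose.1
    oreDenom := fun r s => (key r s).choose.2
    ore_eq := fun r s => (key r s).choose_spec }

end Ore

/-- A subalgebra of `U(L)` containing the image of `L` is everything. -/
theorem mem_of_forall_ι_mem {L : Type*} [LieRing L] [LieAlgebra ℂ L]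
    (S : Subalgebra ℂ (UniversalEnvelopingAlgebra ℂ L))
    (hS : ∀ x : L, UniversalEnvelopingAlgebra.ι ℂ x ∈ S) (u : UniversalEnvelopingAlgebra ℂ L) :
    u ∈ S := by
  let g : L →ₗ⁅ℂ⁆ S :=
    { toFun := fun x => ⟨UniversalEnvelopingAlgebra.ι ℂ x, hS x⟩
      map_add' := fun x y => Subtype.ext (map_add _ x y)
      map_smul' := fun c x => Subtype.ext (map_smul _ c x)
      map_lie' := fun {x y} => Subtype.ext (LieHom.map_lie _ x y) }
  have h : S.val.comp (UniversalEnvelopingAlgebra.lift ℂ g) = AlgHom.id ℂ _ := by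
    apply UniversalEnvelopingAlgebra.hom_ext
    ext x
    simp [g]
  have h2 := DFunLike.congr_fun h u
  rw [AlgHom.id_apply] at h2
  rw [← h2]
  exact ((UniversalEnvelopingAlgebra.lift ℂ g) u).2

theorem coordHom_four_sl2F (w : Fin 5 → ℂ) :
    coordHom 4 sl2F w = ![0, w 0, 2 * w 1, 3 * w 2, 4 * w 3] := by
  change (matSl2 4 sl2F).mulVec w = _
  funext i
  fin_cases i <;> simp [matSl2, sl2F, Matrix.mulVec, dotProduct, Fin.sum_univ_succ, matF]

theorem sl2F_lie (x : Sl2) :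
    (⁅sl2F, x⁆ : Sl2).1 = !![-x.1 0 1, 0; x.1 0 0 - x.1 1 1, x.1 0 1] := by
  rw [LieAlgebra.SpecialLinear.sl_bracket]
  ext i j
  fin_cases i <;> fin_cases j <;>
    simp [sl2F, Matrix.mul_apply, Fin.sum_univ_two, Matrix.sub_apply, Matrix.vecMul, dotProduct]

theorem innerDer_fU_locally_nilpotent (u : U4) : ∃ N : ℕ, (innerDer fU ^ N) u = 0 := by
  let S : Subalgebra ℂ U4 :=
    { carrier := {u | ∃ N : ℕ, (innerDer fU ^ N) u = 0}
      mul_mem' := by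
        rintro u v ⟨p, hp⟩ ⟨q, hq⟩
        exact ⟨p + q, innerDer_pow_mul_eq_zero fU (p + q) p q u v rfl hp hq⟩
      add_mem' := by
        rintro u v ⟨p, hp⟩ ⟨q, hq⟩
        refine ⟨p + q, ?_⟩
        rw [map_add]
        nth_rewrite 1 [add_comm p q]
        rw [pow_add, Module.End.mul_apply, hp, pow_add, Module.End.mul_apply, hq]
        simp
      algebraMap_mem' := by
        intro c
        exact ⟨1, by rw [pow_one, innerDer_apply, Algebra.commutes, sub_self]⟩ }
  refine mem_of_forall_ι_mem S ?_ u
  intro x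
  have hstep : ∀ y : L4, innerDer fU (UniversalEnvelopingAlgebra.ι ℂ y)
      = UniversalEnvelopingAlgebra.ι ℂ ⁅LieAlgebra.SemiDirectSum.inr (irrepDer 4) sl2F, y⁆ := by
    intro y
    rw [LieHom.map_lie, LieRing.of_associative_ring_bracket]
    rfl
  have hpow : ∀ (N : ℕ) (y : L4), (innerDer fU ^ N) (UniversalEnvelopingAlgebra.ι ℂ y)
      = UniversalEnvelopingAlgebra.ι ℂ
        ((fun z => ⁅LieAlgebra.SemiDirectSum.inr (irrepDer 4) sl2F, z⁆)^[N] y) := by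
    intro N
    induction N with
    | zero => intro y; rfl
    | succ N ih => intro y; rw [pow_succ, Module.End.mul_apply, hstep, ih]; rfl
  have hbr : ∀ z : L4, ⁅LieAlgebra.SemiDirectSum.inr (irrepDer 4) sl2F, z⁆
      = ⟨irrepHom 4 sl2F z.left, ⁅sl2F, z.right⁆⟩ := by
    intro z
    have h1 : irrepDer 4 z.right (0 : Irrep 4) = 0 := map_zero _
    change (⟨⁅(0 : Irrep 4), z.left⁆ + irrepDer 4 sl2F z.left - irrepDer 4 z.right 0,
      ⁅sl2F, z.right⁆⟩ : L4) = _
    rw [irrep_lie, h1, zero_add, sub_zero]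
    rfl
  refine ⟨5, ?_⟩
  rw [hpow]
  have : ((fun z => ⁅LieAlgebra.SemiDirectSum.inr (irrepDer 4) sl2F, z⁆)^[5] x) = 0 := by
    simp only [Function.iterate_succ, Function.iterate_zero, Function.comp, id, hbr]
    rw [LieAlgebra.SemiDirectSum.zero_eq_mk]
    congr 1
    · change coordHom 4 sl2F (coordHom 4 sl2F (coordHom 4 sl2F (coordHom 4 sl2F
        (coordHom 4 sl2F (x.left : Fin 5 → ℂ))))) = (0 : Fin 5 → ℂ)
      simp only [coordHom_four_sl2F]
      have h0 : coordHom 4 sl2F (x.left : Fin 5 → ℂ) 0 = 0 :=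
        congrFun (coordHom_four_sl2F x.left) 0
      funext i
      fin_cases i <;> simp [h0]
    · apply Subtype.ext
      simp only [sl2F_lie]
      ext i j
      fin_cases i <;> fin_cases j <;> simp
  rw [this, map_zero]

/-- The powers of `f` form a left Ore set in `U(𝔏⁴)`. -/
noncomputable instance : OreLocalization.OreSet (Submonoid.powers fU) :=
  oreSetPowers fU innerDer_fU_locally_nilpotent

/-! ### The Enright-Arkhipov completion -/

section EA

variable (M : Type*) [AddCommGroup M] [Module U4 M]

/-- The localization `U_(f) ⊗_U M` of an `𝔏⁴`-module, where `U = U(𝔏⁴)`: its elements are the left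
fractions `f⁻ⁿ m`. -/
abbrev LocF : Type _ := OreLocalization (Submonoid.powers fU) M

/-- The canonical map `j : M → U_(f) ⊗_U M`, `m ↦ 1 ⊗ m`. -/
noncomputable def locMap : M →ₗ[U4] LocF M where
  toFun m := m /ₒ 1
  map_add' x y := by rw [OreLocalization.add_oreDiv]
  map_smul' r x := by
    rw [RingHom.id_apply, OreLocalization.smul_oreDiv_one]

/-- `S_f ⊗_U M`, where `S_f = U_(f) / U`; by right exactness of the tensor product, it is the
quotient of `U_(f) ⊗_U M` by the image of `M`. -/
abbrev Comp : Type _ := LocF M ⧸ LinearMap.range (locMap M)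

variable {M}

/-- `x` acts locally finitely on `m`: the space `ℂ[x] m` is finite-dimensional. -/
def IsLocFinite (x : U4) (m : M) : Prop :=
  letI : Module ℂ M := Module.restrictScalars ℂ U4 M
  FiniteDimensional ℂ (Submodule.span ℂ (Set.range fun k : ℕ => x ^ k • m))

theorem finDim_span_iff [Module ℂ M] [IsScalarTower ℂ U4 M] (x : U4) (m : M) :
    FiniteDimensional ℂ (Submodule.span ℂ (Set.range fun k : ℕ => x ^ k • m)) ↔
      ∃ W : Submodule ℂ M, FiniteDimensional ℂ W ∧ m ∈ W ∧ ∀ w ∈ W, x • w ∈ W := by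
  constructor
  · intro h
    refine ⟨_, h, Submodule.subset_span ⟨0, by simp⟩, fun w hw => ?_⟩
    have hle : Submodule.span ℂ (Set.range fun k : ℕ => x ^ k • m) ≤
        (Submodule.span ℂ (Set.range fun k : ℕ => x ^ k • m)).comap
          (Algebra.lsmul ℂ ℂ M x) := by
      rw [Submodule.span_le]
      rintro _ ⟨k, rfl⟩
      exact Submodule.subset_span ⟨k + 1, by simp [pow_succ', mul_smul]⟩
    exact hle hw
  · rintro ⟨W, hW, hm, hst⟩
    have hle : Submodule.span ℂ (Set.range fun k : ℕ => x ^ k • m) ≤ W := by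
      rw [Submodule.span_le]
      rintro _ ⟨k, rfl⟩
      induction k with
      | zero => simpa using hm
      | succ k ih =>
        have := hst _ ih
        simpa [pow_succ', mul_smul] using this
    exact Submodule.finiteDimensional_of_le hle

instance : FiniteDimensional ℂ L4 :=
  Module.Finite.equiv (LieAlgebra.SemiDirectSum.toProdl (irrepDer 4)).symm

theorem isLocFinite_iff (x : U4) (m : M) : IsLocFinite x m ↔
    letI : Module ℂ M := Module.restrictScalars ℂ U4 M
    ∃ W : Submodule ℂ M, FiniteDimensional ℂ W ∧ m ∈ W ∧ ∀ w ∈ W, x • w ∈ W := by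
  let _ : Module ℂ M := Module.restrictScalars ℂ U4 M
  have : IsScalarTower ℂ U4 M := IsScalarTower.restrictScalars ℂ U4 M
  exact finDim_span_iff x m

theorem IsLocFinite.add {x : U4} {m n : M} (hm : IsLocFinite x m) (hn : IsLocFinite x n) :
    IsLocFinite x (m + n) := by
  rw [isLocFinite_iff] at *
  obtain ⟨W₁, _, h₁, hs₁⟩ := hm
  obtain ⟨W₂, _, h₂, hs₂⟩ := hn
  let _ : Module ℂ M := Module.restrictScalars ℂ U4 M
  refine ⟨W₁ ⊔ W₂, inferInstance, Submodule.add_mem_sup h₁ h₂, fun w hw => ?_⟩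
  obtain ⟨a, ha, b, hb, rfl⟩ := Submodule.mem_sup.1 hw
  rw [smul_add]
  exact Submodule.add_mem_sup (hs₁ a ha) (hs₂ b hb)

theorem IsLocFinite.ι_smul {x y : L4} {m : M}
    (hm : IsLocFinite (UniversalEnvelopingAlgebra.ι ℂ x) m) :
    IsLocFinite (UniversalEnvelopingAlgebra.ι ℂ x)
      ((UniversalEnvelopingAlgebra.ι ℂ y : U4) • m) := by
  rw [isLocFinite_iff] at *
  let _ : Module ℂ M := Module.restrictScalars ℂ U4 M
  have : IsScalarTower ℂ U4 M := IsScalarTower.restrictScalars ℂ U4 M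
  obtain ⟨W, hfin, hmW, hst⟩ := hm
  let B : L4 →ₗ[ℂ] M →ₗ[ℂ] M :=
    (Algebra.lsmul ℂ ℂ M).toLinearMap ∘ₗ ((UniversalEnvelopingAlgebra.ι ℂ : L4 →ₗ⁅ℂ⁆ U4) : L4 →ₗ[ℂ] U4)
  have hB : ∀ (z : L4) (w : M), B z w = (UniversalEnvelopingAlgebra.ι ℂ z : U4) • w :=
    fun _ _ => rfl
  refine ⟨Submodule.map₂ B ⊤ W, ?_, ?_, ?_⟩
  · exact Module.Finite.iff_fg.2
      (Submodule.FG.map₂ B Module.Finite.fg_top (Module.Finite.iff_fg.1 hfin))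
  · rw [← hB]
    exact Submodule.apply_mem_map₂ B trivial hmW
  · have hle : Submodule.map₂ B ⊤ W ≤ (Submodule.map₂ B ⊤ W).comap
        (Algebra.lsmul ℂ ℂ M (UniversalEnvelopingAlgebra.ι ℂ x : U4)) := by
      rw [Submodule.map₂_le]
      intro z _ w hw
      rw [Submodule.mem_comap, Algebra.lsmul_coe, hB]
      have h : (UniversalEnvelopingAlgebra.ι ℂ x : U4) • (UniversalEnvelopingAlgebra.ι ℂ z : U4) • w
          = B ⁅x, z⁆ w + B z ((UniversalEnvelopingAlgebra.ι ℂ x : U4) • w) := by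
        rw [hB, hB, LieHom.map_lie, LieRing.of_associative_ring_bracket, sub_smul, mul_smul,
          mul_smul]
        abel
      beta_reduce
      rw [h]
      exact add_mem (Submodule.apply_mem_map₂ B trivial hw)
        (Submodule.apply_mem_map₂ B trivial (hst w hw))
    exact fun w hw => hle hw

theorem IsLocFinite.smul {x : L4} (u : U4) :
    ∀ {m : M}, IsLocFinite (UniversalEnvelopingAlgebra.ι ℂ x) m →
      IsLocFinite (UniversalEnvelopingAlgebra.ι ℂ x) (u • m) := by
  let S : Subalgebra ℂ U4 :=
    { carrier := {u | ∀ {m : M}, IsLocFinite (UniversalEnvelopingAlgebra.ι ℂ x) m →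
        IsLocFinite (UniversalEnvelopingAlgebra.ι ℂ x) (u • m)}
      mul_mem' := by
        intro u v hu hv m hm
        rw [mul_smul]
        exact hu (hv hm)
      add_mem' := by
        intro u v hu hv m hm
        rw [add_smul]
        exact (hu hm).add (hv hm)
      algebraMap_mem' := by
        intro c m hm
        rw [isLocFinite_iff] at *
        obtain ⟨W, hfin, hmW, hst⟩ := hm
        let _ : Module ℂ M := Module.restrictScalars ℂ U4 M
        exact ⟨W, hfin, W.smul_mem c hmW, hst⟩ }
  have hu : u ∈ S := mem_of_forall_ι_mem S (fun y {_} hm => hm.ι_smul) u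
  intro m hm
  exact hu hm

variable (M)

/-- The Enright-Arkhipov completion `EA(M) = ᵉ(S_f ⊗_U M)`: the submodule of `S_f ⊗_U M` of all
elements on which `e` acts locally finitely. -/
noncomputable def EA : Submodule U4 (Comp M) where
  carrier := {m | IsLocFinite eU m}
  add_mem' hm hn := hm.add hn
  zero_mem' := by
    change IsLocFinite eU 0
    rw [isLocFinite_iff]
    let _ : Module ℂ (Comp M) := Module.restrictScalars ℂ U4 (Comp M)
    exact ⟨⊥, inferInstance, zero_mem _, fun w hw => by simp_all⟩
  smul_mem' u _ hm := IsLocFinite.smul u hm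

end EA

/-! ### The category `𝓕` -/

/-- `S` is a simple subquotient of the Enright-Arkhipov completion of a simple highest weight
module `𝐋(λ) = Δ(λ) / N`, where `N` is the maximal submodule of the Verma module: it is simple and
a quotient of a submodule of the completion. -/
def IsSimpleSubquotientEA (S : Type*) [AddCommGroup S] [Module U4 S] : Prop :=
  IsSimpleModule U4 S ∧
    ∃ (l : ℂ × ℂ) (N : Submodule U4 (Verma l)), IsCoatom N ∧
      ∃ (P : Submodule U4 (EA (Verma l ⧸ N))) (φ : P →ₗ[U4] S), Function.Surjective φ

/-- The `𝔏⁴`-module `V` is an object of `𝓕`, the semi-simple additive category generated by the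
simple subquotients of Enright-Arkhipov completions of simple highest weight modules: it is
a finite direct sum of such subquotients. -/
def InF (V : Type*) [AddCommGroup V] [Module U4 V] : Prop :=
  ∃ (n : ℕ) (W : Fin n → Submodule U4 V), iSupIndep W ∧ iSup W = ⊤ ∧
    ∀ i, IsSimpleSubquotientEA (W i)

/-- `V` is a simple object of `𝓕`. -/
def IsSimpleObjectF (V : Type*) [AddCommGroup V] [Module U4 V] : Prop :=
  InF V ∧ IsSimpleModule U4 V

/-- `V` is a simple object of `𝓕` on which `C₂`, `C₃` act by `c²`, `c³` and whose `𝔤`-types are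
`L(t 0), L(t 1), …`. -/
def IsSimpleObjectFWith (c : ℂ) (t : ℕ → ℕ) (V : Type*) [AddCommGroup V] [Module U4 V] : Prop :=
  IsSimpleObjectF V ∧ HasCharacter c V ∧ HasGTypes t V

/-- The labels of the families `V(i, -)` for `i > 0`, `V'(0, -)` and `V'(2, -)`. -/
inductive Label
  | V (i : ℕ+)
  | V'0
  | V'2

/-- The highest weights of the `𝔤`-types in each family: `i, i + 2, i + 4, …` for `V(i, -)`,
`0, 4, 8, …` for `V'(0, -)` and `2, 6, 10, …` for `V'(2, -)`. -/
def Label.gTypes : Label → ℕ → ℕ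
  | .V i, k => i + 2 * k
  | .V'0, k => 4 * k
  | .V'2, k => 2 + 4 * k

end

end ConformalGalilei

open ConformalGalilei

namespace ConformalGalilei

attribute [local instance 100] LieRing.ofAssociativeRing
open UniversalEnvelopingAlgebra
set_option linter.unusedSectionVars false
set_option linter.unusedSimpArgs false

/-! Every module is compared with a coinduced one. Let `Series i c` be coinduced from the character
of `ℂh ⊕ 𝔯` that takes the value `i` on `h`, `c` on `v₀` and `0` on the other `v_k`. Expanding along
`exp(se) exp(tf)` turns it into power series in `s`, `t` on which `𝔏⁴` acts through the second Weyl
algebra. By Frobenius reciprocity a map `M → Series i c` is a functional on `M` transforming by this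
character (`IsPointFunctional.toSeries`). The coinduced module is rigid: a vector killed by `f` does
not involve `t`, and the `sʲ` have distinct weights, so every lowest weight vector is a multiple of
some `sʲ` (`Series.exists_mono_of_isLowest`).

The main step is `exists_functional`. Suppose `e`, `f` are locally nilpotent on `M`, `M` is
generated by a lowest weight vector and `C₂`, `C₃` act by `c²`, `c³`. Then `M` is finitely generated
over the image of `S(𝔯)`, so the Nullstellensatz gives a functional on which `𝔯` acts by a point of
`𝔯*`, that is, by a binary quartic. `C₂` and `C₃` are the invariants of the quartic, and their
values `c²`, `c³` force a double root. Exponentials of `e` and `f` move the double root to `0`;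
choosing a functional of maximal weight kills the remaining coordinates, and the Weyl element makes
the weight nonpositive. Thus `M` maps nontrivially to some `Series (-n) c`, `n ≥ 0`.

Inside `Series (-n) c` the `𝔤`-submodules generated by the powers of `s` (all of them if `n > 0`,
those of one parity if `n = 0`) span the submodules `repV`, which have the required `𝔤`-types. They
are simple when `c ≠ 0` (`repV.isSimpleModule`): `v₋₄` acts on power series as multiplication by `c
s²`, which is injective, whereas on a proper quotient of `repV` a power of it would kill a lowest
weight vector. Two simple submodules sharing a power of `s` coincide, so every simple integrable
module of character `c ≠ 0` is some `repV` (`Integrable.exists_equiv_repV`).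

Both sides of the theorem reduce to this. Simple objects of `𝓕` and simple Harish-Chandra modules
are integrable. Conversely each `repV` lies in a completion (`exists_EA_hom_repV`): a Fourier
transform in `t` realizes a simple highest weight module as `ℂ[s, y]` with `f = y`, its localization
as `ℂ[s, y, y⁻¹]`, and taking principal parts embeds the quotient of these two into `Series`. -/

theorem gU_commutator (x y : Sl2) : gU x * gU y - gU y * gU x = gU ⁅x, y⁆ := by
  simp only [gU, LieHom.map_lie, LieRing.of_associative_ring_bracket]

theorem lie_inr_inl (x : Sl2) (v : Irrep 4) :
    (⁅LieAlgebra.SemiDirectSum.inr (irrepDer 4) x, LieAlgebra.SemiDirectSum.inl (irrepDer 4) v⁆ : L4)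
      = LieAlgebra.SemiDirectSum.inl (irrepDer 4) (irrepHom 4 x v) := by
  have h1 : irrepDer 4 (0 : Sl2) (0 : Irrep 4) = 0 := map_zero _
  change (⟨⁅(0 : Irrep 4), v⁆ + irrepDer 4 x v - irrepDer 4 (0 : Sl2) 0, ⁅x, 0⁆⟩ : L4) = ⟨_, 0⟩
  rw [irrep_lie, h1, zero_add, sub_zero, lie_zero]
  rfl

theorem lie_inl_inl (v w : Irrep 4) :
    (⁅LieAlgebra.SemiDirectSum.inl (irrepDer 4) v, LieAlgebra.SemiDirectSum.inl (irrepDer 4) w⁆ : L4)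
      = 0 := by
  rw [← LieHom.map_lie, irrep_lie, map_zero]

theorem gU_rU_commutator (x : Sl2) (v : Irrep 4) :
    gU x * rU v - rU v * gU x = rU (irrepHom 4 x v) := by
  simp only [gU, rU, ← lie_inr_inl, LieHom.map_lie, LieRing.of_associative_ring_bracket]

theorem rU_commute (v w : Irrep 4) : rU v * rU w = rU w * rU v := by
  have h := congrArg (ι ℂ (L := L4)) (lie_inl_inl v w)
  rw [LieHom.map_lie, LieRing.of_associative_ring_bracket, map_zero] at h
  exact sub_eq_zero.1 h

/-- The basis vectors `v₄, v₂, v₀, v₋₂, v₋₄` of `𝔯`, in this order. -/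
noncomputable def xU (j : Fin 5) : U4 := rU (Irrep.basisVec 4 j)

theorem xU_commute (i j : Fin 5) : xU i * xU j = xU j * xU i := rU_commute _ _

theorem rU_eq_sum (v : Irrep 4) : rU v = ∑ j, (v : Fin 5 → ℂ) j • xU j := by
  have h : v = ∑ j, (v : Fin 5 → ℂ) j • Irrep.basisVec 4 j := by
    funext i
    change (v : Fin 5 → ℂ) i = (∑ j, (v : Fin 5 → ℂ) j • (Pi.single j 1 : Fin 5 → ℂ)) i
    simp only [Finset.sum_apply, Pi.smul_apply, Pi.single_apply, smul_eq_mul, mul_ite, mul_one,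
      mul_zero]
    exact (Fintype.sum_ite_eq i _).symm
  have h2 : ∀ s : Finset (Fin 5), rU (∑ j ∈ s, (v : Fin 5 → ℂ) j • Irrep.basisVec 4 j)
      = ∑ j ∈ s, (v : Fin 5 → ℂ) j • xU j := by
    intro s
    simp only [rU, map_sum, map_smul]; rfl
  conv_lhs => rw [h]
  exact h2 _

theorem gU_eq (x : Sl2) : gU x = x.1 0 1 • eU + x.1 0 0 • hU + x.1 1 0 • fU := by
  have hx : x.1 1 1 = -x.1 0 0 := by
    have := (mem_sl2_iff x.1).1 x.2
    rw [Matrix.trace_fin_two] at this; linear_combination this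
  have h : x = x.1 0 1 • sl2E + x.1 0 0 • sl2H + x.1 1 0 • sl2F := by
    apply Subtype.ext
    ext i j
    change x.1 i j = x.1 0 1 * sl2E.1 i j + x.1 0 0 * sl2H.1 i j + x.1 1 0 * sl2F.1 i j
    fin_cases i <;> fin_cases j <;> simp [sl2E, sl2H, sl2F, hx]
  conv_lhs => rw [h]
  simp only [gU, eU, hU, fU, map_add, map_smul]

theorem lie_sl2E_sl2F : ⁅sl2E, sl2F⁆ = sl2H := by
  apply Subtype.ext
  rw [LieAlgebra.SpecialLinear.sl_bracket]
  ext i j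
  fin_cases i <;> fin_cases j <;> simp [sl2E, sl2F, sl2H]

theorem lie_sl2H_sl2E : ⁅sl2H, sl2E⁆ = (2 : ℂ) • sl2E := by
  apply Subtype.ext
  change (⁅sl2H, sl2E⁆ : Sl2).1 = (2 : ℂ) • sl2E.1
  rw [LieAlgebra.SpecialLinear.sl_bracket]
  ext i j
  fin_cases i <;> fin_cases j <;> simp [sl2E, sl2H]
  norm_num

theorem lie_sl2H_sl2F : ⁅sl2H, sl2F⁆ = (-2 : ℂ) • sl2F := by
  apply Subtype.ext
  change (⁅sl2H, sl2F⁆ : Sl2).1 = (-2 : ℂ) • sl2F.1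
  rw [LieAlgebra.SpecialLinear.sl_bracket]
  ext i j
  fin_cases i <;> fin_cases j <;> simp [sl2F, sl2H]
  norm_num

theorem gU_smul (a : ℂ) (x : Sl2) : gU (a • x) = a • gU x := by
  simp only [gU, map_smul]

theorem eU_fU : eU * fU - fU * eU = hU := by
  rw [eU, fU, gU_commutator, lie_sl2E_sl2F, hU]
theorem hU_eU : hU * eU - eU * hU = (2 : ℂ) • eU := by
  rw [eU, hU, gU_commutator, lie_sl2H_sl2E, gU_smul]
theorem hU_fU : hU * fU - fU * hU = (-2 : ℂ) • fU := by
  rw [fU, hU, gU_commutator, lie_sl2H_sl2F, gU_smul]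

theorem coordHom_apply_sl2E (w : Fin 5 → ℂ) :
    coordHom 4 sl2E w = ![4 * w 1, 3 * w 2, 2 * w 3, w 4, 0] := by
  change (matSl2 4 sl2E).mulVec w = _
  funext i
  fin_cases i <;> simp [matSl2, sl2E, Matrix.mulVec, dotProduct, Fin.sum_univ_succ, matE] <;> 
    norm_num

theorem coordHom_apply_sl2H (w : Fin 5 → ℂ) :
    coordHom 4 sl2H w = ![4 * w 0, 2 * w 1, 0, -2 * w 3, -4 * w 4] := by
  change (matSl2 4 sl2H).mulVec w = _
  funext i
  fin_cases i <;> simp [matSl2, sl2H, Matrix.mulVec, dotProduct, Fin.sum_univ_succ, matH] <;> 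
    norm_num

theorem eU_xU (j : Fin 5) : eU * xU j - xU j * eU =
    ∑ i, coordHom 4 sl2E (Pi.single j 1) i • xU i := by
  rw [eU, xU, gU_rU_commutator, rU_eq_sum]; rfl
theorem hU_xU (j : Fin 5) : hU * xU j - xU j * hU =
    ∑ i, coordHom 4 sl2H (Pi.single j 1) i • xU i := by
  rw [hU, xU, gU_rU_commutator, rU_eq_sum]; rfl
theorem fU_xU (j : Fin 5) : fU * xU j - xU j * fU =
    ∑ i, coordHom 4 sl2F (Pi.single j 1) i • xU i := by
  rw [fU, xU, gU_rU_commutator, rU_eq_sum]; rfl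

/-- A subalgebra of `U(𝔏⁴)` containing `e`, `f` and `v₋₄` is everything. -/
theorem mem_of_gens (S : Subalgebra ℂ U4) (he : eU ∈ S) (hf : fU ∈ S) (hx : xU 4 ∈ S)
    (u : U4) : u ∈ S := by
  have hh : hU ∈ S := by rw [← eU_fU]; exact S.sub_mem (S.mul_mem he hf) (S.mul_mem hf he)
  have step : ∀ (j k : Fin 5) (a : ℂ), a ≠ 0 → eU * xU j - xU j * eU = a • xU k → xU j ∈ S →
      xU k ∈ S := by
    intro j k a ha h hj
    have : a • xU k ∈ S := by
      rw [← h]; exact S.sub_mem (S.mul_mem he hj) (S.mul_mem hj he)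
    simpa [smul_smul, ha] using S.smul_mem this a⁻¹
  have h3 : xU 3 ∈ S := step 4 3 1 (by norm_num) (by
    rw [eU_xU, coordHom_apply_sl2E]; simp [Fin.sum_univ_succ]) hx
  have h2 : xU 2 ∈ S := step 3 2 2 (by norm_num) (by
    rw [eU_xU, coordHom_apply_sl2E]; simp [Fin.sum_univ_succ]) h3
  have h1 : xU 1 ∈ S := step 2 1 3 (by norm_num) (by
    rw [eU_xU, coordHom_apply_sl2E]; simp [Fin.sum_univ_succ]) h2
  have h0 : xU 0 ∈ S := step 1 0 4 (by norm_num) (by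
    rw [eU_xU, coordHom_apply_sl2E]; simp [Fin.sum_univ_succ]) h1
  have hall : ∀ j, xU j ∈ S := by
    intro j; fin_cases j <;> assumption
  apply mem_of_forall_ι_mem
  intro x
  have : (ι ℂ x : U4) = rU x.left + gU x.right := by
    rw [rU, gU, ← map_add]
    congr 1
    simp
  rw [this, rU_eq_sum, gU_eq]
  exact S.add_mem (S.sum_mem fun j _ => S.smul_mem (hall j) _)
    (S.add_mem (S.add_mem (S.smul_mem he _) (S.smul_mem hh _)) (S.smul_mem hf _))

/-! ### Action formulas -/
section act
variable {M : Type*} [AddCommGroup M] [Module U4 M] [Module ℂ M] [IsScalarTower ℂ U4 M]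

theorem smul_complex_comm (u : U4) (a : ℂ) (m : M) : u • a • m = a • u • m := by
  rw [← algebraMap_smul U4 a m, ← algebraMap_smul U4 a (u • m), smul_smul, smul_smul,
    Algebra.commutes]

/-- The action of an element of `U(𝔏⁴)` as a linear map. -/
noncomputable def act (u : U4) : M →ₗ[ℂ] M where
  toFun m := u • m
  map_add' := smul_add u
  map_smul' a m := smul_complex_comm u a m

theorem act_apply (u : U4) (m : M) : act u m = u • m := rfl

theorem algebraMap_smul_eq (a : ℂ) (m : M) : algebraMap ℂ U4 a • m = a • m := algebraMap_smul U4 a m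

theorem e_f (m : M) : eU • fU • m = fU • eU • m + hU • m := by
  rw [← eU_fU]; simp [sub_smul, mul_smul]
theorem h_e (m : M) : hU • eU • m = eU • hU • m + (2 : ℂ) • eU • m := by
  have h := congrArg (· • m) hU_eU
  simpa [sub_smul, mul_smul, sub_eq_iff_eq_add'] using h
theorem h_f (m : M) : hU • fU • m = fU • hU • m - (2 : ℂ) • fU • m := by
  have h := congrArg (· • m) hU_fU
  simpa [sub_smul, mul_smul, sub_eq_iff_eq_add', ← sub_eq_add_neg] using h
theorem x_x (i j : Fin 5) (m : M) : xU i • xU j • m = xU j • xU i • m := by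
  rw [smul_smul, smul_smul, xU_commute]

theorem e_x0 (m : M) : eU • xU 0 • m = xU 0 • eU • m := by
  have h := congrArg (· • m) (eU_xU 0)
  rw [coordHom_apply_sl2E] at h
  simpa [sub_smul, mul_smul, Fin.sum_univ_succ, sub_eq_zero] using h
theorem e_x1 (m : M) : eU • xU 1 • m = xU 1 • eU • m + (4 : ℂ) • xU 0 • m := by
  have h := congrArg (· • m) (eU_xU 1)
  rw [coordHom_apply_sl2E] at h
  simpa [sub_smul, mul_smul, Fin.sum_univ_succ, sub_eq_iff_eq_add'] using h
theorem e_x2 (m : M) : eU • xU 2 • m = xU 2 • eU • m + (3 : ℂ) • xU 1 • m := by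
  have h := congrArg (· • m) (eU_xU 2)
  rw [coordHom_apply_sl2E] at h
  simpa [sub_smul, mul_smul, Fin.sum_univ_succ, sub_eq_iff_eq_add'] using h
theorem e_x3 (m : M) : eU • xU 3 • m = xU 3 • eU • m + (2 : ℂ) • xU 2 • m := by
  have h := congrArg (· • m) (eU_xU 3)
  rw [coordHom_apply_sl2E] at h
  simpa [sub_smul, mul_smul, Fin.sum_univ_succ, sub_eq_iff_eq_add'] using h
theorem e_x4 (m : M) : eU • xU 4 • m = xU 4 • eU • m + xU 3 • m := by
  have h := congrArg (· • m) (eU_xU 4)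
  rw [coordHom_apply_sl2E] at h
  simpa [sub_smul, mul_smul, Fin.sum_univ_succ, sub_eq_iff_eq_add'] using h
theorem f_x0 (m : M) : fU • xU 0 • m = xU 0 • fU • m + xU 1 • m := by
  have h := congrArg (· • m) (fU_xU 0)
  rw [coordHom_four_sl2F] at h
  simpa [sub_smul, mul_smul, Fin.sum_univ_succ, sub_eq_iff_eq_add'] using h
theorem f_x1 (m : M) : fU • xU 1 • m = xU 1 • fU • m + (2 : ℂ) • xU 2 • m := by
  have h := congrArg (· • m) (fU_xU 1)
  rw [coordHom_four_sl2F] at h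
  simpa [sub_smul, mul_smul, Fin.sum_univ_succ, sub_eq_iff_eq_add'] using h
theorem f_x2 (m : M) : fU • xU 2 • m = xU 2 • fU • m + (3 : ℂ) • xU 3 • m := by
  have h := congrArg (· • m) (fU_xU 2)
  rw [coordHom_four_sl2F] at h
  simpa [sub_smul, mul_smul, Fin.sum_univ_succ, sub_eq_iff_eq_add'] using h
theorem f_x3 (m : M) : fU • xU 3 • m = xU 3 • fU • m + (4 : ℂ) • xU 4 • m := by
  have h := congrArg (· • m) (fU_xU 3)
  rw [coordHom_four_sl2F] at h
  simpa [sub_smul, mul_smul, Fin.sum_univ_succ, sub_eq_iff_eq_add'] using h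
theorem f_x4 (m : M) : fU • xU 4 • m = xU 4 • fU • m := by
  have h := congrArg (· • m) (fU_xU 4)
  rw [coordHom_four_sl2F] at h
  simpa [sub_smul, mul_smul, Fin.sum_univ_succ, sub_eq_zero] using h
theorem h_x (j : Fin 5) (m : M) :
    hU • xU j • m = xU j • hU • m + (4 - 2 * (j : ℕ) : ℂ) • xU j • m := by
  have h := congrArg (· • m) (hU_xU j)
  rw [coordHom_apply_sl2H] at h
  fin_cases j <;> norm_num [sub_smul, mul_smul, Fin.sum_univ_succ, sub_eq_iff_eq_add'] at h ⊢ <;>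
    simpa [sub_eq_add_neg] using h

/-- A `ℂ`-subspace stable under `e`, `f` and `v₋₄` is a submodule. -/
def submoduleOfGens (N : Submodule ℂ M) (he : ∀ m ∈ N, eU • m ∈ N) (hf : ∀ m ∈ N, fU • m ∈ N)
    (hx : ∀ m ∈ N, xU 4 • m ∈ N) : Submodule U4 M where
  carrier := N
  add_mem' := N.add_mem
  zero_mem' := N.zero_mem
  smul_mem' u m hm := by
    let S : Subalgebra ℂ U4 :=
      { carrier := {u | ∀ m ∈ N, u • m ∈ N}
        mul_mem' := fun {u v} hu hv m hm => by rw [mul_smul]; exact hu _ (hv _ hm)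
        add_mem' := fun {u v} hu hv m hm => by rw [add_smul]; exact N.add_mem (hu _ hm) (hv _ hm)
        algebraMap_mem' := fun a m hm => by rw [algebraMap_smul_eq]; exact N.smul_mem a hm }
    exact mem_of_gens S he hf hx u m hm

theorem mem_submoduleOfGens {N : Submodule ℂ M} {he hf hx} {m : M} :
    m ∈ submoduleOfGens N he hf hx ↔ m ∈ N := Iff.rfl

/-- A `ℂ`-linear map commuting with `e`, `f` and `v₋₄` is `U(𝔏⁴)`-linear. -/
def homOfGens {M' : Type*} [AddCommGroup M'] [Module U4 M'] [Module ℂ M'] [IsScalarTower ℂ U4 M']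
    (g : M →ₗ[ℂ] M') (he : ∀ m, g (eU • m) = eU • g m) (hf : ∀ m, g (fU • m) = fU • g m)
    (hx : ∀ m, g (xU 4 • m) = xU 4 • g m) : M →ₗ[U4] M' where
  toFun := g
  map_add' := map_add g
  map_smul' u m := by
    let S : Subalgebra ℂ U4 :=
      { carrier := {u | ∀ m, g (u • m) = u • g m}
        mul_mem' := fun {u v} hu hv m => by rw [mul_smul, hu, hv, mul_smul]
        add_mem' := fun {u v} hu hv m => by rw [add_smul, map_add, hu, hv, add_smul]
        algebraMap_mem' := fun a m => by rw [algebraMap_smul_eq, map_smul, algebraMap_smul_eq] }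
    exact mem_of_gens S he hf hx u m

theorem C2_smul (m : M) : C2 • m = xU 2 • xU 2 • m - (3 : ℂ) • xU 3 • xU 1 • m
    + (12 : ℂ) • xU 4 • xU 0 • m := by
  simp only [C2, v0, v2, v4, vm2, vm4, xU, add_smul, sub_smul, smul_assoc, mul_smul, pow_succ,
    pow_zero, one_mul]

theorem C3_smul (m : M) : C3 • m = xU 2 • xU 2 • xU 2 • m - (9 / 2 : ℂ) • xU 3 • xU 2 • xU 1 • m
    + (27 / 2 : ℂ) • xU 3 • xU 3 • xU 0 • m + (27 / 2 : ℂ) • xU 4 • xU 1 • xU 1 • m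
    - (36 : ℂ) • xU 4 • xU 2 • xU 0 • m := by
  simp only [C3, v0, v2, v4, vm2, vm4, xU, add_smul, sub_smul, smul_assoc, mul_smul, pow_succ,
    pow_zero, one_mul]

end act

/-! ### Constructing modules from operators -/
section ofOps
variable {V : Type*} [AddCommGroup V] [Module ℂ V]

/-- Operators on a vector space satisfying the relations of `𝔏⁴`. -/
structure L4Ops (V : Type*) [AddCommGroup V] [Module ℂ V] where
  E : Module.End ℂ V
  H : Module.End ℂ V
  F : Module.End ℂ V
  X : Fin 5 → Module.End ℂ V
  EF : E * F - F * E = H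
  HE : H * E - E * H = (2 : ℂ) • E
  HF : H * F - F * H = (-2 : ℂ) • F
  XX : ∀ i j, X i * X j = X j * X i
  EX : ∀ j, E * X j - X j * E = ∑ i, coordHom 4 sl2E (Pi.single j 1) i • X i
  HX : ∀ j, H * X j - X j * H = ∑ i, coordHom 4 sl2H (Pi.single j 1) i • X i
  FX : ∀ j, F * X j - X j * F = ∑ i, coordHom 4 sl2F (Pi.single j 1) i • X i

/-- The action of `𝔰𝔩₂`. -/
noncomputable def L4Ops.g (O : L4Ops V) : Sl2 →ₗ[ℂ] Module.End ℂ V where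
  toFun x := x.1 0 1 • O.E + x.1 0 0 • O.H + x.1 1 0 • O.F
  map_add' x y := by
    have h : ∀ i j, (x + y).1 i j = x.1 i j + y.1 i j := fun _ _ => rfl
    simp only [h]; module
  map_smul' c x := by
    have h : ∀ i j, (c • x).1 i j = c * x.1 i j := fun _ _ => rfl
    simp only [h, RingHom.id_apply]; module

/-- The action of `𝔯`. -/
noncomputable def L4Ops.r (O : L4Ops V) : (Fin 5 → ℂ) →ₗ[ℂ] Module.End ℂ V where
  toFun v := ∑ j, v j • O.X j
  map_add' v w := by simp only [Pi.add_apply, add_smul, Finset.sum_add_distrib]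
  map_smul' c v := by simp [Finset.smul_sum, smul_smul]

theorem L4Ops.g_lie (O : L4Ops V) (x y : Sl2) : O.g ⁅x, y⁆ = O.g x * O.g y - O.g y * O.g x := by
  have hx : x.1 1 1 = -x.1 0 0 := by
    have := (mem_sl2_iff x.1).1 x.2
    rw [Matrix.trace_fin_two] at this; linear_combination this
  have hy : y.1 1 1 = -y.1 0 0 := by
    have := (mem_sl2_iff y.1).1 y.2
    rw [Matrix.trace_fin_two] at this; linear_combination this
  have key : O.g x * O.g y - O.g y * O.g x =
      (x.1 0 1 * y.1 1 0 - x.1 1 0 * y.1 0 1) • (O.E * O.F - O.F * O.E)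
      + (x.1 0 0 * y.1 0 1 - x.1 0 1 * y.1 0 0) • (O.H * O.E - O.E * O.H)
      + (x.1 0 0 * y.1 1 0 - x.1 1 0 * y.1 0 0) • (O.H * O.F - O.F * O.H) := by
    simp only [L4Ops.g, LinearMap.coe_mk, AddHom.coe_mk, add_mul, mul_add, smul_mul_assoc,
      mul_smul_comm]
    module
  rw [key, O.EF, O.HE, O.HF]
  simp only [L4Ops.g, LinearMap.coe_mk, AddHom.coe_mk, LieAlgebra.SpecialLinear.sl_bracket,
    Matrix.sub_apply, Matrix.mul_apply, Fin.sum_univ_two, hx, hy]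
  module

theorem L4Ops.g_r (O : L4Ops V) (x : Sl2) (v : Fin 5 → ℂ) :
    O.r (coordHom 4 x v) = O.g x * O.r v - O.r v * O.g x := by
  have hv : v = ∑ j, v j • (Pi.single j 1 : Fin 5 → ℂ) := by
    funext i; simp [Finset.sum_apply, Pi.single_apply]
  have hx : x = x.1 0 1 • sl2E + x.1 0 0 • sl2H + x.1 1 0 • sl2F := by
    have hx : x.1 1 1 = -x.1 0 0 := by
      have := (mem_sl2_iff x.1).1 x.2
      rw [Matrix.trace_fin_two] at this; linear_combination this
    apply Subtype.ext
    ext i j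
    change x.1 i j = x.1 0 1 * sl2E.1 i j + x.1 0 0 * sl2H.1 i j + x.1 1 0 * sl2F.1 i j
    fin_cases i <;> fin_cases j <;> simp [sl2E, sl2H, sl2F, hx]
  have gE : O.g sl2E = O.E := by simp [L4Ops.g, sl2E]
  have gH : O.g sl2H = O.H := by simp [L4Ops.g, sl2H]
  have gF : O.g sl2F = O.F := by simp [L4Ops.g, sl2F]
  have rX : ∀ j, O.r (Pi.single j 1) = O.X j := by
    intro j; simp [L4Ops.r, Pi.single_apply]
  have base : ∀ j, O.r (coordHom 4 x (Pi.single j 1)) = O.g x * O.X j - O.X j * O.g x := by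
    intro j
    have h1 := O.EX j
    have h2 := O.HX j
    have h3 := O.FX j
    have hr : ∀ w : Fin 5 → ℂ, ∑ i, w i • O.X i = O.r w := fun _ => rfl
    rw [hr] at h1 h2 h3
    rw [hx]
    simp only [map_add, map_smul, LinearMap.add_apply,
      LinearMap.smul_apply, gE, gH, gF, ← h1, ← h2, ← h3, add_mul, mul_add, smul_mul_assoc,
      mul_smul_comm]
    module
  conv_lhs => rw [hv]
  conv_rhs => rw [hv]
  simp only [map_sum, map_smul, base, rX, Finset.mul_sum, Finset.sum_mul, smul_sub,
    Finset.sum_sub_distrib, mul_smul_comm, smul_mul_assoc]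

theorem L4Ops.r_comm (O : L4Ops V) (v w : Fin 5 → ℂ) : O.r v * O.r w = O.r w * O.r v := by
  simp only [L4Ops.r, LinearMap.coe_mk, AddHom.coe_mk]
  exact Commute.sum_right _ _ _ fun i _ => Commute.sum_left _ _ _ fun j _ =>
    ((show Commute _ _ from O.XX j i).smul_left _).smul_right _

/-- The action of `𝔯 = L(4)`. -/
noncomputable def L4Ops.rI (O : L4Ops V) : Irrep 4 →ₗ[ℂ] Module.End ℂ V := O.r

theorem L4Ops.g_rI (O : L4Ops V) (x : Sl2) (v : Irrep 4) :
    O.rI (irrepHom 4 x v) = O.g x * O.rI v - O.rI v * O.g x := O.g_r x v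

/-- The representation of `𝔏⁴` given by operators. -/
noncomputable def L4Ops.lieHom (O : L4Ops V) : L4 →ₗ⁅ℂ⁆ Module.End ℂ V where
  toFun x := O.rI x.left + O.g x.right
  map_add' x y := by
    change O.rI (x.left + y.left) + O.g (x.right + y.right) = _
    rw [map_add, map_add]; abel
  map_smul' c x := by
    change O.rI (c • x.left) + O.g (c • x.right) = _
    rw [map_smul, map_smul, RingHom.id_apply, smul_add]
  map_lie' {x y} := by
    have h : ⁅x, y⁆ = (⟨irrepHom 4 x.right y.left - irrepHom 4 y.right x.left,
      ⁅x.right, y.right⁆⟩ : L4) := by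
      change (⟨⁅x.left, y.left⁆ + irrepDer 4 x.right y.left - irrepDer 4 y.right x.left,
        ⁅x.right, y.right⁆⟩ : L4) = _
      rw [irrep_lie, zero_add]; rfl
    rw [h, LieRing.of_associative_ring_bracket, map_sub, O.g_rI, O.g_rI, O.g_lie]
    have : O.rI x.left * O.rI y.left = O.rI y.left * O.rI x.left := O.r_comm x.left y.left
    simp only [add_mul, mul_add, this]
    abel

/-- The algebra homomorphism `U(𝔏⁴) → End V` given by operators. -/
noncomputable def L4Ops.rep (O : L4Ops V) : U4 →ₐ[ℂ] Module.End ℂ V := lift ℂ O.lieHom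

theorem L4Ops.rep_gU (O : L4Ops V) (x : Sl2) : O.rep (gU x) = O.g x := by
  rw [L4Ops.rep, gU, lift_ι_apply]
  change O.rI 0 + O.g x = _
  rw [map_zero, zero_add]

theorem L4Ops.rep_eU (O : L4Ops V) : O.rep eU = O.E := by
  rw [eU, O.rep_gU]; simp [L4Ops.g, sl2E]
theorem L4Ops.rep_hU (O : L4Ops V) : O.rep hU = O.H := by
  rw [hU, O.rep_gU]; simp [L4Ops.g, sl2H]
theorem L4Ops.rep_fU (O : L4Ops V) : O.rep fU = O.F := by
  rw [fU, O.rep_gU]; simp [L4Ops.g, sl2F]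
theorem L4Ops.rep_xU (O : L4Ops V) (j : Fin 5) : O.rep (xU j) = O.X j := by
  rw [L4Ops.rep, xU, rU, lift_ι_apply]
  change O.r (Pi.single j 1) + O.g 0 = _
  rw [map_zero O.g, add_zero]
  simp [L4Ops.r, Pi.single_apply]

end ofOps

/-! ### Centrality of `C₂` and `C₃`, the invariants of a binary quartic -/

section central
variable {M : Type*} [AddCommGroup M] [Module U4 M] [Module ℂ M] [IsScalarTower ℂ U4 M]

theorem C2_e (m : M) : eU • C2 • m = C2 • eU • m := by
  simp only [C2_smul, smul_add, smul_sub, smul_complex_comm eU, e_x0, e_x1, e_x2, e_x3, e_x4,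
    smul_complex_comm (xU _), x_x 0 1, x_x 0 2, x_x 0 3, x_x 0 4, x_x 1 2, x_x 1 3, x_x 1 4,
    x_x 2 3, x_x 2 4, x_x 3 4]
  simp only [← act_apply (M := M)]
  module

theorem C2_f (m : M) : fU • C2 • m = C2 • fU • m := by
  simp only [C2_smul, smul_add, smul_sub, smul_complex_comm fU, f_x0, f_x1, f_x2, f_x3, f_x4,
    smul_complex_comm (xU _), x_x 0 1, x_x 0 2, x_x 0 3, x_x 0 4, x_x 1 2, x_x 1 3, x_x 1 4,
    x_x 2 3, x_x 2 4, x_x 3 4]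
  simp only [← act_apply (M := M)]
  module

theorem C3_e (m : M) : eU • C3 • m = C3 • eU • m := by
  simp only [C3_smul, smul_add, smul_sub, smul_complex_comm eU, e_x0, e_x1, e_x2, e_x3, e_x4,
    smul_complex_comm (xU _), x_x 0 1, x_x 0 2, x_x 0 3, x_x 0 4, x_x 1 2, x_x 1 3, x_x 1 4,
    x_x 2 3, x_x 2 4, x_x 3 4]
  simp only [← act_apply (M := M)]
  module

theorem C3_f (m : M) : fU • C3 • m = C3 • fU • m := by
  simp only [C3_smul, smul_add, smul_sub, smul_complex_comm fU, f_x0, f_x1, f_x2, f_x3, f_x4,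
    smul_complex_comm (xU _), x_x 0 1, x_x 0 2, x_x 0 3, x_x 0 4, x_x 1 2, x_x 1 3, x_x 1 4,
    x_x 2 3, x_x 2 4, x_x 3 4]
  simp only [← act_apply (M := M)]
  module

theorem C2_x4 (m : M) : xU 4 • C2 • m = C2 • xU 4 • m := by
  simp only [C2_smul, smul_add, smul_sub, smul_complex_comm (xU _), x_x 0 1, x_x 0 2, x_x 0 3,
    x_x 0 4, x_x 1 2, x_x 1 3, x_x 1 4, x_x 2 3, x_x 2 4, x_x 3 4]

theorem C3_x4 (m : M) : xU 4 • C3 • m = C3 • xU 4 • m := by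
  simp only [C3_smul, smul_add, smul_sub, smul_complex_comm (xU _), x_x 0 1, x_x 0 2, x_x 0 3,
    x_x 0 4, x_x 1 2, x_x 1 3, x_x 1 4, x_x 2 3, x_x 2 4, x_x 3 4]

end central

/-- The centralizer of `C₂` is a subalgebra, so it is enough to commute with `e`, `f`, `v₋₄`; the
module identities above are read off at `1` in the regular module. -/
theorem C2_central (u : U4) : u * C2 = C2 * u := by
  have := mem_of_gens (Subalgebra.centralizer ℂ {C2})
    (by simpa [Subalgebra.mem_centralizer_iff] using (C2_e (1 : U4)).symm)
    (by simpa [Subalgebra.mem_centralizer_iff] using (C2_f (1 : U4)).symm)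
    (by simpa [Subalgebra.mem_centralizer_iff] using (C2_x4 (1 : U4)).symm) u
  exact (Subalgebra.mem_centralizer_iff ℂ).1 this C2 rfl |>.symm

theorem C3_central (u : U4) : u * C3 = C3 * u := by
  have := mem_of_gens (Subalgebra.centralizer ℂ {C3})
    (by simpa [Subalgebra.mem_centralizer_iff] using (C3_e (1 : U4)).symm)
    (by simpa [Subalgebra.mem_centralizer_iff] using (C3_f (1 : U4)).symm)
    (by simpa [Subalgebra.mem_centralizer_iff] using (C3_x4 (1 : U4)).symm) u
  exact (Subalgebra.mem_centralizer_iff ℂ).1 this C3 rfl |>.symm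

/-! ### Modules from Weyl algebra operators -/

/-- Operators on a vector space satisfying the relations of the second Weyl algebra, with
coordinates `S`, `T` and derivations `P`, `Q`. -/
structure WeylOps (V : Type*) [AddCommGroup V] [Module ℂ V] where
  S : Module.End ℂ V
  P : Module.End ℂ V
  T : Module.End ℂ V
  Q : Module.End ℂ V
  PS : P * S = S * P + 1
  QT : Q * T = T * Q + 1
  TS : T * S = S * T
  QS : Q * S = S * Q
  PT : P * T = T * P
  QP : Q * P = P * Q

section weyl
variable {V : Type*} [AddCommGroup V] [Module ℂ V]

/-- The functions by which `𝔯` acts. -/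
def WeylOps.X (W : WeylOps V) (c : ℂ) : Fin 5 → Module.End ℂ V :=
  -- Entry `j` is the value, at the point of `𝔯*` whose only nonzero coordinate is `v₀ = c`, of
  -- `Ad(exp(se) exp(tf)) v_{4-2j}`. For instance `v₋₄` is fixed by `f` and `exp(se)` gives it the
  -- `v₀`-coefficient `s²`.
  ![c • (W.T * W.T + (2 : ℂ) • (W.S * W.T * W.T * W.T) + W.S * W.S * W.T * W.T * W.T * W.T),
    c • ((2 : ℂ) • W.T + (6 : ℂ) • (W.S * W.T * W.T) + (4 : ℂ) • (W.S * W.S * W.T * W.T * W.T)),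
    c • (1 + (6 : ℂ) • (W.S * W.T) + (6 : ℂ) • (W.S * W.S * W.T * W.T)),
    c • ((2 : ℂ) • W.S + (4 : ℂ) • (W.S * W.S * W.T)),
    c • (W.S * W.S)]

theorem WeylOps.commute_X (W : WeylOps V) (c : ℂ) (A : Module.End ℂ V) (hS : Commute A W.S)
    (hT : Commute A W.T) (j : Fin 5) : Commute A (W.X c j) := by
  fin_cases j <;> simp only [WeylOps.X] <;> refine Commute.smul_right ?_ c
  · exact ((hT.mul_right hT).add_right
      ((((hS.mul_right hT).mul_right hT).mul_right hT).smul_right _)).add_right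
      (((((hS.mul_right hS).mul_right hT).mul_right hT).mul_right hT).mul_right hT)
  · exact ((hT.smul_right _).add_right (((hS.mul_right hT).mul_right hT).smul_right _)).add_right
      (((((hS.mul_right hS).mul_right hT).mul_right hT).mul_right hT).smul_right _)
  · exact ((Commute.one_right A).add_right ((hS.mul_right hT).smul_right _)).add_right
      ((((hS.mul_right hS).mul_right hT).mul_right hT).smul_right _)
  · exact (hS.smul_right _).add_right (((hS.mul_right hS).mul_right hT).smul_right _)
  · exact hS.mul_right hS

theorem WeylOps.X_commute (W : WeylOps V) (c : ℂ) (i j : Fin 5) :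
    Commute (W.X c i) (W.X c j) := by
  have hST : Commute W.S W.T := W.TS.symm
  exact W.commute_X c _ (W.commute_X c W.S (Commute.refl _) hST i).symm
    (W.commute_X c W.T hST.symm (Commute.refl _) i).symm j

/-- The operators of `𝔏⁴` defined by Weyl algebra operators. -/
def WeylOps.toL4Ops (W : WeylOps V) (i c : ℂ) : L4Ops V :=
  -- Each relation is repeated with a trailing factor, so that rewriting right-nested products
  -- reaches the normal order `S, T, P, Q`.
  have PS' (A : Module.End ℂ V) : W.P * (W.S * A) = W.S * (W.P * A) + A := by
    rw [← mul_assoc, W.PS, add_mul, one_mul, mul_assoc]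
  have QT' (A : Module.End ℂ V) : W.Q * (W.T * A) = W.T * (W.Q * A) + A := by
    rw [← mul_assoc, W.QT, add_mul, one_mul, mul_assoc]
  have TS' (A : Module.End ℂ V) : W.T * (W.S * A) = W.S * (W.T * A) := by
    rw [← mul_assoc, W.TS, mul_assoc]
  have QS' (A : Module.End ℂ V) : W.Q * (W.S * A) = W.S * (W.Q * A) := by
    rw [← mul_assoc, W.QS, mul_assoc]
  have PT' (A : Module.End ℂ V) : W.P * (W.T * A) = W.T * (W.P * A) := by
    rw [← mul_assoc, W.PT, mul_assoc]
  have QP' (A : Module.End ℂ V) : W.Q * (W.P * A) = W.P * (W.Q * A) := by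
    rw [← mul_assoc, W.QP, mul_assoc]
  -- These are the vector fields of `e`, `h`, `f` in the coordinates `exp(se) exp(tf)`, twisted by
  -- the weight `i`.
  { E := W.P - i • W.T + (2 : ℂ) • (W.S * W.T * W.P) - W.T * W.T * W.Q
    H := i • 1 - (2 : ℂ) • (W.S * W.P) + (2 : ℂ) • (W.T * W.Q)
    F := W.Q
    X := W.X c
    EF := by
      simp only [mul_assoc, mul_add, add_mul, mul_sub, sub_mul, smul_mul_assoc, mul_smul_comm,
        W.PS, W.QT, W.TS, W.QS, W.PT, W.QP, PS', QT', TS', QS', PT', QP', mul_one, one_mul]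
      module
    HE := by
      simp only [mul_assoc, mul_add, add_mul, mul_sub, sub_mul, smul_mul_assoc, mul_smul_comm,
        W.PS, W.QT, W.TS, W.QS, W.PT, W.QP, PS', QT', TS', QS', PT', QP', mul_one, one_mul]
      module
    HF := by
      simp only [mul_assoc, mul_add, add_mul, mul_sub, sub_mul, smul_mul_assoc, mul_smul_comm,
        W.PS, W.QT, W.TS, W.QS, W.PT, W.QP, PS', QT', TS', QS', PT', QP', mul_one, one_mul]
      module
    XX := W.X_commute c
    EX := by
      intro j
      rw [coordHom_apply_sl2E]
      fin_cases j <;> simp [Fin.sum_univ_succ] <;> simp only [WeylOps.X, mul_assoc, mul_add,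
        add_mul, mul_sub, sub_mul, smul_mul_assoc, mul_smul_comm, W.PS, W.QT, W.TS, W.QS, W.PT,
        W.QP, PS', QT', TS', QS', PT', QP', mul_one, one_mul, Matrix.cons_val, smul_add] <;> module
    HX := by
      intro j
      rw [coordHom_apply_sl2H]
      fin_cases j <;> simp [Fin.sum_univ_succ] <;> simp only [WeylOps.X, mul_assoc, mul_add,
        add_mul, mul_sub, sub_mul, smul_mul_assoc, mul_smul_comm, W.PS, W.QT, W.TS, W.QS, W.PT,
        W.QP, PS', QT', TS', QS', PT', QP', mul_one, one_mul, Matrix.cons_val, smul_add] <;> module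
    FX := by
      intro j
      rw [coordHom_four_sl2F]
      fin_cases j <;> simp [Fin.sum_univ_succ] <;> simp only [WeylOps.X, mul_assoc, mul_add,
        add_mul, mul_sub, sub_mul, smul_mul_assoc, mul_smul_comm, W.PS, W.QT, W.TS, W.QS, W.PT,
        W.QP, PS', QT', TS', QS', PT', QP', mul_one, one_mul, Matrix.cons_val, smul_add] <;> module }

end weyl

/-! ### The coinduced module of power series -/

/-- The Weyl algebra acting on power series in `s`, `t`, written in divided power coordinates. -/
def seriesOps : WeylOps (ℕ → ℕ → ℂ) where
  -- An array `a` stands for `∑ a j k sʲtᵏ / (j! k!)`, so the derivations are shifts. The truncated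
  -- `j - 1` at `j = 0` is harmless because of the factor `j`.
  S := { toFun := fun a j k => j * a (j - 1) k
         map_add' := fun a b => by funext j k; simp [mul_add]
         map_smul' := fun r a => by funext j k; simp; ring }
  P := { toFun := fun a j k => a (j + 1) k
         map_add' := fun a b => rfl
         map_smul' := fun r a => rfl }
  T := { toFun := fun a j k => k * a j (k - 1)
         map_add' := fun a b => by funext j k; simp [mul_add]
         map_smul' := fun r a => by funext j k; simp; ring }
  Q := { toFun := fun a j k => a j (k + 1)
         map_add' := fun a b => rfl
         map_smul' := fun r a => rfl }
  PS := by
    ext a j k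
    rcases j with _ | j <;> simp
    ring
  QT := by
    ext a j k
    rcases k with _ | k <;> simp
    ring
  TS := by ext a j k; simp; ring
  QS := by ext a j k; simp
  PT := by ext a j k; simp
  QP := by ext a j k; simp

/-- The module of power series coinduced from the character of weight `i` of `h` and the point
`c` of `𝔯*` with only nonzero coordinate `v₀`. -/
def Series (_ _ : ℂ) : Type := ℕ → ℕ → ℂ

section series
variable {i c : ℂ}

instance : AddCommGroup (Series i c) := inferInstanceAs (AddCommGroup (ℕ → ℕ → ℂ))
noncomputable instance : Module ℂ (Series i c) := inferInstanceAs (Module ℂ (ℕ → ℕ → ℂ))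
noncomputable instance : Module U4 (Series i c) :=
  Module.compHom (ℕ → ℕ → ℂ) (seriesOps.toL4Ops i c).rep.toRingHom

theorem Series.smul_def (u : U4) (a : Series i c) :
    u • a = (seriesOps.toL4Ops i c).rep u a := rfl

instance : IsScalarTower ℂ U4 (Series i c) := ⟨fun r u a => by
  simp only [Series.smul_def, map_smul]; rfl⟩

theorem Series.complex_smul_apply (r : ℂ) (a : Series i c) (j k : ℕ) :
    (r • a) j k = r * a j k := rfl

theorem Series.f_apply (a : Series i c) (j k : ℕ) : (fU • a) j k = a j (k + 1) := by
  rw [Series.smul_def, L4Ops.rep_fU]; rfl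

theorem Series.h_apply (a : Series i c) (j k : ℕ) :
    (hU • a) j k = (i - 2 * j + 2 * k) * a j k := by
  rw [Series.smul_def, L4Ops.rep_hU]
  change i * a j k - 2 * (j * a (j - 1 + 1) k) + 2 * (k * a j (k - 1 + 1)) = _
  rcases j with _ | j <;> rcases k with _ | k <;> simp <;> ring

theorem Series.e_apply (a : Series i c) (j k : ℕ) :
    (eU • a) j k = a (j + 1) k - k * (i - 2 * j + k - 1) * a j (k - 1) := by
  rw [Series.smul_def, L4Ops.rep_eU]
  change a (j + 1) k - i * (k * a j (k - 1)) + 2 * (j * (k * a (j - 1 + 1) (k - 1)))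
    - k * ((k - 1 : ℕ) * a j (k - 1 - 1 + 1)) = _
  rcases j with _ | j <;> rcases k with _ | _ | k <;> simp <;> ring

theorem Series.x4_apply (a : Series i c) (j k : ℕ) :
    (xU 4 • a) j k = c * (j * (j - 1) * a (j - 2) k) := by
  rw [Series.smul_def, L4Ops.rep_xU]
  change c * (j * ((j - 1 : ℕ) * a (j - 1 - 1) k)) = _
  rcases j with _ | _ | j
  · simp
  · simp
  · simp only [add_tsub_cancel_right, Nat.reduceSubDiff, tsub_zero]; push_cast; ring_nf

/-- The monomial `sʲ tᵏ`. -/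
def mono (i c : ℂ) (j k : ℕ) : Series i c :=
  fun j' k' => if j' = j ∧ k' = k then j.factorial * k.factorial else 0

/-- Multiplication by `s`. -/
def Series.S : Module.End ℂ (Series i c) := seriesOps.S
/-- Multiplication by `t`. -/
def Series.T : Module.End ℂ (Series i c) := seriesOps.T
/-- The derivation `∂/∂s`. -/
def Series.P : Module.End ℂ (Series i c) := seriesOps.P
/-- The derivation `∂/∂t`. -/
def Series.Q : Module.End ℂ (Series i c) := seriesOps.Q

theorem S_mono (j k : ℕ) : Series.S (mono i c j k) = mono i c (j + 1) k := by
  funext j' k'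
  change (j' : ℂ) * (if j' - 1 = j ∧ k' = k then _ else _) = if _ then _ else _
  rcases j' with _ | j'
  · simp
  · simp only [add_tsub_cancel_right, add_left_inj, mul_ite, mul_zero, Nat.factorial_succ]
    split_ifs with h
    · rw [h.1]; push_cast; ring
    · rfl

theorem T_mono (j k : ℕ) : Series.T (mono i c j k) = mono i c j (k + 1) := by
  funext j' k'
  change (k' : ℂ) * (if j' = j ∧ k' - 1 = k then _ else _) = if _ then _ else _
  rcases k' with _ | k'
  · simp
  · simp only [add_tsub_cancel_right, add_left_inj, mul_ite, mul_zero, Nat.factorial_succ]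
    split_ifs with h
    · rw [h.2]; push_cast; ring
    · rfl

theorem f_mono (j k : ℕ) : fU • mono i c j k = (k : ℂ) • mono i c j (k - 1) := by
  funext j' k'
  rw [Series.f_apply, Series.complex_smul_apply]
  rcases k with _ | k
  · simp [mono]
  · simp only [mono, add_left_inj, add_tsub_cancel_right, mul_ite, mul_zero]
    split_ifs
    · rw [Nat.factorial_succ]; push_cast; ring
    · rfl

theorem h_mono (j k : ℕ) : hU • mono i c j k = (i - 2 * j + 2 * k) • mono i c j k := by
  funext j' k'
  rw [Series.h_apply, Series.complex_smul_apply]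
  simp only [mono]
  split_ifs with h
  · rw [h.1, h.2]
  · simp

theorem P_mono (j k : ℕ) : Series.P (mono i c j k) = (j : ℂ) • mono i c (j - 1) k := by
  funext j' k'
  change (if j' + 1 = j ∧ k' = k then _ else _) = (j : ℂ) * (if _ then _ else _)
  rcases j with _ | j
  · simp
  · simp only [add_tsub_cancel_right, add_left_inj, mul_ite, mul_zero, Nat.factorial_succ]
    split_ifs with h
    · push_cast; ring
    · rfl

theorem Q_mono (j k : ℕ) : Series.Q (mono i c j k) = (k : ℂ) • mono i c j (k - 1) := by
  rw [← f_mono, Series.smul_def, L4Ops.rep_fU]; rfl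

theorem e_mono (j k : ℕ) : eU • mono i c j k
    = (j : ℂ) • mono i c (j - 1) k + (2 * j - i - k) • mono i c j (k + 1) := by
  rw [Series.smul_def, L4Ops.rep_eU]
  change (Series.P (mono i c j k)) - i • (Series.T (mono i c j k))
    + (2 : ℂ) • (Series.S (Series.T (Series.P (mono i c j k))))
    - Series.T (Series.T (Series.Q (mono i c j k))) = _
  rw [T_mono, P_mono, map_smul, T_mono, map_smul, S_mono, Q_mono, map_smul, T_mono, map_smul,
    T_mono]
  rcases j with _ | j <;> rcases k with _ | k <;>
    simp only [add_tsub_cancel_right, Nat.cast_zero, zero_smul, add_zero, Nat.cast_add,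
      Nat.cast_one] <;> module

theorem x4_mono (j k : ℕ) : xU 4 • mono i c j k = c • mono i c (j + 2) k := by
  rw [Series.smul_def, L4Ops.rep_xU]
  change c • Series.S (Series.S (mono i c j k)) = _
  rw [S_mono, S_mono]

theorem x3_mono (j k : ℕ) : xU 3 • mono i c j k
    = c • ((2 : ℂ) • mono i c (j + 1) k + (4 : ℂ) • mono i c (j + 2) (k + 1)) := by
  rw [Series.smul_def, L4Ops.rep_xU]
  change c • ((2 : ℂ) • Series.S (mono i c j k)
    + (4 : ℂ) • Series.S (Series.S (Series.T (mono i c j k)))) = _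
  simp only [S_mono, T_mono]

theorem x2_mono (j k : ℕ) : xU 2 • mono i c j k
    = c • (mono i c j k + (6 : ℂ) • mono i c (j + 1) (k + 1)
      + (6 : ℂ) • mono i c (j + 2) (k + 2)) := by
  rw [Series.smul_def, L4Ops.rep_xU]
  change c • (mono i c j k + (6 : ℂ) • Series.S (Series.T (mono i c j k))
    + (6 : ℂ) • Series.S (Series.S (Series.T (Series.T (mono i c j k))))) = _
  simp only [S_mono, T_mono]

theorem x1_mono (j k : ℕ) : xU 1 • mono i c j k
    = c • ((2 : ℂ) • mono i c j (k + 1) + (6 : ℂ) • mono i c (j + 1) (k + 2)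
      + (4 : ℂ) • mono i c (j + 2) (k + 3)) := by
  rw [Series.smul_def, L4Ops.rep_xU]
  change c • ((2 : ℂ) • Series.T (mono i c j k)
    + (6 : ℂ) • Series.S (Series.T (Series.T (mono i c j k)))
    + (4 : ℂ) • Series.S (Series.S (Series.T (Series.T (Series.T
      (mono i c j k)))))) = _
  simp only [S_mono, T_mono]

theorem x0_mono (j k : ℕ) : xU 0 • mono i c j k
    = c • (mono i c j (k + 2) + (2 : ℂ) • mono i c (j + 1) (k + 3)
      + mono i c (j + 2) (k + 4)) := by
  rw [Series.smul_def, L4Ops.rep_xU]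
  change c • (Series.T (Series.T (mono i c j k))
    + (2 : ℂ) • Series.S (Series.T (Series.T (Series.T (mono i c j k))))
    + Series.S (Series.S (Series.T (Series.T (Series.T (Series.T
      (mono i c j k))))))) = _
  simp only [S_mono, T_mono]

end series

/-! ### The module of distributions, and its localization -/

/-- The monomial `sᵃ yᵇ`. -/
noncomputable def laurentMono (a : ℕ) (b : ℤ) : ℕ × ℤ →₀ ℂ := Finsupp.single (a, b) 1

/-- Multiplication by `s` on `ℂ[s, y, y⁻¹]`. -/
noncomputable def laurentS : Module.End ℂ (ℕ × ℤ →₀ ℂ) :=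
  Finsupp.linearCombination ℂ fun p => laurentMono (p.1 + 1) p.2
/-- The derivation `∂/∂s` on `ℂ[s, y, y⁻¹]`. -/
noncomputable def laurentP : Module.End ℂ (ℕ × ℤ →₀ ℂ) :=
  Finsupp.linearCombination ℂ fun p => (p.1 : ℂ) • laurentMono (p.1 - 1) p.2
/-- The operator `-∂/∂y` on `ℂ[s, y, y⁻¹]`. -/
noncomputable def laurentT : Module.End ℂ (ℕ × ℤ →₀ ℂ) :=
  Finsupp.linearCombination ℂ fun p => (-p.2 : ℂ) • laurentMono p.1 (p.2 - 1)
/-- Multiplication by `y` on `ℂ[s, y, y⁻¹]`. -/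
noncomputable def laurentQ : Module.End ℂ (ℕ × ℤ →₀ ℂ) :=
  Finsupp.linearCombination ℂ fun p => laurentMono p.1 (p.2 + 1)

theorem laurentS_mono (a : ℕ) (b : ℤ) :
    laurentS (laurentMono a b) = laurentMono (a + 1) b := by
  rw [laurentS]
  conv_lhs => rw [laurentMono, Finsupp.linearCombination_single, one_smul]
theorem laurentP_mono (a : ℕ) (b : ℤ) :
    laurentP (laurentMono a b) = (a : ℂ) • laurentMono (a - 1) b := by
  rw [laurentP]
  conv_lhs => rw [laurentMono, Finsupp.linearCombination_single, one_smul]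
theorem laurentT_mono (a : ℕ) (b : ℤ) :
    laurentT (laurentMono a b) = (-b : ℂ) • laurentMono a (b - 1) := by
  rw [laurentT]
  conv_lhs => rw [laurentMono, Finsupp.linearCombination_single, one_smul]
theorem laurentQ_mono (a : ℕ) (b : ℤ) :
    laurentQ (laurentMono a b) = laurentMono a (b + 1) := by
  rw [laurentQ]
  conv_lhs => rw [laurentMono, Finsupp.linearCombination_single, one_smul]

theorem laurent_ext {A B : Module.End ℂ (ℕ × ℤ →₀ ℂ)}
    (h : ∀ a b, A (laurentMono a b) = B (laurentMono a b)) : A = B :=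
  Finsupp.lhom_ext' fun ⟨a, b⟩ => LinearMap.ext_ring (h a b)

/-- The Weyl algebra acting on `ℂ[s, y, y⁻¹]`, where `t = -∂/∂y` and `∂/∂t = y`. -/
noncomputable def laurentOps : WeylOps (ℕ × ℤ →₀ ℂ) where
  S := laurentS
  P := laurentP
  T := laurentT
  Q := laurentQ
  PS := laurent_ext fun a b => by
    simp only [Module.End.mul_apply, LinearMap.add_apply, Module.End.one_apply, laurentS_mono,
      laurentP_mono, map_smul, add_tsub_cancel_right]
    rcases a with _ | a
    · simp
    · simp only [add_tsub_cancel_right]; push_cast; module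
  QT := laurent_ext fun a b => by
    simp only [Module.End.mul_apply, LinearMap.add_apply, Module.End.one_apply, laurentQ_mono,
      laurentT_mono, map_smul, add_sub_cancel_right, sub_add_cancel]
    push_cast; module
  TS := laurent_ext fun a b => by
    simp only [Module.End.mul_apply, laurentS_mono, laurentT_mono, map_smul]
  QS := laurent_ext fun a b => by
    simp only [Module.End.mul_apply, laurentS_mono, laurentQ_mono]
  PT := laurent_ext fun a b => by
    simp only [Module.End.mul_apply, laurentP_mono, laurentT_mono, map_smul]
    module
  QP := laurent_ext fun a b => by
    simp only [Module.End.mul_apply, laurentP_mono, laurentQ_mono, map_smul]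

/-- The module `ℂ[s, y, y⁻¹]`. -/
def Laurent (_ _ : ℂ) : Type := ℕ × ℤ →₀ ℂ

section laurent
variable {i c : ℂ}

noncomputable instance : AddCommGroup (Laurent i c) := inferInstanceAs (AddCommGroup (ℕ × ℤ →₀ ℂ))
noncomputable instance : Module ℂ (Laurent i c) := inferInstanceAs (Module ℂ (ℕ × ℤ →₀ ℂ))
noncomputable instance : Module U4 (Laurent i c) :=
  Module.compHom (ℕ × ℤ →₀ ℂ) (laurentOps.toL4Ops i c).rep.toRingHom

theorem Laurent.smul_def (u : U4) (a : Laurent i c) :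
    u • a = (laurentOps.toL4Ops i c).rep u a := rfl

instance : IsScalarTower ℂ U4 (Laurent i c) := ⟨fun r u a => by
  simp only [Laurent.smul_def, map_smul]; rfl⟩

end laurent

/-! ### Lowest weight vectors and powers of `e` and `f` -/

section sl2
variable {M : Type*} [AddCommGroup M] [Module U4 M] [Module ℂ M] [IsScalarTower ℂ U4 M]

theorem h_e_pow (k : ℕ) (m : M) :
    hU • eU ^ k • m = eU ^ k • hU • m + (2 * k : ℂ) • eU ^ k • m := by
  induction k with
  | zero => simp
  | succ k ih =>
    rw [pow_succ', mul_smul eU, h_e, ih, mul_smul eU, smul_add, smul_complex_comm]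
    push_cast
    simp only [← act_apply (M := M)]
    module

theorem h_f_pow (k : ℕ) (m : M) :
    hU • fU ^ k • m = fU ^ k • hU • m - (2 * k : ℂ) • fU ^ k • m := by
  induction k with
  | zero => simp
  | succ k ih =>
    rw [pow_succ', mul_smul fU, h_f, ih, mul_smul fU, smul_sub, smul_complex_comm]
    push_cast
    simp only [← act_apply (M := M)]
    module

theorem f_e (m : M) : fU • eU • m = eU • fU • m - hU • m := by
  rw [e_f]; abel

theorem f_pow_e (k : ℕ) (m : M) : fU ^ k • eU • m
    = eU • fU ^ k • m - (k : ℂ) • hU • fU ^ (k - 1) • m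
      - (k * (k - 1) : ℂ) • fU ^ (k - 1) • m := by
  induction k with
  | zero => simp
  | succ k ih =>
    rw [pow_succ', mul_smul fU, ih, smul_sub, smul_sub, smul_complex_comm, smul_complex_comm, f_e,
      mul_smul fU, add_tsub_cancel_right]
    rcases k with _ | k
    · simp
    · have h := h_f (fU ^ k • m)
      rw [← mul_smul fU, ← pow_succ'] at h
      simp only [add_tsub_cancel_right]
      rw [← mul_smul fU (fU ^ k), ← pow_succ', ← sub_eq_zero]
      have h2 : fU • hU • fU ^ k • m = hU • fU ^ (k + 1) • m + (2 : ℂ) • fU ^ (k + 1) • m := by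
        rw [h]; abel
      rw [h2]
      push_cast
      simp only [← act_apply (M := M)]
      module

/-- `y` is a lowest weight vector of weight `-N`. -/
def IsLowest (N : ℂ) (y : M) : Prop := fU • y = 0 ∧ hU • y = -N • y

theorem IsLowest.h_e_pow {N : ℂ} {y : M} (hy : IsLowest N y) (k : ℕ) :
    hU • eU ^ k • y = (2 * k - N : ℂ) • eU ^ k • y := by
  rw [ConformalGalilei.h_e_pow, hy.2, smul_complex_comm, ← add_smul]; ring_nf

theorem IsLowest.f_e_pow {N : ℂ} {y : M} (hy : IsLowest N y) (k : ℕ) :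
    fU • eU ^ (k + 1) • y = ((k + 1) * (N - k) : ℂ) • eU ^ k • y := by
  induction k with
  | zero => simp [f_e, hy.1, hy.2]
  | succ k ih =>
    rw [pow_succ', mul_smul, f_e, ih, hy.h_e_pow, smul_complex_comm, ← mul_smul, ← pow_succ',
      ← sub_smul]
    congr 1
    push_cast; ring

end sl2

/-! ### The modules `L(n)` -/
section irrep

theorem ι_smul_irrep (n : ℕ) (x : Sl2) (w : Irrep n) :
    (ι ℂ x : Ug) • w = irrepHom n x w := by
  change lift ℂ (irrepHom n) (ι ℂ x) w = _
  rw [lift_ι_apply]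

instance (n : ℕ) : IsScalarTower ℂ Ug (Irrep n) := ⟨fun r u w => by
  change lift ℂ (irrepHom n) (r • u) w = r • lift ℂ (irrepHom n) u w
  rw [map_smul]; rfl⟩

instance (V : Type*) [AddCommGroup V] [Module ℂ V] : Module ℂ (ResG V) :=
  inferInstanceAs (Module ℂ V)

/-- The identity map to the restriction. -/
def toResG (V : Type*) [AddCommGroup V] [Module ℂ V] : V ≃ₗ[ℂ] ResG V := LinearEquiv.refl ℂ V

theorem toResG_gU_smul {V : Type*} [AddCommGroup V] [Module U4 V] [Module ℂ V] (x : Sl2) (v : V) :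
    toResG V (gU x • v) = (ι ℂ x : Ug) • toResG V v := by
  change _ = ugToU4 (ι ℂ x) • v
  rw [ugToU4, lift_ι_apply]; rfl

instance (V : Type*) [AddCommGroup V] [Module U4 V] [Module ℂ V] [IsScalarTower ℂ U4 V] :
    IsScalarTower ℂ Ug (ResG V) := ⟨fun r u v => by
  change ugToU4 (r • u) • (show V from v) = r • ugToU4 u • (show V from v)
  rw [map_smul, smul_assoc]⟩

theorem sl2_eq (x : Sl2) : x = x.1 0 1 • sl2E + x.1 0 0 • sl2H + x.1 1 0 • sl2F := by
  have hx : x.1 1 1 = -x.1 0 0 := by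
    have := (mem_sl2_iff x.1).1 x.2
    rw [Matrix.trace_fin_two] at this; linear_combination this
  apply Subtype.ext
  ext i j
  change x.1 i j = x.1 0 1 * sl2E.1 i j + x.1 0 0 * sl2H.1 i j + x.1 1 0 * sl2F.1 i j
  fin_cases i <;> fin_cases j <;> simp [sl2E, sl2H, sl2F, hx]

/-- A subalgebra of `U(𝔤)` containing `e`, `f` is everything. -/
theorem mem_of_gens_sl2 (S : Subalgebra ℂ Ug) (he : ι ℂ sl2E ∈ S) (hf : ι ℂ sl2F ∈ S)
    (u : Ug) : u ∈ S := by
  have hh : ι ℂ sl2H ∈ S := by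
    rw [← lie_sl2E_sl2F, LieHom.map_lie, LieRing.of_associative_ring_bracket]
    exact S.sub_mem (S.mul_mem he hf) (S.mul_mem hf he)
  apply mem_of_forall_ι_mem
  intro x
  rw [sl2_eq x, map_add, map_add, map_smul, map_smul, map_smul]
  exact S.add_mem (S.add_mem (S.smul_mem he _) (S.smul_mem hh _)) (S.smul_mem hf _)

section homs
variable {A B : Type*} [AddCommGroup A] [Module Ug A] [Module ℂ A] [IsScalarTower ℂ Ug A]
  [AddCommGroup B] [Module Ug B] [Module ℂ B] [IsScalarTower ℂ Ug B]

/-- A `ℂ`-linear map commuting with `e`, `f` is `U(𝔤)`-linear. -/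
def homOfGensSl2 (g : A →ₗ[ℂ] B) (he : ∀ m, g ((ι ℂ sl2E : Ug) • m) = (ι ℂ sl2E : Ug) • g m)
    (hf : ∀ m, g ((ι ℂ sl2F : Ug) • m) = (ι ℂ sl2F : Ug) • g m) : A →ₗ[Ug] B where
  toFun := g
  map_add' := map_add g
  map_smul' u m := by
    let S : Subalgebra ℂ Ug :=
      { carrier := {u | ∀ m, g (u • m) = u • g m}
        mul_mem' := fun {u v} hu hv m => by rw [mul_smul, hu, hv, mul_smul]
        add_mem' := fun {u v} hu hv m => by rw [add_smul, map_add, hu, hv, add_smul]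
        algebraMap_mem' := fun a m => by rw [algebraMap_smul, map_smul, algebraMap_smul] }
    exact mem_of_gens_sl2 S he hf u m

end homs

theorem irrepE_apply (n : ℕ) (w : Irrep n) (i : Fin (n + 1)) :
    (irrepHom n sl2E w : Irrep n) i = ∑ j, matE n i j * w j := by
  change (matSl2 n sl2E).mulVec w i = _
  simp [matSl2, sl2E, Matrix.mulVec, dotProduct]

theorem irrepF_apply (n : ℕ) (w : Irrep n) (i : Fin (n + 1)) :
    (irrepHom n sl2F w : Irrep n) i = ∑ j, matF n i j * w j := by
  change (matSl2 n sl2F).mulVec w i = _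
  simp [matSl2, sl2F, Matrix.mulVec, dotProduct]

theorem irrepH_apply (n : ℕ) (w : Irrep n) (i : Fin (n + 1)) :
    (irrepHom n sl2H w : Irrep n) i = (n - 2 * (i : ℕ)) * w i := by
  change (matSl2 n sl2H).mulVec w i = _
  simp only [matSl2, sl2H, matH, Matrix.of_apply, Matrix.cons_val, zero_smul, one_smul, zero_add,
    add_zero]
  exact Matrix.mulVec_diagonal _ _ _

theorem irrepF_succ (n : ℕ) (w : Irrep n) (k : ℕ) (hk : k + 1 < n + 1) :
    (irrepHom n sl2F w : Irrep n) ⟨k + 1, hk⟩ = (k + 1) * w ⟨k, by omega⟩ := by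
  rw [irrepF_apply, Finset.sum_eq_single (⟨k, by omega⟩ : Fin (n + 1))]
  · simp [matF]
  · intro j _ hj
    have : k ≠ j := fun h => hj (Fin.ext h.symm)
    simp [matF, this]
  · simp

theorem irrepF_zero (n : ℕ) (w : Irrep n) :
    (irrepHom n sl2F w : Irrep n) 0 = 0 := by
  rw [irrepF_apply, Finset.sum_eq_zero]
  intro j _
  simp [matF]

theorem irrepE_apply_lt (n : ℕ) (w : Irrep n) (k : ℕ) (hk : k + 1 < n + 1) :
    (irrepHom n sl2E w : Irrep n) ⟨k, by omega⟩ = (n - k) * w ⟨k + 1, hk⟩ := by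
  rw [irrepE_apply, Finset.sum_eq_single (⟨k + 1, by omega⟩ : Fin (n + 1))]
  · simp [matE]
  · intro j _ hj
    have : (j : ℕ) ≠ k + 1 := fun h => hj (Fin.ext h)
    simp [matE, this]
  · simp

theorem irrepE_apply_last (n : ℕ) (w : Irrep n) :
    (irrepHom n sl2E w : Irrep n) (Fin.last n) = 0 := by
  rw [irrepE_apply, Finset.sum_eq_zero]
  intro j _
  have : (j : ℕ) ≠ n + 1 := by omega
  simp [matE, this]

theorem irrepF_pow_apply (n m : ℕ) : ∀ (w : Irrep n) (i : Fin (n + 1)), (i : ℕ) < m →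
    ((ι ℂ sl2F : Ug) ^ m • w : Irrep n) i = 0 := by
  induction m with
  | zero => intro w i hi; omega
  | succ m ih =>
    intro w i hi
    rw [pow_succ', mul_smul, ι_smul_irrep]
    obtain ⟨k, hk⟩ := i
    rcases k with _ | k
    · exact irrepF_zero n _
    · rw [irrepF_succ, ih w ⟨k, by omega⟩ (by simp at hi ⊢; omega), mul_zero]

theorem irrepF_pow_eq_zero (n : ℕ) (w : Irrep n) : (ι ℂ sl2F : Ug) ^ (n + 1) • w = 0 := by
  funext i
  exact irrepF_pow_apply n (n + 1) w i i.2

theorem irrepF_eq_zero_apply (n : ℕ) (w : Irrep n) (hw : (ι ℂ sl2F : Ug) • w = 0)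
    (i : Fin (n + 1)) (hi : i ≠ Fin.last n) : w i = 0 := by
  obtain ⟨k, hk⟩ := i
  have hk' : k ≠ n := fun h => hi (Fin.ext h)
  have h := irrepF_succ n w k (by omega)
  rw [← ι_smul_irrep, hw] at h
  have h0 : (0 : ℂ) = (k + 1) * w ⟨k, hk⟩ := h
  rcases mul_eq_zero.1 h0.symm with h1 | h1
  · exact absurd h1 (Nat.cast_add_one_ne_zero k)
  · exact h1

end irrep

/-! ### `𝔤`-types and lowest weight vectors -/

section gtypes
variable {M : Type*} [AddCommGroup M] [Module U4 M] [Module ℂ M] [IsScalarTower ℂ U4 M]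

/-- The map `L(N) → M` defined by a lowest weight vector. -/
noncomputable def irrepMapAux (N : ℕ) (y : M) : Irrep N →ₗ[ℂ] M where
  -- In `L(N)` the matrix of `e` gives `e^(N-i) x_N = (N-i)! x_i`, whence the factorials when `x_N`
  -- is sent to `y`.
  toFun w := ∑ i : Fin (N + 1), (w i * ((N - i : ℕ).factorial : ℂ)⁻¹) • (eU ^ (N - i : ℕ) • y : M)
  map_add' v w := by
    have h : ∀ i, (v + w) i = v i + w i := fun _ => rfl
    simp only [h, add_mul, add_smul, Finset.sum_add_distrib]
  map_smul' r w := by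
    have h : ∀ i, (r • w) i = r * w i := fun _ => rfl
    simp only [h, mul_assoc, RingHom.id_apply, mul_smul r, Finset.smul_sum]

theorem irrepMapAux_apply (N : ℕ) (y : M) (w : Irrep N) : irrepMapAux N y w =
    (∑ i : Fin (N + 1), (w i * ((N - i : ℕ).factorial : ℂ)⁻¹) • (eU ^ (N - i : ℕ) • y : M)) := rfl

theorem irrepMapAux_e {N : ℕ} {y : M} (he : eU ^ (N + 1) • y = 0) (w : Irrep N) :
    irrepMapAux N y ((ι ℂ sl2E : Ug) • w) = eU • irrepMapAux N y w := by
  rw [ι_smul_irrep]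
  rw [irrepMapAux_apply, irrepMapAux_apply, Finset.smul_sum, Fin.sum_univ_castSucc, Fin.sum_univ_succ,
    irrepE_apply_last, zero_mul, zero_smul, add_zero]
  simp only [smul_complex_comm eU, ← mul_smul eU, ← pow_succ']
  simp only [Fin.val_zero, tsub_zero, he, smul_zero, zero_add]
  refine Finset.sum_congr rfl fun i _ => ?_
  have h1 := irrepE_apply_lt N w i (by omega)
  have h2 : (i.castSucc : Fin (N + 1)) = ⟨i, by omega⟩ := rfl
  have h3 : i.succ = ⟨(i : ℕ) + 1, by omega⟩ := rfl
  obtain ⟨d, hd⟩ : ∃ d, N = i + 1 + d := ⟨N - i - 1, by omega⟩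
  rw [h2, h1, h3]
  have e1 : N - (i : ℕ) = d + 1 := by omega
  have e2 : N - ((i : ℕ) + 1) = d := by omega
  have e3 : (N : ℂ) - (i : ℕ) = d + 1 := by
    rw [show (N : ℂ) = ((i + 1 + d : ℕ) : ℂ) by rw [← hd]]; push_cast; ring
  simp only [e1, e2, e3, Nat.factorial_succ]
  congr 1
  have : (d : ℂ) + 1 ≠ 0 := Nat.cast_add_one_ne_zero d
  have : (d.factorial : ℂ) ≠ 0 := by exact_mod_cast d.factorial_ne_zero
  push_cast
  field_simp

theorem irrepMapAux_f {N : ℕ} {y : M} (hy : IsLowest (N : ℂ) y) (w : Irrep N) :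
    irrepMapAux N y ((ι ℂ sl2F : Ug) • w) = fU • irrepMapAux N y w := by
  rw [ι_smul_irrep]
  rw [irrepMapAux_apply, irrepMapAux_apply, Finset.smul_sum, Fin.sum_univ_succ, Fin.sum_univ_castSucc,
    irrepF_zero, zero_mul, zero_smul, zero_add]
  simp only [smul_complex_comm fU, Fin.val_last, tsub_self, pow_zero, one_smul, hy.1, smul_zero,
    add_zero]
  refine Finset.sum_congr rfl fun i _ => ?_
  have h1 := irrepF_succ N w i (by omega)
  have h2 : (i.castSucc : Fin (N + 1)) = ⟨i, by omega⟩ := rfl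
  have h3 : i.succ = ⟨(i : ℕ) + 1, by omega⟩ := rfl
  obtain ⟨d, hd⟩ : ∃ d, N = i + 1 + d := ⟨N - i - 1, by omega⟩
  rw [h2, h3, h1]
  have e1 : N - (i : ℕ) = d + 1 := by omega
  have e2 : N - ((i : ℕ) + 1) = d := by omega
  have e3 : (N : ℂ) - d = i + 1 := by
    rw [show (N : ℂ) = ((i + 1 + d : ℕ) : ℂ) by rw [← hd]]; push_cast; ring
  simp only [e1, e2]
  rw [hy.f_e_pow, e3, ← mul_smul, Nat.factorial_succ]
  congr 1
  have : (d : ℂ) + 1 ≠ 0 := Nat.cast_add_one_ne_zero d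
  have : (d.factorial : ℂ) ≠ 0 := by exact_mod_cast d.factorial_ne_zero
  push_cast
  field_simp

/-- The homomorphism `L(N) → M` defined by a lowest weight vector. -/
noncomputable def irrepMap {N : ℕ} {y : M} (hy : IsLowest (N : ℂ) y) (he : eU ^ (N + 1) • y = 0) :
    Irrep N →ₗ[Ug] ResG M :=
  homOfGensSl2 ((toResG M).toLinearMap ∘ₗ irrepMapAux N y)
    (fun m => (congrArg (toResG M) (irrepMapAux_e he m)).trans (toResG_gU_smul _ _))
    (fun m => (congrArg (toResG M) (irrepMapAux_f hy m)).trans (toResG_gU_smul _ _))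

theorem irrepMap_single {N : ℕ} {y : M} (hy : IsLowest (N : ℂ) y) (he : eU ^ (N + 1) • y = 0)
    (i : Fin (N + 1)) : irrepMap hy he (Irrep.basisVec N i)
      = toResG M (((N - i : ℕ).factorial : ℂ)⁻¹ • (eU ^ (N - i : ℕ) • y : M)) := by
  change toResG M (irrepMapAux N y _) = _
  rw [irrepMapAux_apply, Finset.sum_eq_single i]
  · simp [Irrep.basisVec]
  · intro j _ hj
    simp [Irrep.basisVec, hj]
  · simp

theorem irrepMap_eq_of_f_eq_zero {N : ℕ} {y : M} (hy : IsLowest (N : ℂ) y)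
    (he : eU ^ (N + 1) • y = 0) (w : Irrep N) (hw : (ι ℂ sl2F : Ug) • w = 0) :
    irrepMap hy he w = toResG M (w (Fin.last N) • y) := by
  change toResG M (irrepMapAux N y _) = _
  rw [irrepMapAux_apply, Finset.sum_eq_single (Fin.last N)]
  · simp
  · intro j _ hj
    rw [irrepF_eq_zero_apply N w hw j hj, zero_mul, zero_smul]
  · simp

/-- The maps `L(t k) → M` defined by the `y k` add up to a map from the direct sum, onto by the
spanning hypothesis. Since `f` is nilpotent on each vector of the sum, a nonzero kernel would
contain a nonzero vector killed by `f`; such a vector has only bottom coordinates, and the `y k` are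
independent because their weights differ. -/
theorem hasGTypes_of_lowest (t : ℕ → ℕ) (ht : Function.Injective t) (y : ℕ → M)
    (hy : ∀ k, IsLowest (t k : ℂ) (y k)) (hy0 : ∀ k, y k ≠ 0) (he : ∀ k, eU ^ (t k + 1) • y k = 0)
    (hspan : Submodule.span ℂ {m | ∃ k a, m = eU ^ a • y k} = ⊤) : HasGTypes t M := by
  classical
  let Ψ : (DirectSum ℕ fun k => Irrep (t k)) →ₗ[Ug] ResG M :=
    DirectSum.toModule Ug ℕ (ResG M) fun k => irrepMap (hy k) (he k)
  have hΨ : ∀ k w, Ψ (DirectSum.lof Ug ℕ (fun k => Irrep (t k)) k w) = irrepMap (hy k) (he k) w :=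
    fun k w => by simp only [Ψ, DirectSum.toModule_lof]
  have hli : LinearIndependent ℂ y := by
    refine Module.End.eigenvectors_linearIndependent' (act hU : Module.End ℂ M)
      (fun k => -(t k : ℂ)) (fun a b h => ht (by simpa using h)) y fun k => ?_
    exact ⟨Module.End.mem_eigenspace_iff.2 (hy k).2, hy0 k⟩
  have key : ∀ v, (ι ℂ sl2F : Ug) • v = 0 → Ψ v = 0 → v = 0 := by
    intro v hv h0
    have hcomp : ∀ k, (ι ℂ sl2F : Ug) • v k = 0 := fun k => by
      rw [← DirectSum.smul_apply, hv]; rfl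
    have h1 : Ψ v = toResG M (∑ k ∈ DFinsupp.support v, v k (Fin.last (t k)) • y k) := by
      conv_lhs => rw [← DirectSum.sum_support_of v, map_sum]
      rw [map_sum]
      refine Finset.sum_congr rfl fun k _ => ?_
      refine (hΨ k (v k)).trans ?_
      rw [irrepMap_eq_of_f_eq_zero (hy k) (he k) _ (hcomp k)]
    rw [h1, LinearEquiv.map_eq_zero_iff] at h0
    have h2 := linearIndependent_iff'.1 hli (DFinsupp.support v) (fun k => v k (Fin.last (t k))) h0
    have : ∀ k, v k = 0 := by
      intro k
      by_contra hk
      apply hk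
      funext i
      by_cases hi : i = Fin.last (t k)
      · rw [hi]; exact h2 k (DFinsupp.mem_support_iff.2 hk)
      · exact irrepF_eq_zero_apply _ _ (hcomp k) i hi
    exact DFinsupp.ext this
  have hnil : ∀ v : DirectSum ℕ fun k => Irrep (t k), ∃ m, (ι ℂ sl2F : Ug) ^ m • v = 0 := by
    intro v
    refine ⟨(DFinsupp.support v).sup t + 1, ?_⟩
    refine DFinsupp.ext fun k => ?_
    change ((ι ℂ sl2F : Ug) ^ _ • v) k = 0
    rw [DirectSum.smul_apply]
    by_cases hk : v k = 0
    · rw [hk, smul_zero]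
    · have : t k ≤ (DFinsupp.support v).sup t :=
        Finset.le_sup (f := t) (DFinsupp.mem_support_iff.2 hk)
      obtain ⟨d, hd⟩ := Nat.exists_eq_add_of_le this
      rw [hd, show t k + d + 1 = d + (t k + 1) by ring, pow_add, mul_smul, irrepF_pow_eq_zero,
        smul_zero]
  have hinj : Function.Injective Ψ := by
    rw [← LinearMap.ker_eq_bot, Submodule.eq_bot_iff]
    intro v hv
    have : ∀ m, (ι ℂ sl2F : Ug) ^ m • v = 0 → v = 0 := by
      intro m
      induction m with
      | zero => intro h; simpa using h
      | succ m ih =>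
        intro h
        apply ih
        apply key
        · rwa [← mul_smul, ← pow_succ']
        · rw [map_smul, hv, smul_zero]
    obtain ⟨m, hm⟩ := hnil v
    exact this m hm
  have hsurj : Function.Surjective Ψ := by
    have hsub : ∀ (r : ℂ) (u : ResG M), r • u = algebraMap ℂ Ug r • u := fun r u =>
      (algebraMap_smul Ug r u).symm
    let R : Submodule ℂ M :=
      { carrier := {m | ∃ v, Ψ v = toResG M m}
        add_mem' := by
          rintro a b ⟨v, hv⟩ ⟨w, hw⟩
          exact ⟨v + w, by rw [map_add, map_add, hv, hw]⟩
        zero_mem' := ⟨0, by rw [map_zero, map_zero]⟩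
        smul_mem' := by
          rintro r m ⟨v, hv⟩
          exact ⟨algebraMap ℂ Ug r • v, by rw [map_smul, map_smul, hv, ← hsub]⟩ }
    have hR : R = ⊤ := by
      rw [eq_top_iff, ← hspan, Submodule.span_le]
      rintro _ ⟨k, a, rfl⟩
      by_cases ha : a ≤ t k
      · have hi : t k - a < t k + 1 := by omega
        have h2 : t k - (t k - a) = a := by omega
        have h := irrepMap_single (hy k) (he k) ⟨t k - a, hi⟩
        simp only [h2] at h
        have h3 : (((a.factorial : ℂ)⁻¹ • (eU ^ a • y k : M) : M)) ∈ R :=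
          ⟨DirectSum.lof Ug ℕ (fun k => Irrep (t k)) k _, (hΨ k _).trans h⟩
        have h4 := R.smul_mem (a.factorial : ℂ) h3
        rwa [smul_smul, mul_inv_cancel₀ (by exact_mod_cast a.factorial_ne_zero), one_smul] at h4
      · obtain ⟨d, rfl⟩ : ∃ d, a = d + (t k + 1) := ⟨a - (t k + 1), by omega⟩
        rw [pow_add, mul_smul, he, smul_zero]
        exact R.zero_mem
    intro m
    have : (toResG M).symm m ∈ R := hR ▸ Submodule.mem_top
    exact this
  exact ⟨(LinearEquiv.ofBijective Ψ ⟨hinj, hsurj⟩).symm⟩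

/-- This makes the set of `𝔤`-types an isomorphism invariant without decomposing `M` again: in
`L(n)` only multiples of the last basis vector are killed by `f`, and their weight is `-n`. -/
theorem HasGTypes.exists_lowest_iff {t : ℕ → ℕ} (h : HasGTypes t M) (N : ℕ) :
    (∃ m : M, m ≠ 0 ∧ IsLowest (N : ℂ) m) ↔ N ∈ Set.range t := by
  classical
  obtain ⟨Φ₀⟩ := h
  let Φ : M ≃+ DirectSum ℕ fun k => Irrep (t k) := (toResG M).toAddEquiv.trans Φ₀.toAddEquiv
  have hgU : ∀ (x : Sl2) (m : M), Φ (gU x • m) = (ι ℂ x : Ug) • Φ m := by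
    intro x m
    change Φ₀ (toResG M (gU x • m)) = (ι ℂ x : Ug) • Φ₀ (toResG M m)
    rw [toResG_gU_smul, map_smul]
  have hΦc : ∀ (r : ℂ) (m : M), Φ (r • m) = r • Φ m := by
    intro r m
    change Φ₀ (toResG M (r • m)) = r • Φ₀ (toResG M m)
    rw [map_smul, ← algebraMap_smul Ug r, map_smul, algebraMap_smul]
  constructor
  · rintro ⟨m, hm, hf, hh⟩
    have hv : Φ m ≠ 0 := fun h => hm (by simpa using h)
    have h1 : (ι ℂ sl2F : Ug) • Φ m = 0 := by
      rw [← hgU]; change Φ (fU • m : M) = 0; rw [hf]; exact map_zero Φ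
    have h2 : (ι ℂ sl2H : Ug) • Φ m = (-N : ℂ) • Φ m := by
      rw [← hgU, ← hΦc]; change Φ (hU • m : M) = _; rw [hh]
    obtain ⟨k, hk⟩ : ∃ k, Φ m k ≠ 0 := by
      by_contra hcon
      push Not at hcon
      exact hv (DFinsupp.ext hcon)
    refine ⟨k, ?_⟩
    have h1k : (ι ℂ sl2F : Ug) • Φ m k = 0 := by rw [← DirectSum.smul_apply, h1]; rfl
    have h2k : (ι ℂ sl2H : Ug) • Φ m k = (-N : ℂ) • Φ m k := by
      rw [← DirectSum.smul_apply, h2, DirectSum.smul_apply]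
    have hlast : Φ m k (Fin.last _) ≠ 0 := by
      intro h0
      apply hk
      funext i
      by_cases hi : i = Fin.last (t k)
      · rw [hi]; exact h0
      · exact irrepF_eq_zero_apply _ _ h1k i hi
    have h3 := congrFun h2k (Fin.last _)
    rw [ι_smul_irrep] at h3
    have h4 := (irrepH_apply _ (Φ m k) (Fin.last _)).symm.trans h3
    have h5 : ((t k : ℂ) - 2 * (t k : ℂ)) * Φ m k (Fin.last _) = -N * Φ m k (Fin.last _) := by
      rw [Fin.val_last] at h4; exact h4
    have h6 := mul_right_cancel₀ hlast h5
    have h7 : (t k : ℂ) = N := by linear_combination -h6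
    exact_mod_cast h7
  · rintro ⟨k, rfl⟩
    let x : DirectSum ℕ fun k => Irrep (t k) :=
      DirectSum.lof Ug ℕ (fun k => Irrep (t k)) k (Irrep.basisVec (t k) (Fin.last _))
    have hx0 : x ≠ 0 := by
      intro h
      have h1 : x k = 0 := by rw [h]; rfl
      have h2 : x k = Irrep.basisVec (t k) (Fin.last _) := DirectSum.lof_apply ..
      rw [h2] at h1
      have := congrFun h1 (Fin.last _)
      simp [Irrep.basisVec] at this
      exact one_ne_zero this
    refine ⟨Φ.symm x, fun h => hx0 ?_, ?_, ?_⟩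
    · exact (AddEquiv.map_eq_zero_iff Φ.symm).1 h
    · apply Φ.injective
      refine (hgU sl2F (Φ.symm x)).trans ?_
      rw [AddEquiv.apply_symm_apply, ← map_smul]
      refine (congrArg _ ?_).trans ((map_zero _).trans (map_zero Φ).symm)
      rw [ι_smul_irrep]
      funext i
      obtain ⟨j, hj⟩ := i
      rcases j with _ | j
      · exact irrepF_zero _ _
      · refine (irrepF_succ _ _ j hj).trans ?_
        have : (⟨j, by omega⟩ : Fin (t k + 1)) ≠ Fin.last _ := by
          intro h; have := congrArg Fin.val h; simp at this; omega
        simp [Irrep.basisVec, this]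
        rfl
    · apply Φ.injective
      refine (hgU sl2H (Φ.symm x)).trans ?_
      refine Eq.trans ?_ (hΦc _ _).symm
      rw [AddEquiv.apply_symm_apply, ← map_smul, ι_smul_irrep]
      have : irrepHom (t k) sl2H (Irrep.basisVec (t k) (Fin.last _))
          = (algebraMap ℂ Ug (-(t k : ℂ))) • Irrep.basisVec (t k) (Fin.last _) := by
        rw [algebraMap_smul]
        funext i
        rw [irrepH_apply]
        change _ = -(t k : ℂ) * _
        by_cases hi : i = Fin.last _
        · rw [hi]; rw [Fin.val_last]; ring
        · simp [Irrep.basisVec, hi]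
      rw [this, map_smul, algebraMap_smul]

end gtypes

/-! ### Exponentials of locally nilpotent operators -/
section exp
variable {V : Type*} [AddCommGroup V] [Module ℂ V]

/-- The operator `A` is locally nilpotent. -/
def LocNilp (A : Module.End ℂ V) : Prop := ∀ v, ∃ n, (A ^ n) v = 0

theorem pow_apply_eq_zero_of_le {A : Module.End ℂ V} {v : V} {n m : ℕ} (h : (A ^ n) v = 0)
    (hnm : n ≤ m) : (A ^ m) v = 0 := by
  obtain ⟨d, rfl⟩ := Nat.exists_eq_add_of_le hnm
  rw [add_comm, pow_add, Module.End.mul_apply, h, map_zero]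

/-- The divided power `Aⁿ / n!`. -/
noncomputable def divPow (A : Module.End ℂ V) (n : ℕ) : Module.End ℂ V :=
  (n.factorial : ℂ)⁻¹ • A ^ n

theorem divPow_apply_eq_zero {A : Module.End ℂ V} {v : V} {n m : ℕ} (h : (A ^ n) v = 0)
    (hnm : n ≤ m) : divPow A m v = 0 := by
  rw [divPow, LinearMap.smul_apply, pow_apply_eq_zero_of_le h hnm, smul_zero]

theorem mul_divPow (A : Module.End ℂ V) (n : ℕ) :
    A * divPow A n = ((n : ℂ) + 1) • divPow A (n + 1) := by
  have : (n : ℂ) + 1 ≠ 0 := Nat.cast_add_one_ne_zero n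
  rw [divPow, divPow, mul_smul_comm, ← pow_succ', smul_smul, Nat.factorial_succ]
  congr 1
  push_cast
  field_simp

theorem expLN_support_finite {A : Module.End ℂ V} (hA : LocNilp A) (v : V) :
    (Function.support fun n => divPow A n v).Finite := by
  obtain ⟨n, hn⟩ := hA v
  refine (Set.finite_Iio n).subset fun m hm => ?_
  by_contra h
  exact hm (divPow_apply_eq_zero hn (not_lt.1 h))

/-- The exponential of a locally nilpotent operator. -/
noncomputable def expLN (A : Module.End ℂ V) (hA : LocNilp A) : Module.End ℂ V where
  toFun v := ∑ᶠ n, divPow A n v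
  map_add' v w := by
    simp only [map_add]
    exact finsum_add_distrib (expLN_support_finite hA v) (expLN_support_finite hA w)
  map_smul' r v := by
    simp only [map_smul, RingHom.id_apply]
    exact (smul_finsum r _).symm

theorem expLN_eq_sum {A : Module.End ℂ V} (hA : LocNilp A) {v : V} {n : ℕ} (h : (A ^ n) v = 0) :
    expLN A hA v = ∑ k ∈ Finset.range n, divPow A k v := by
  refine finsum_eq_sum_of_support_subset _ fun m hm => ?_
  rw [Finset.coe_range, Set.mem_Iio]
  by_contra hcon
  exact hm (divPow_apply_eq_zero h (not_lt.1 hcon))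

/-- The exponential is unipotent: `v` differs from `exp(A) v` by terms `Aᵏv / k!` with `k ≥ 1`,
which are killed by a smaller power of `A`. -/
theorem expLN_surjective {A : Module.End ℂ V} (hA : LocNilp A) :
    Function.Surjective (expLN A hA) := by
  have key : ∀ n v, (A ^ n) v = 0 → v ∈ LinearMap.range (expLN A hA) := by
    intro n
    induction n with
    | zero => intro v hv; rw [show v = 0 from hv]; exact zero_mem _
    | succ n ih =>
      intro v hv
      have h1 := expLN_eq_sum hA hv
      rw [Finset.sum_range_succ'] at h1
      have h0 : divPow A 0 v = v := by simp [divPow]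
      rw [h0] at h1
      have h2 : v = expLN A hA v - ∑ k ∈ Finset.range n, divPow A (k + 1) v := by
        rw [h1]; abel
      rw [h2]
      refine sub_mem ⟨v, rfl⟩ (sum_mem fun k _ => ih _ ?_)
      rw [divPow, LinearMap.smul_apply, map_smul, ← Module.End.mul_apply, ← pow_add,
        pow_apply_eq_zero_of_le hv (by omega), smul_zero]
  intro v
  obtain ⟨n, hn⟩ := hA v
  exact key n v hn

/-- The Leibniz rule in divided powers; the hypothesis says that `b m` is the divided power `(ad A)ᵐ
(b 0) / m!`. -/
theorem divPow_mul {A : Module.End ℂ V} (b : ℕ → Module.End ℂ V)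
    (hb : ∀ m, A * b m = b m * A + ((m : ℂ) + 1) • b (m + 1)) (n : ℕ) :
    divPow A n * b 0 = ∑ p ∈ Finset.HasAntidiagonal.antidiagonal n, b p.1 * divPow A p.2 := by
  induction n with
  | zero => simp [divPow]
  | succ n ih =>
    have hn : (n : ℂ) + 1 ≠ 0 := Nat.cast_add_one_ne_zero n
    have h1 : ((n : ℂ) + 1) • (divPow A (n + 1) * b 0)
        = ((n : ℂ) + 1) • ∑ p ∈ Finset.HasAntidiagonal.antidiagonal (n + 1), b p.1 * divPow A p.2 := by
      rw [← smul_mul_assoc, ← mul_divPow, mul_assoc, ih, Finset.mul_sum]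
      have h2 : ∀ p : ℕ × ℕ, A * (b p.1 * divPow A p.2)
          = ((p.2 : ℂ) + 1) • (b p.1 * divPow A (p.2 + 1))
            + ((p.1 : ℂ) + 1) • (b (p.1 + 1) * divPow A p.2) := by
        intro p
        rw [← mul_assoc, hb, add_mul, mul_assoc, mul_divPow, mul_smul_comm, smul_mul_assoc]
      simp only [h2]
      rw [Finset.sum_add_distrib, Finset.smul_sum]
      have h3 : ∑ p ∈ Finset.HasAntidiagonal.antidiagonal (n + 1), ((n : ℂ) + 1) • (b p.1 * divPow A p.2)
          = ∑ p ∈ Finset.HasAntidiagonal.antidiagonal (n + 1), (p.2 : ℂ) • (b p.1 * divPow A p.2)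
            + ∑ p ∈ Finset.HasAntidiagonal.antidiagonal (n + 1), (p.1 : ℂ) • (b p.1 * divPow A p.2) := by
        rw [← Finset.sum_add_distrib]
        refine Finset.sum_congr rfl fun p hp => ?_
        rw [← add_smul]
        congr 1
        have := Finset.HasAntidiagonal.mem_antidiagonal.1 hp
        have h := congrArg (Nat.cast : ℕ → ℂ) this
        push_cast at h
        linear_combination -h
      rw [h3, Finset.Nat.sum_antidiagonal_succ', Finset.Nat.sum_antidiagonal_succ]
      simp
    exact smul_right_injective _ hn h1

/-- This is `exp(A) b exp(-A) = exp(ad A) b` for a `b` on which `ad A` is nilpotent, obtained by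
summing the Leibniz rule over all degrees. -/
theorem expLN_apply_mul {A : Module.End ℂ V} (hA : LocNilp A) (b : ℕ → Module.End ℂ V)
    (hb : ∀ m, A * b m = b m * A + ((m : ℂ) + 1) • b (m + 1)) (r : ℕ) (hr : ∀ m, r ≤ m → b m = 0)
    (v : V) : expLN A hA (b 0 v) = ∑ m ∈ Finset.range r, b m (expLN A hA v) := by
  obtain ⟨L, hL⟩ := hA v
  have hzero : ∀ p : ℕ × ℕ, p ∉ Finset.range r ×ˢ Finset.range L → b p.1 (divPow A p.2 v) = 0 := by
    intro p hp
    by_cases h1 : r ≤ p.1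
    · rw [hr _ h1]; rfl
    · by_cases h2 : L ≤ p.2
      · rw [divPow_apply_eq_zero hL h2, map_zero]
      · exact absurd (Finset.mem_product.2 ⟨Finset.mem_range.2 (not_le.1 h1),
          Finset.mem_range.2 (not_le.1 h2)⟩) hp
  have hdiv : ∀ n, divPow A n (b 0 v)
      = ∑ p ∈ Finset.range r ×ˢ Finset.range L with p.1 + p.2 = n, b p.1 (divPow A p.2 v) := by
    intro n
    rw [← Module.End.mul_apply, divPow_mul b hb, LinearMap.sum_apply]
    symm
    refine Finset.sum_subset (fun p hp => ?_) fun p hp hp' => ?_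
    · exact Finset.HasAntidiagonal.mem_antidiagonal.2 (Finset.mem_filter.1 hp).2
    · apply hzero
      intro h
      exact hp' (Finset.mem_filter.2 ⟨h, Finset.HasAntidiagonal.mem_antidiagonal.1 hp⟩)
  -- A term of degree `r + L` needs a first index `≥ r` or a second index `≥ L`, and either one
  -- vanishes.
  have hbig : (A ^ (r + L)) (b 0 v) = 0 := by
    have h := hdiv (r + L)
    rw [Finset.sum_eq_zero] at h
    · rw [divPow, LinearMap.smul_apply, smul_eq_zero] at h
      rcases h with h | h
      · exact absurd h (by simp [Nat.factorial_ne_zero])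
      · exact h
    · intro p hp
      rw [Finset.mem_filter, Finset.mem_product, Finset.mem_range, Finset.mem_range] at hp
      omega
  rw [expLN_eq_sum hA hbig, expLN_eq_sum hA hL]
  simp only [hdiv]
  rw [Finset.sum_fiberwise_of_maps_to, Finset.sum_product]
  · simp only [map_sum]
  · intro p hp
    rw [Finset.mem_product, Finset.mem_range, Finset.mem_range] at hp
    rw [Finset.mem_range]; omega

/-- Conjugation by the exponential of a locally nilpotent operator. -/
theorem expLN_conj {W : Type*} [AddCommGroup W] [Module ℂ W] {A : Module.End ℂ V} (hA : LocNilp A)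
    (R : W →ₗ[ℂ] Module.End ℂ V) (N : Module.End ℂ W) (hN : N ^ 5 = 0)
    (hR : ∀ w, A * R w = R w * A + R (N w)) (w : W) (v : V) :
    expLN A hA (R w v) = R (∑ k ∈ Finset.range 5, divPow N k w) (expLN A hA v) := by
  have h0 : divPow N 0 w = w := by simp [divPow]
  have h := expLN_apply_mul hA (fun m => R (divPow N m w)) (fun m => by
    rw [hR, ← Module.End.mul_apply N, mul_divPow, LinearMap.smul_apply, map_smul]) 5 (fun m hm => by
    rw [divPow_apply_eq_zero (n := 5) (by rw [hN]; rfl) hm, map_zero]) v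
  simp only [h0] at h
  rw [h, map_sum, LinearMap.sum_apply]

end exp

/-! ### Supports in `𝔯*` and their normalization by exponentials -/

section shift
variable {M : Type*} [AddCommGroup M] [Module U4 M] [Module ℂ M] [IsScalarTower ℂ U4 M]

/-- The action of `𝔯` as a linear map. -/
noncomputable def rAct : (Fin 5 → ℂ) →ₗ[ℂ] Module.End ℂ M where
  toFun v := ∑ j, v j • act (xU j)
  map_add' v w := by simp only [Pi.add_apply, add_smul, Finset.sum_add_distrib]
  map_smul' r v := by simp [Finset.smul_sum, smul_smul]

theorem rAct_eq (v : Fin 5 → ℂ) (m : M) : rAct v m = rU (show Irrep 4 from v) • m := by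
  rw [rU_eq_sum, Finset.sum_smul]
  simp only [rAct, LinearMap.coe_mk, AddHom.coe_mk, LinearMap.sum_apply, LinearMap.smul_apply,
    act_apply, smul_assoc]

theorem rAct_single (j : Fin 5) (m : M) : rAct (Pi.single j 1) m = xU j • m := by
  simp [rAct, Pi.single_apply, act_apply]

/-- The action of `𝔤` as a linear map. -/
noncomputable def gAct : Sl2 →ₗ[ℂ] Module.End ℂ M where
  toFun x := act (gU x)
  map_add' x y := by
    ext m; simp only [act_apply, gU, map_add, add_smul, LinearMap.add_apply]
  map_smul' r x := by ext m; simp only [act_apply, gU, map_smul, smul_assoc]; rfl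

theorem gAct_apply (x : Sl2) (m : M) : gAct x m = gU x • m := rfl

theorem gAct_rAct (x : Sl2) (v : Fin 5 → ℂ) :
    (gAct x : Module.End ℂ M) * rAct v = rAct v * gAct x + rAct (coordHom 4 x v) := by
  ext m
  simp only [Module.End.mul_apply, LinearMap.add_apply, gAct_apply, rAct_eq]
  have h := congrArg (· • m) (gU_rU_commutator x (show Irrep 4 from v))
  simp only [sub_smul, mul_smul] at h
  exact sub_eq_iff_eq_add'.1 h

theorem gAct_gAct (x y : Sl2) :
    (gAct x : Module.End ℂ M) * gAct y = gAct y * gAct x + gAct ⁅x, y⁆ := by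
  ext m
  simp only [Module.End.mul_apply, LinearMap.add_apply, gAct_apply]
  have h := congrArg (· • m) (gU_commutator x y)
  simp only [sub_smul, mul_smul] at h
  exact sub_eq_iff_eq_add'.1 h

theorem coordHom_smul_sl2F (u : ℂ) (w : Fin 5 → ℂ) :
    coordHom 4 (u • sl2F) w = ![0, u * w 0, 2 * u * w 1, 3 * u * w 2, 4 * u * w 3] := by
  rw [map_smul, LinearMap.smul_apply, coordHom_four_sl2F]
  funext i
  fin_cases i <;> simp <;> ring

theorem expSum_sl2F (u : ℂ) (w : Fin 5 → ℂ) :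
    ∑ k ∈ Finset.range 5, divPow (coordHom 4 (u • sl2F)) k w
      = ![w 0, w 1 + u * w 0, w 2 + 2 * u * w 1 + u ^ 2 * w 0,
        w 3 + 3 * u * w 2 + 3 * u ^ 2 * w 1 + u ^ 3 * w 0,
        w 4 + 4 * u * w 3 + 6 * u ^ 2 * w 2 + 4 * u ^ 3 * w 1 + u ^ 4 * w 0] := by
  simp only [Finset.sum_range_succ, Finset.sum_range_zero, divPow, pow_succ, pow_zero, one_mul,
    LinearMap.smul_apply, Module.End.mul_apply, Module.End.one_apply, coordHom_smul_sl2F]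
  funext i
  fin_cases i <;> simp [Nat.factorial, Matrix.vecHead, Matrix.vecTail] <;> try ring_nf

theorem coordHom_sl2F_pow (u : ℂ) : coordHom 4 (u • sl2F) ^ 5 = 0 := by
  refine LinearMap.ext fun w => ?_
  simp only [pow_succ, pow_zero, one_mul, Module.End.mul_apply, Module.End.one_apply,
    coordHom_smul_sl2F]
  funext i
  fin_cases i <;> simp

theorem coordHom_sl2E_pow : coordHom 4 sl2E ^ 5 = 0 := by
  refine LinearMap.ext fun w => ?_
  simp only [pow_succ, pow_zero, one_mul, Module.End.mul_apply, Module.End.one_apply,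
    coordHom_apply_sl2E]
  funext i
  fin_cases i <;> simp

theorem expSum_sl2E (w : Fin 5 → ℂ) :
    ∑ k ∈ Finset.range 5, divPow (coordHom 4 sl2E) k w
      = ![w 0 + 4 * w 1 + 6 * w 2 + 4 * w 3 + w 4, w 1 + 3 * w 2 + 3 * w 3 + w 4,
        w 2 + 2 * w 3 + w 4, w 3 + w 4, w 4] := by
  simp only [Finset.sum_range_succ, Finset.sum_range_zero, divPow, pow_succ, pow_zero, one_mul,
    LinearMap.smul_apply, Module.End.mul_apply, Module.End.one_apply, coordHom_apply_sl2E]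
  funext i
  fin_cases i <;> simp [Nat.factorial, Matrix.vecHead, Matrix.vecTail] <;> try ring_nf

theorem gAct_locNilp {x : Sl2} (h : ∀ m : M, ∃ n, gU x ^ n • m = 0) (u : ℂ) :
    LocNilp (gAct (u • x) : Module.End ℂ M) := by
  intro m
  obtain ⟨n, hn⟩ := h m
  refine ⟨n, ?_⟩
  have : ∀ k (z : M), ((gAct x : Module.End ℂ M) ^ k) z = gU x ^ k • z := by
    intro k
    induction k with
    | zero => intro z; simp
    | succ k ih => intro z; rw [pow_succ, Module.End.mul_apply, ih, pow_succ, mul_smul, gAct_apply]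
  rw [map_smul, smul_pow, LinearMap.smul_apply, this, hn, smul_zero]

/-- There is a functional on `M` on which `𝔯` acts by the character `χ`. -/
def SuppAt (M : Type*) [AddCommGroup M] [Module U4 M] [Module ℂ M] (χ : Fin 5 → ℂ) : Prop :=
  ∃ φ : M →ₗ[ℂ] ℂ, φ ≠ 0 ∧ ∀ j m, φ (xU j • m) = χ j * φ m

theorem functional_rAct {χ : Fin 5 → ℂ} {φ : M →ₗ[ℂ] ℂ} (h : ∀ j m, φ (xU j • m) = χ j * φ m)
    (v : Fin 5 → ℂ) (m : M) : φ (rAct v m) = (∑ j, v j * χ j) * φ m := by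
  simp [rAct, LinearMap.sum_apply, act_apply, h, Finset.sum_mul, mul_assoc]

/-- Regard `χ` as the quartic `χ₀ + χ₁u + χ₂u² + χ₃u³ + χ₄u⁴`. Composing the functional with
`exp(uf)` translates the variable by `u`: the new `χ₀`, `χ₁` are the value and the derivative at
`u`. -/
theorem SuppAt.shift {χ : Fin 5 → ℂ} (hf : ∀ m : M, ∃ n, fU ^ n • m = 0) (h : SuppAt M χ) (u : ℂ) :
    SuppAt M ![χ 0 + u * χ 1 + u ^ 2 * χ 2 + u ^ 3 * χ 3 + u ^ 4 * χ 4,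
      χ 1 + 2 * u * χ 2 + 3 * u ^ 2 * χ 3 + 4 * u ^ 3 * χ 4,
      χ 2 + 3 * u * χ 3 + 6 * u ^ 2 * χ 4, χ 3 + 4 * u * χ 4, χ 4] := by
  obtain ⟨φ, hφ, h⟩ := h
  have hA := gAct_locNilp (x := sl2F) hf u
  refine ⟨φ ∘ₗ expLN _ hA, fun h0 => hφ ?_, fun j m => ?_⟩
  · ext m
    obtain ⟨m, rfl⟩ := expLN_surjective hA m
    exact LinearMap.congr_fun h0 m
  · rw [LinearMap.comp_apply, ← rAct_single, expLN_conj hA rAct _ (coordHom_sl2F_pow u)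
      (gAct_rAct _), functional_rAct h, expSum_sl2F, LinearMap.comp_apply]
    congr 1
    fin_cases j <;> simp [Fin.sum_univ_succ] <;> ring

section weyl
variable (he : ∀ m : M, ∃ n, eU ^ n • m = 0) (hf : ∀ m : M, ∃ n, fU ^ n • m = 0)

/-- The action of the Weyl group element `exp(e) exp(-f) exp(e)`. -/
noncomputable def weylAct : Module.End ℂ M :=
  expLN _ (gAct_locNilp (x := sl2E) he 1) * expLN _ (gAct_locNilp (x := sl2F) hf (-1)) *
    expLN _ (gAct_locNilp (x := sl2E) he 1)

theorem weylAct_surjective : Function.Surjective (weylAct he hf) :=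
  ((expLN_surjective (gAct_locNilp (x := sl2E) he 1)).comp
    (expLN_surjective (gAct_locNilp (x := sl2F) hf (-1)))).comp
    (expLN_surjective (gAct_locNilp (x := sl2E) he 1))

theorem weylAct_x (v : Fin 5 → ℂ) (m : M) : weylAct he hf (rAct v m)
    = rAct ![v 4, -v 3, v 2, -v 1, v 0] (weylAct he hf m) := by
  have hE : coordHom 4 ((1 : ℂ) • sl2E) = coordHom 4 sl2E := by rw [one_smul]
  simp only [weylAct, Module.End.mul_apply]
  rw [expLN_conj _ rAct _ (by rw [hE]; exact coordHom_sl2E_pow) (gAct_rAct _),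
    expLN_conj _ rAct _ (coordHom_sl2F_pow _) (gAct_rAct _),
    expLN_conj _ rAct _ (by rw [hE]; exact coordHom_sl2E_pow) (gAct_rAct _), hE, expSum_sl2E,
    expSum_sl2F, expSum_sl2E]
  congr 2
  funext i
  fin_cases i <;> simp <;> ring

end weyl
end shift

section weylh
variable {M : Type*} [AddCommGroup M] [Module U4 M] [Module ℂ M] [IsScalarTower ℂ U4 M]

/-- The case in which `ad A` has cube zero on `b0`, as happens for `e` and `f` acting on `𝔤`. -/
theorem expLN_apply_quadratic {A : Module.End ℂ M} (hA : LocNilp A) (b0 b1 b2 : Module.End ℂ M)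
    (h0 : A * b0 = b0 * A + b1) (h1 : A * b1 = b1 * A + (2 : ℂ) • b2) (h2 : A * b2 = b2 * A)
    (v : M) : expLN A hA (b0 v) = (b0 + b1 + b2) (expLN A hA v) := by
  have h := expLN_apply_mul hA (fun m => match m with | 0 => b0 | 1 => b1 | 2 => b2 | _ => 0)
    (fun m => by
      match m with
      | 0 => simpa using h0
      | 1 => simpa [one_add_one_eq_two] using h1
      | 2 => simpa using h2
      | m + 3 => simp) 3 (fun m hm => by
      match m, hm with
      | m + 3, _ => rfl) v
  simpa [Finset.sum_range_succ] using h

variable (he : ∀ m : M, ∃ n, eU ^ n • m = 0) (hf : ∀ m : M, ∃ n, fU ^ n • m = 0)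

theorem weylAct_h (m : M) : weylAct he hf (hU • m) = -(hU • weylAct he hf m) := by
  have hfe : ⁅sl2F, sl2E⁆ = -sl2H := by rw [← lie_skew, lie_sl2E_sl2F]
  have hfh : ⁅sl2F, sl2H⁆ = (2 : ℂ) • sl2F := by
    rw [← lie_skew, lie_sl2H_sl2F, neg_smul, neg_neg]
  have heh : ⁅sl2E, sl2H⁆ = -((2 : ℂ) • sl2E) := by rw [← lie_skew, lie_sl2H_sl2E]
  have E0 := gAct_gAct (M := M) sl2E sl2H
  have E1 := gAct_gAct (M := M) sl2F sl2H
  have E2 := gAct_gAct (M := M) sl2F sl2E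
  rw [heh] at E0
  rw [hfh] at E1
  rw [hfe] at E2
  simp only [map_neg, map_smul] at E0 E1 E2
  -- The three exponentials move `h` successively to `h - 2e`, to `-h - 2e` and to `-h`.
  have s1 := expLN_apply_quadratic (gAct_locNilp (x := sl2E) he 1) (gAct sl2H)
    (-((2 : ℂ) • gAct sl2E)) 0 (by rw [one_smul, E0]) (by simp) (by simp)
  have s2 := expLN_apply_quadratic (gAct_locNilp (x := sl2F) hf (-1))
    (gAct sl2H + -((2 : ℂ) • gAct sl2E))
    (-((2 : ℂ) • gAct sl2H) - (2 : ℂ) • gAct sl2F) ((2 : ℂ) • gAct sl2F)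
    (by simp only [map_smul, mul_add, add_mul, smul_mul_assoc, mul_neg, neg_mul, mul_smul_comm,
          E1, E2]; module)
    (by simp only [map_smul, mul_sub, sub_mul, mul_neg, neg_mul, smul_mul_assoc, mul_smul_comm,
          E1]; module) (by simp)
  have s3 := expLN_apply_quadratic (gAct_locNilp (x := sl2E) he 1)
    (-gAct sl2H - (2 : ℂ) • gAct sl2E) ((2 : ℂ) • gAct sl2E) 0
    (by simp only [map_smul, mul_sub, sub_mul, mul_neg, neg_mul, one_smul, mul_smul_comm,
          smul_mul_assoc, E0]; module) (by simp) (by simp)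
  have a2 : (gAct sl2H + -((2 : ℂ) • gAct sl2E) + (-((2 : ℂ) • gAct sl2H) - (2 : ℂ) • gAct sl2F)
      + (2 : ℂ) • gAct sl2F : Module.End ℂ M) = -gAct sl2H - (2 : ℂ) • gAct sl2E := by module
  have a3 : (-gAct sl2H - (2 : ℂ) • gAct sl2E + (2 : ℂ) • gAct sl2E + 0 : Module.End ℂ M)
      = -gAct sl2H := by module
  rw [a2] at s2
  rw [a3] at s3
  rw [add_zero] at s1
  change weylAct he hf (gAct sl2H m) = -(gAct sl2H (weylAct he hf m))
  simp only [weylAct, Module.End.mul_apply]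
  rw [s1, s2, s3, LinearMap.neg_apply]

theorem weylAct_xU (j : Fin 5) (m : M) :
    weylAct he hf (xU j • m) = (-1 : ℂ) ^ (j : ℕ) • xU j.rev • weylAct he hf m := by
  rw [← rAct_single, weylAct_x]
  have e4 : (-1 : ℂ) ^ 4 = 1 := by norm_num
  have e3 : (-1 : ℂ) ^ 3 = -1 := by norm_num
  fin_cases j <;> simp [rAct, Fin.sum_univ_succ, act_apply, e3, e4]

-- The Weyl element reverses the quartic up to signs, thereby exchanging the roots at `0` and at
-- infinity.
include he hf in
theorem SuppAt.flip {χ : Fin 5 → ℂ} (h : SuppAt M χ) :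
    SuppAt M fun j => (-1) ^ (j : ℕ) * χ j.rev := by
  obtain ⟨φ, hφ, h⟩ := h
  refine ⟨φ ∘ₗ weylAct he hf, fun h0 => hφ ?_, fun j m => ?_⟩
  · ext m
    obtain ⟨m, rfl⟩ := weylAct_surjective he hf m
    exact LinearMap.congr_fun h0 m
  · rw [LinearMap.comp_apply, weylAct_xU, map_smul, h, LinearMap.comp_apply, smul_eq_mul, mul_assoc]

/-- A point of the support is a ring character of `S(𝔯)`, so evaluating the central elements there
gives their scalars. -/
theorem SuppAt.character {χ : Fin 5 → ℂ} (h : SuppAt M χ) {c : ℂ} (hc : HasCharacter c M) :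
    χ 2 ^ 2 - 3 * χ 3 * χ 1 + 12 * χ 4 * χ 0 = c ^ 2 ∧
    χ 2 ^ 3 - 9 / 2 * χ 3 * χ 2 * χ 1 + 27 / 2 * χ 3 ^ 2 * χ 0 + 27 / 2 * χ 4 * χ 1 ^ 2
      - 36 * χ 4 * χ 2 * χ 0 = c ^ 3 := by
  obtain ⟨φ, hφ, h⟩ := h
  obtain ⟨m, hm⟩ : ∃ m, φ m ≠ 0 := by
    by_contra hcon
    push Not at hcon
    exact hφ (LinearMap.ext hcon)
  have h2 := congrArg φ (hc.1 m)
  have h3 := congrArg φ (hc.2 m)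
  rw [C2_smul, algebraMap_smul_eq] at h2
  rw [C3_smul, algebraMap_smul_eq] at h3
  simp only [map_add, map_sub, map_smul, h, smul_eq_mul] at h2 h3
  constructor
  · apply mul_right_cancel₀ hm; linear_combination h2
  · apply mul_right_cancel₀ hm; linear_combination h3

end weylh

/-- The hypothesis is the vanishing of the discriminant of the cubic `d + cu + bu² + au³`. The first
alternative is a double root at infinity. -/
theorem exists_double_root {a b c d : ℂ}
    (h : b ^ 2 * c ^ 2 - 4 * a * c ^ 3 - 4 * b ^ 3 * d - 27 * a ^ 2 * d ^ 2
      + 18 * a * b * c * d = 0) :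
    (a = 0 ∧ b = 0) ∨
      ∃ u, d + c * u + b * u ^ 2 + a * u ^ 3 = 0 ∧ c + 2 * b * u + 3 * a * u ^ 2 = 0 := by
  by_cases h1 : b ^ 2 - 3 * a * c = 0
  · by_cases ha : a = 0
    · left
      refine ⟨ha, ?_⟩
      rw [ha] at h1
      simpa using h1
    · right
      -- Modulo `b² - 3ac`, the discriminant is `-(9ad - bc)² / 3`. Hence here the root is triple,
      -- and it equals `-b / (3a)`.
      have h9 : 9 * a * d - b * c = 0 := by
        have : (9 * a * d - b * c) ^ 2 = 0 := by
          linear_combination (-3) * h + (4 * c^2 - 12 * b * d) * h1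
        simpa using this
      refine ⟨-b / (3 * a), ?_, ?_⟩
      · field_simp
        linear_combination 3 * a * h9 + 2 * b * h1
      · field_simp
        linear_combination -h1
  · right
    obtain ⟨e, he⟩ : ∃ e, e = b ^ 2 - 3 * a * c := ⟨_, rfl⟩
    rw [← he] at h1
    -- The double root is a rational function of the coefficients, found by eliminating `u²` and
    -- `u³` between the cubic and its derivative.
    refine ⟨(9 * a * d - b * c) / (2 * e), ?_, ?_⟩
    · field_simp
      rw [he]
      linear_combination (-2 * b ^ 3 + 9 * a * b * c - 27 * a ^ 2 * d) * h
    · field_simp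
      rw [he]
      linear_combination (-9 * a) * h

section
variable {M : Type*} [AddCommGroup M] [Module U4 M] [Module ℂ M] [IsScalarTower ℂ U4 M]

/-- With `C₂ = c²` and `C₃ = c³` the quartic has a double root. A translation, or the Weyl element
if the root is at infinity, brings it to `0`, so `χ₀ = χ₁ = 0`; then the invariants are `χ₂²` and
`χ₂³`. -/
theorem SuppAt.exists_normalized {χ : Fin 5 → ℂ} (h : SuppAt M χ)
    (he : ∀ m : M, ∃ n, eU ^ n • m = 0) (hf : ∀ m : M, ∃ n, fU ^ n • m = 0)
    {c : ℂ} (hc : HasCharacter c M) : ∃ χ, SuppAt M χ ∧ χ 0 = 0 ∧ χ 1 = 0 ∧ χ 2 = c := by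
  -- The equalities `χ₂² = c²` and `χ₂³ = c³` give `χ₂ = c`; the case `c = 0` is separate because
  -- dividing by `c²` is not possible there.
  have fin : ∀ χ, SuppAt M χ → χ 0 = 0 → χ 1 = 0 → ∃ χ, SuppAt M χ ∧ χ 0 = 0 ∧ χ 1 = 0 ∧ χ 2 = c := by
    intro χ h h0 h1
    refine ⟨χ, h, h0, h1, ?_⟩
    obtain ⟨h2, h3⟩ := h.character hc
    rw [h0, h1] at h2 h3
    have h2' : χ 2 ^ 2 = c ^ 2 := by linear_combination h2
    have h3' : χ 2 ^ 3 = c ^ 3 := by linear_combination h3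
    by_cases hc0 : c = 0
    · rw [hc0] at h2' ⊢
      simpa using h2'
    · apply mul_right_cancel₀ (pow_ne_zero 2 hc0)
      linear_combination h3' - χ 2 * h2'
  -- Here the double root is at infinity.
  have flat : ∀ χ, SuppAt M χ → χ 4 = 0 → χ 3 = 0 →
      ∃ χ, SuppAt M χ ∧ χ 0 = 0 ∧ χ 1 = 0 ∧ χ 2 = c := by
    intro χ h h4 h3
    refine fin _ (h.flip he hf) ?_ ?_
    · simpa using h4
    · simpa using h3
  have zero : ∀ χ, SuppAt M χ → χ 0 = 0 → ∃ χ, SuppAt M χ ∧ χ 0 = 0 ∧ χ 1 = 0 ∧ χ 2 = c := by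
    intro χ h h0
    by_cases h1 : χ 1 = 0
    · exact fin χ h h0 h1
    obtain ⟨h2, h3⟩ := h.character hc
    rw [h0] at h2 h3
    -- For `χ₀ = 0` the quartic is `u` times a cubic, and `C₂³ - C₃²` evaluates to `27/4 · χ₁²`
    -- times the discriminant of that cubic.
    have hd : χ 3 ^ 2 * χ 2 ^ 2 - 4 * χ 4 * χ 2 ^ 3 - 4 * χ 3 ^ 3 * χ 1 - 27 * χ 4 ^ 2 * χ 1 ^ 2
        + 18 * χ 4 * χ 3 * χ 2 * χ 1 = 0 := by
      have : (χ 3 ^ 2 * χ 2 ^ 2 - 4 * χ 4 * χ 2 ^ 3 - 4 * χ 3 ^ 3 * χ 1 - 27 * χ 4 ^ 2 * χ 1 ^ 2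
        + 18 * χ 4 * χ 3 * χ 2 * χ 1) * (χ 1) ^ 2 * (27 / 4) = 0 := by
        have e : (χ 2 ^ 2 - 3 * χ 3 * χ 1 + 12 * χ 4 * 0) ^ 3 =
          (χ 2 ^ 3 - 9 / 2 * χ 3 * χ 2 * χ 1 + 27 / 2 * χ 3 ^ 2 * 0 + 27 / 2 * χ 4 * χ 1 ^ 2
      - 36 * χ 4 * χ 2 * 0) ^ 2 := by rw [h2, h3]; ring
        linear_combination e
      simpa [h1] using this
    rcases exists_double_root hd with ⟨h4, h5⟩ | ⟨u, hu, hu'⟩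
    · exact flat χ h h4 h5
    · refine fin _ (h.shift hf u) ?_ ?_
      · simp only [Matrix.cons_val]
        rw [h0]; linear_combination u * hu
      · simp only [Matrix.cons_val]
        linear_combination hu + u * hu'
  by_cases h34 : χ 4 = 0 ∧ χ 3 = 0
  · exact flat χ h h34.1 h34.2
  -- Either `χ₃` or `χ₄` is nonzero, so the quartic is not constant and has a root, which a
  -- translation brings to `0`.
  open Polynomial in
  obtain ⟨r, hr⟩ : ∃ r, (Polynomial.C (χ 4) * X ^ 4 + Polynomial.C (χ 3) * X ^ 3
      + Polynomial.C (χ 2) * X ^ 2 + Polynomial.C (χ 1) * X + Polynomial.C (χ 0)).IsRoot r := by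
    apply IsAlgClosed.exists_root
    intro hdeg
    have hP := Polynomial.eq_C_of_degree_eq_zero hdeg
    apply h34
    constructor
    · have := congrArg (fun p => Polynomial.coeff p 4) hP
      simpa [Polynomial.coeff_X, Polynomial.coeff_C] using this
    · have := congrArg (fun p => Polynomial.coeff p 3) hP
      simpa [Polynomial.coeff_X, Polynomial.coeff_C] using this
  refine zero _ (h.shift hf r) ?_
  simp [Polynomial.IsRoot] at hr
  simp only [Matrix.cons_val]
  linear_combination hr

end

/-! ### From a lowest weight generator to a functional supported at a point -/

section

/-- The image of `U(𝔯) = S(𝔯)` in `U(𝔏⁴)`. -/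
noncomputable abbrev rAlg : Subalgebra ℂ U4 := Algebra.adjoin ℂ (Set.range xU)

instance : IsMulCommutative rAlg :=
  Algebra.isMulCommutative_adjoin ℂ (by
    rintro _ ⟨i, rfl⟩ _ ⟨j, rfl⟩
    exact xU_commute i j)

open scoped IsMulCommutative

theorem xU_mem_rAlg (j : Fin 5) : xU j ∈ rAlg := Algebra.subset_adjoin ⟨j, rfl⟩

theorem rU_mem_rAlg (v : Irrep 4) : rU v ∈ rAlg := by
  rw [rU_eq_sum]
  exact sum_mem fun j _ => rAlg.smul_mem (xU_mem_rAlg j) _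

theorem gU_commutator_mem_rAlg (x : Sl2) {a : U4} (ha : a ∈ rAlg) : gU x * a - a * gU x ∈ rAlg := by
  refine Algebra.adjoin_induction (p := fun a _ => gU x * a - a * gU x ∈ rAlg) ?_ ?_ ?_ ?_ ha
  · rintro _ ⟨j, rfl⟩
    rw [xU, gU_rU_commutator]
    exact rU_mem_rAlg _
  · intro r
    rw [Algebra.commutes, sub_self]
    exact zero_mem _
  · intro a b _ _ h1 h2
    have : gU x * (a + b) - (a + b) * gU x = (gU x * a - a * gU x) + (gU x * b - b * gU x) := by
      noncomm_ring
    rw [this]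
    exact add_mem h1 h2
  · intro a b ha hb h1 h2
    have : gU x * (a * b) - (a * b) * gU x
        = (gU x * a - a * gU x) * b + a * (gU x * b - b * gU x) := by
      noncomm_ring
    rw [this]
    exact add_mem (mul_mem h1 hb) (mul_mem ha h2)

instance : Algebra.FiniteType ℂ rAlg :=
  (Subalgebra.fg_iff_finiteType rAlg).1
    ⟨(Set.finite_range xU).toFinset, by rw [Set.Finite.coe_toFinset]⟩

section exist
variable {M : Type*} [AddCommGroup M] [Module U4 M] [Module ℂ M] [IsScalarTower ℂ U4 M]

/-- Commutators with `𝔤` preserve the image of `S(𝔯)`, so the `S(𝔯)`-span of the finite `e`-string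
through `y` is stable under all of `𝔏⁴`. Thus the module is finitely generated over a commutative
algebra. -/
theorem span_rAlg_eq_top {N : ℕ} {y : M} (hy : IsLowest (N : ℂ) y) (he : eU ^ (N + 1) • y = 0)
    (hgen : Submodule.span U4 {y} = ⊤) :
    Submodule.span rAlg ((fun k => eU ^ k • y) '' Set.Iic N) = ⊤ := by
  set L := Submodule.span rAlg ((fun k => eU ^ k • y) '' Set.Iic N) with hL
  have hmem : ∀ k, eU ^ k • y ∈ L := by
    intro k
    by_cases hk : k ≤ N
    · exact Submodule.subset_span ⟨k, hk, rfl⟩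
    · obtain ⟨d, rfl⟩ : ∃ d, k = d + (N + 1) := ⟨k - (N + 1), by omega⟩
      rw [pow_add, mul_smul, he, smul_zero]
      exact zero_mem _
  have stab : ∀ x : Sl2, (∀ k, gU x • eU ^ k • y ∈ L) → ∀ m ∈ L, gU x • m ∈ L := by
    intro x hx m hm
    induction hm using Submodule.span_induction with
    | mem m hm =>
      obtain ⟨k, _, rfl⟩ := hm
      exact hx k
    | zero => rw [smul_zero]; exact zero_mem _
    | add a b _ _ ha hb => rw [smul_add]; exact add_mem ha hb
    | smul a m hm' ih =>
      have : gU x • a • m = a • gU x • m + (gU x * a - a * gU x) • m := by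
        rw [sub_smul, mul_smul, mul_smul]
        change gU x • (a : U4) • m = (a : U4) • gU x • m + _
        abel
      rw [this]
      exact add_mem (L.smul_mem a ih) (L.smul_mem ⟨_, gU_commutator_mem_rAlg x a.2⟩ hm')
  have hsub : (submoduleOfGens (L.restrictScalars ℂ) (stab sl2E fun k => by
      have := hmem (k + 1)
      rwa [pow_succ', mul_smul] at this) (stab sl2F fun k => by
      rcases k with _ | k
      · rw [pow_zero, one_smul]
        change fU • y ∈ L
        rw [hy.1]; exact zero_mem _
      · change fU • _ ∈ L
        rw [hy.f_e_pow]
        exact (L.restrictScalars ℂ).smul_mem _ (hmem k))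
      (fun m hm => L.smul_mem ⟨_, xU_mem_rAlg 4⟩ hm) : Submodule U4 M) = ⊤ := by
    rw [eq_top_iff, ← hgen, Submodule.span_singleton_le_iff_mem]
    have := hmem 0
    rw [pow_zero, one_smul] at this
    exact this
  rw [eq_top_iff]
  intro m _
  have : m ∈ (⊤ : Submodule U4 M) := trivial
  rw [← hsub] at this
  exact this

/-- A nonzero finitely generated module over the image of `S(𝔯)` has a simple quotient, which is a
residue field of a finitely generated `ℂ`-algebra, hence `ℂ` itself by the Nullstellensatz. The
quotient map is the functional. -/
theorem exists_suppAt {N : ℕ} {y : M} (hy : IsLowest (N : ℂ) y) (he : eU ^ (N + 1) • y = 0)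
    (hgen : Submodule.span U4 {y} = ⊤) (hy0 : y ≠ 0) : ∃ χ, SuppAt M χ := by
  have hfin : Module.Finite rAlg M :=
    ⟨Submodule.fg_def.2 ⟨_, (Set.finite_Iic N).image _, span_rAlg_eq_top hy he hgen⟩⟩
  have : Nontrivial M := ⟨y, 0, hy0⟩
  obtain ⟨K, hK⟩ : ∃ K : Submodule rAlg M, IsCoatom K := by
    rcases eq_top_or_exists_le_coatom (⊥ : Submodule rAlg M) with h | ⟨K, hK, _⟩
    · exact absurd h bot_ne_top
    · exact ⟨K, hK⟩
  have : IsSimpleModule rAlg (M ⧸ K) := isSimpleModule_iff_isCoatom.2 hK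
  obtain ⟨I, hI, ⟨Φ⟩⟩ := isSimpleModule_iff_quot_maximal.1 this
  let _ : Field (rAlg ⧸ I) := Ideal.Quotient.field I
  have : Module.Finite ℂ (rAlg ⧸ I) := finite_of_finite_type_of_isJacobsonRing ℂ (rAlg ⧸ I)
  let ε : ℂ ≃ₐ[ℂ] (rAlg ⧸ I) := AlgEquiv.ofBijective (Algebra.ofId ℂ _)
    IsAlgClosed.algebraMap_bijective_of_isIntegral
  let g : M →ₗ[rAlg] (rAlg ⧸ I) := Φ.toLinearMap ∘ₗ K.mkQ
  have hg : Function.Surjective g := Φ.surjective.comp K.mkQ_surjective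
  refine ⟨fun j => ε.symm (Ideal.Quotient.mk I ⟨xU j, xU_mem_rAlg j⟩),
    ε.symm.toLinearMap ∘ₗ g.restrictScalars ℂ, fun h0 => ?_, fun j m => ?_⟩
  · obtain ⟨m, hm⟩ := hg 1
    have := LinearMap.congr_fun h0 m
    change ε.symm (g m) = 0 at this
    rw [hm, map_one] at this
    exact one_ne_zero this
  · change ε.symm (g ((⟨xU j, xU_mem_rAlg j⟩ : rAlg) • m)) = _
    rw [map_smul, Algebra.smul_def, map_mul]
    rfl

theorem iSup_eigenspace_hU_eq_top {y : M} {p : ℤ} (hy : hU • y = (p : ℂ) • y)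
    (hgen : Submodule.span U4 {y} = ⊤) :
    ⨆ p : ℤ, Module.End.eigenspace (act hU : Module.End ℂ M) (p : ℂ) = ⊤ := by
  set W := ⨆ p : ℤ, Module.End.eigenspace (act hU : Module.End ℂ M) (p : ℂ) with hW
  have stab : ∀ (u : U4) (d : ℤ), (∀ m : M, hU • u • m = u • hU • m + (d : ℂ) • u • m) →
      ∀ m ∈ W, u • m ∈ W := by
    intro u d hu m hm
    induction hm using Submodule.iSup_induction' with
    | mem p m hm =>
      have h : hU • m = (p : ℂ) • m := Module.End.mem_eigenspace_iff.1 hm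
      refine Submodule.mem_iSup_of_mem (p + d) (Module.End.mem_eigenspace_iff.2 ?_)
      rw [act_apply, hu, h, smul_complex_comm, ← add_smul]
      push_cast; rfl
    | zero => rw [smul_zero]; exact zero_mem _
    | add a b _ _ ha hb => rw [smul_add]; exact add_mem ha hb
  have hsub : (submoduleOfGens W (stab eU 2 fun m => by rw [h_e]; norm_cast)
      (stab fU (-2) fun m => by rw [h_f, sub_eq_add_neg, ← neg_smul]; norm_cast)
      (stab (xU 4) (-4) fun m => by rw [h_x]; norm_num) : Submodule U4 M) = ⊤ := by
    rw [eq_top_iff, ← hgen, Submodule.span_singleton_le_iff_mem, mem_submoduleOfGens]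
    exact Submodule.mem_iSup_of_mem p (Module.End.mem_eigenspace_iff.2 hy)
  rw [eq_top_iff]
  intro m _
  have : m ∈ (⊤ : Submodule U4 M) := trivial
  rwa [← hsub, mem_submoduleOfGens] at this

/-- `φ` is a functional of weight `p` supported at the point of `𝔯*` where `v₄ = v₂ = 0` and
`v₀ = c`, as far as these coordinates are concerned. -/
def IsWeightFunctional (p c : ℂ) (φ : M →ₗ[ℂ] ℂ) : Prop :=
  (∀ m, φ (xU 0 • m) = 0) ∧ (∀ m, φ (xU 1 • m) = 0) ∧ (∀ m, φ (xU 2 • m) = c * φ m) ∧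
    ∀ m, φ (hU • m) = p * φ m

theorem IsWeightFunctional.comp_xU {p c : ℂ} {φ : M →ₗ[ℂ] ℂ} (h : IsWeightFunctional p c φ)
    (j : Fin 5) : IsWeightFunctional (p + (2 * (j : ℕ) - 4)) c (φ ∘ₗ act (xU j)) := by
  obtain ⟨h0, h1, h2, hh⟩ := h
  refine ⟨fun m => ?_, fun m => ?_, fun m => ?_, fun m => ?_⟩ <;>
    simp only [LinearMap.comp_apply, act_apply]
  · rw [x_x, h0]
  · rw [x_x, h1]
  · rw [x_x, h2]
  · have : xU j • hU • m = hU • xU j • m - (4 - 2 * (j : ℕ) : ℂ) • xU j • m := by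
      rw [h_x]; abel
    rw [this, map_sub, hh, φ.map_smul, smul_eq_mul]
    ring

/-- For a diagonalizable operator the range of `T - p` lies in the sum of the other eigenspaces,
which meets the `p`-eigenspace trivially. -/
theorem eq_zero_of_mem_range_sub {V : Type*} [AddCommGroup V] [Module ℂ V] {T : Module.End ℂ V}
    {p : ℤ} (hT : ⨆ q : ℤ, T.eigenspace q = ⊤) {z v : V} (hz : T z = (p : ℂ) • z)
    (hv : T v - (p : ℂ) • v = z) : z = 0 := by
  have hind : iSupIndep fun q : ℤ => T.eigenspace (q : ℂ) :=
    T.eigenspaces_iSupIndep.comp Int.cast_injective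
  have hmem : ∀ v, T v - (p : ℂ) • v ∈ ⨆ q, ⨆ (_ : q ≠ p), T.eigenspace ((q : ℤ) : ℂ) := by
    intro v
    have hv : v ∈ ⨆ q : ℤ, T.eigenspace (q : ℂ) := hT ▸ Submodule.mem_top
    induction hv using Submodule.iSup_induction' with
    | mem q m hm =>
      have h : T m = (q : ℂ) • m := Module.End.mem_eigenspace_iff.1 hm
      by_cases hq : q = p
      · rw [h, hq, sub_self]; exact zero_mem _
      · rw [h, ← sub_smul]
        exact Submodule.smul_mem _ _ (Submodule.mem_iSup_of_mem q (Submodule.mem_iSup_of_mem hq hm))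
    | zero => simp
    | add a b _ _ ha hb =>
      rw [map_add, smul_add, add_sub_add_comm]; exact add_mem ha hb
  exact Submodule.disjoint_def.1 (hind p) z (Module.End.mem_eigenspace_iff.2 hz) (hv ▸ hmem v)

/-- The functional supplied by the support need not be an `h`-eigenvector. Its first three
conditions say that it vanishes on a subspace `K`, which is `h`-stable, so an eigenfunctional can be
chosen on `M ⧸ K`, where `h` is diagonalizable. -/
theorem exists_isWeightFunctional {c : ℂ} {χ : Fin 5 → ℂ} (h : SuppAt M χ) (h0 : χ 0 = 0)
    (h1 : χ 1 = 0) (h2 : χ 2 = c) (hW : ⨆ p : ℤ, Module.End.eigenspace (act hU : Module.End ℂ M) (p : ℂ) = ⊤) :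
    ∃ (p : ℤ) (φ : M →ₗ[ℂ] ℂ), φ ≠ 0 ∧ IsWeightFunctional p c φ := by
  obtain ⟨φ₀, hφ₀, hχ⟩ := h
  obtain ⟨p, z, hz, hφz⟩ : ∃ (p : ℤ) (z : M), hU • z = (p : ℂ) • z ∧ φ₀ z ≠ 0 := by
    by_contra hcon
    push Not at hcon
    apply hφ₀
    ext m
    have hm : m ∈ ⨆ p : ℤ, Module.End.eigenspace (act hU : Module.End ℂ M) (p : ℂ) := hW ▸ Submodule.mem_top
    induction hm using Submodule.iSup_induction' with
    | mem p m hm => exact hcon p m (Module.End.mem_eigenspace_iff.1 hm)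
    | zero => simp
    | add a b _ _ ha hb => rw [map_add, ha, hb]; simp
  let K : Submodule ℂ M := LinearMap.range (act (xU 0)) ⊔ LinearMap.range (act (xU 1)) ⊔
    LinearMap.range (act (xU 2) - c • LinearMap.id)
  have hK0 : K ≤ LinearMap.ker φ₀ := by
    refine sup_le (sup_le ?_ ?_) ?_ <;> rintro _ ⟨m, rfl⟩ <;> rw [LinearMap.mem_ker]
    · rw [act_apply, hχ, h0, zero_mul]
    · rw [act_apply, hχ, h1, zero_mul]
    · simp [act_apply, hχ, h2]
  have hKh : K ≤ K.comap (act hU) := by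
    refine sup_le (sup_le ?_ ?_) ?_ <;> rintro _ ⟨m, rfl⟩ <;>
      rw [Submodule.mem_comap, act_apply]
    · rw [act_apply, h_x]
      exact Submodule.mem_sup_left (Submodule.mem_sup_left
        (add_mem ⟨hU • m, rfl⟩ (Submodule.smul_mem _ _ ⟨m, rfl⟩)))
    · rw [act_apply, h_x]
      exact Submodule.mem_sup_left (Submodule.mem_sup_right
        (add_mem ⟨hU • m, rfl⟩ (Submodule.smul_mem _ _ ⟨m, rfl⟩)))
    · refine Submodule.mem_sup_right ⟨hU • m, ?_⟩
      simp only [LinearMap.sub_apply, act_apply, LinearMap.smul_apply, LinearMap.id_apply, smul_sub,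
        h_x, smul_complex_comm]
      norm_num
  let T : Module.End ℂ (M ⧸ K) := K.mapQ K (act hU) hKh
  have hTmk : ∀ m, T (K.mkQ m) = K.mkQ (hU • m) := fun m => rfl
  have hT : ⨆ q : ℤ, T.eigenspace (q : ℂ) = ⊤ := by
    rw [eq_top_iff]
    rintro v -
    obtain ⟨m, rfl⟩ := K.mkQ_surjective v
    have hm : m ∈ ⨆ p : ℤ, Module.End.eigenspace (act hU : Module.End ℂ M) (p : ℂ) := hW ▸ Submodule.mem_top
    induction hm using Submodule.iSup_induction' with
    | mem p m hm =>
      have h : hU • m = (p : ℂ) • m := Module.End.mem_eigenspace_iff.1 hm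
      refine Submodule.mem_iSup_of_mem p (Module.End.mem_eigenspace_iff.2 ?_)
      rw [hTmk, h, map_smul]
    | zero => rw [map_zero]; exact zero_mem _
    | add a b _ _ ha hb => rw [map_add]; exact add_mem ha hb
  have hzK : K.mkQ z ∉ LinearMap.range (T - (p : ℂ) • LinearMap.id) := by
    rintro ⟨v, hv⟩
    have h3 : K.mkQ z = 0 := eq_zero_of_mem_range_sub hT (by rw [hTmk, hz, map_smul]) hv
    rw [Submodule.mkQ_apply, Submodule.Quotient.mk_eq_zero] at h3
    exact hφz (hK0 h3)
  -- A functional vanishing on the range of `T - p` has weight `p`; it can be chosen nonzero at the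
  -- class of `z`.
  obtain ⟨ψ, hψ, hψ0⟩ := Submodule.exists_dual_map_eq_bot_of_notMem hzK inferInstance
  have hψr : ∀ v, ψ (T v - (p : ℂ) • v) = 0 := by
    intro v
    have : ψ ((T - (p : ℂ) • LinearMap.id : Module.End ℂ (M ⧸ K)) v) ∈
        (LinearMap.range (T - (p : ℂ) • LinearMap.id)).map ψ := ⟨_, ⟨v, rfl⟩, rfl⟩
    rw [hψ0] at this
    exact this
  have hψK : ∀ k ∈ K, ψ (K.mkQ k) = 0 := by
    intro k hk
    rw [Submodule.mkQ_apply, (Submodule.Quotient.mk_eq_zero K).2 hk, map_zero]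
  refine ⟨p, ψ ∘ₗ K.mkQ, fun h => hψ ?_, fun m => ?_, fun m => ?_, fun m => ?_, fun m => ?_⟩
  · exact LinearMap.congr_fun h z
  · exact hψK _ (Submodule.mem_sup_left (Submodule.mem_sup_left ⟨m, rfl⟩))
  · exact hψK _ (Submodule.mem_sup_left (Submodule.mem_sup_right ⟨m, rfl⟩))
  · have := hψK ((act (xU 2) - c • LinearMap.id : M →ₗ[ℂ] M) m) (Submodule.mem_sup_right ⟨m, rfl⟩)
    simp only [LinearMap.sub_apply, act_apply, LinearMap.smul_apply, LinearMap.id_apply, map_sub,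
      map_smul] at this
    simpa [sub_eq_zero] using this
  · have := hψr (K.mkQ m)
    rw [hTmk, map_sub, ψ.map_smul] at this
    exact sub_eq_zero.1 this

/-- The module is spanned over `S(𝔯)` by vectors of weight at most `N`. Absorbing an element of `𝔯`
into the functional gives zero for `v₄`, `v₂`, a scalar multiple for `v₀`, and a functional of
weight larger by `2` or `4` for `v₋₂`, `v₋₄`; a weight above `N` therefore stays above `N`. -/
theorem IsWeightFunctional.eq_zero {N : ℕ} {y : M} (hy : IsLowest (N : ℂ) y)
    (he : eU ^ (N + 1) • y = 0) (hgen : Submodule.span U4 {y} = ⊤) {c : ℂ} {p : ℤ} (hp : (N : ℤ) < p)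
    {φ : M →ₗ[ℂ] ℂ} (hφ : IsWeightFunctional p c φ) : φ = 0 := by
  have key : ∀ m : M, ∀ (p : ℤ), (N : ℤ) < p → ∀ φ : M →ₗ[ℂ] ℂ, IsWeightFunctional p c φ →
      φ m = 0 := by
    intro m
    have hm : m ∈ Submodule.span rAlg ((fun k => eU ^ k • y) '' Set.Iic N) := by
      rw [span_rAlg_eq_top hy he hgen]; trivial
    induction hm using Submodule.span_induction with
    | mem m hm =>
      obtain ⟨k, hk, rfl⟩ := hm
      intro p hp φ hφ
      have h := hφ.2.2.2 (eU ^ k • y)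
      rw [hy.h_e_pow, map_smul, smul_eq_mul] at h
      have h2 : ((2 * k - N : ℂ) - p) * φ (eU ^ k • y) = 0 := by linear_combination h
      rcases mul_eq_zero.1 h2 with h3 | h3
      · exfalso
        have : ((2 * k - N - p : ℤ) : ℂ) = 0 := by push_cast; exact h3
        have := Int.cast_eq_zero.1 this
        have := Set.mem_Iic.1 hk
        omega
      · exact h3
    | zero => simp
    | add a b _ _ ha hb =>
      intro p hp φ hφ
      rw [map_add, ha p hp φ hφ, hb p hp φ hφ, add_zero]
    | smul a m hm ih =>
      clear hm
      obtain ⟨a, ha⟩ := a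
      change ∀ (p : ℤ), (N : ℤ) < p → ∀ φ : M →ₗ[ℂ] ℂ, IsWeightFunctional p c φ → φ (a • m) = 0
      induction ha using Algebra.adjoin_induction generalizing m with
      | mem a ha =>
        obtain ⟨j, rfl⟩ := ha
        intro p hp φ hφ
        fin_cases j
        · exact hφ.1 m
        · exact hφ.2.1 m
        · exact (hφ.2.2.1 m).trans (by rw [ih p hp φ hφ, mul_zero])
        · exact ih (p + 2) (by omega) _ (by convert hφ.comp_xU 3 using 1; norm_num)
        · exact ih (p + 4) (by omega) _ (by convert hφ.comp_xU 4 using 1; norm_num)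
      | algebraMap r =>
        intro p hp φ hφ
        rw [algebraMap_smul_eq, map_smul, ih p hp φ hφ, smul_zero]
      | add a b _ _ ha hb =>
        intro p hp φ hφ
        rw [add_smul, map_add, ha m ih p hp φ hφ, hb m ih p hp φ hφ, add_zero]
      | mul a b _ _ ha hb =>
        rw [mul_smul]
        exact ha _ (hb m ih)
  exact LinearMap.ext fun m => key m p hp φ hφ

/-- A module generated by a lowest weight vector, on which `e` and `f` are locally nilpotent and
which has a central character, has a functional of weight `-n ≤ 0` supported at the point of `𝔯*`
with only nonzero coordinate `v₀`. -/
theorem exists_functional {N : ℕ} {y : M} (hy : IsLowest (N : ℂ) y) (heN : eU ^ (N + 1) • y = 0)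
    (hgen : Submodule.span U4 {y} = ⊤) (hy0 : y ≠ 0) (he : ∀ m : M, ∃ n, eU ^ n • m = 0)
    (hf : ∀ m : M, ∃ n, fU ^ n • m = 0) {c : ℂ} (hc : HasCharacter c M) :
    ∃ (n : ℕ) (φ : M →ₗ[ℂ] ℂ), φ ≠ 0 ∧
      (∀ j m, φ (xU j • m) = (if j = 2 then c else 0) * φ m) ∧ ∀ m, φ (hU • m) = -n * φ m := by
  classical
  obtain ⟨χ, hχ⟩ := exists_suppAt hy heN hgen hy0
  obtain ⟨χ, hχ, h0, h1, h2⟩ := hχ.exists_normalized he hf hc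
  have hW := iSup_eigenspace_hU_eq_top (p := -N) (by rw [hy.2]; norm_cast) hgen
  -- Maximality of the weight is what kills the last two coordinates: composing with `v₋₂` or `v₋₄`
  -- would produce a functional of larger weight.
  obtain ⟨p, ⟨φ, hφ0, hφ⟩, hmax⟩ := Int.exists_greatest_of_bdd
    (P := fun p => ∃ φ : M →ₗ[ℂ] ℂ, φ ≠ 0 ∧ IsWeightFunctional p c φ)
    ⟨N, fun p ⟨φ, hφ0, hφ⟩ => by
      by_contra hcon
      exact hφ0 (hφ.eq_zero hy heN hgen (not_le.1 hcon))⟩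
    (exists_isWeightFunctional hχ h0 h1 h2 hW)
  have h3 : φ ∘ₗ act (xU 3) = 0 := by
    by_contra hcon
    have := hmax (p + 2) ⟨_, hcon, by convert hφ.comp_xU 3 using 1; norm_num⟩
    omega
  have h4 : φ ∘ₗ act (xU 4) = 0 := by
    by_contra hcon
    have := hmax (p + 4) ⟨_, hcon, by convert hφ.comp_xU 4 using 1; norm_num⟩
    omega
  have h3' : ∀ m, φ (xU 3 • m) = 0 := LinearMap.congr_fun h3
  have h4' : ∀ m, φ (xU 4 • m) = 0 := LinearMap.congr_fun h4
  obtain ⟨h0', h1', h2', hh⟩ := hφ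
  rcases le_or_gt p 0 with hp | hp
  · obtain ⟨n, rfl⟩ : ∃ n : ℕ, p = -n := ⟨p.natAbs, by omega⟩
    refine ⟨n, φ, hφ0, fun j m => ?_, fun m => by rw [hh]; push_cast; ring⟩
    fin_cases j <;> simp [h0', h1', h2', h3', h4']
  · obtain ⟨n, rfl⟩ : ∃ n : ℕ, p = n := ⟨p.natAbs, by omega⟩
    -- The Weyl element negates the weight and fixes `v₀`, so the support is unchanged.
    refine ⟨n, φ ∘ₗ weylAct he hf, fun h => hφ0 ?_, fun j m => ?_, fun m => ?_⟩
    · ext m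
      obtain ⟨m, rfl⟩ := weylAct_surjective he hf m
      exact LinearMap.congr_fun h m
    · rw [LinearMap.comp_apply, weylAct_xU, map_smul]
      fin_cases j
      · have : φ (xU 4 • weylAct he hf m) = 0 := h4' _
        simpa [Fin.rev] using this
      · have : φ (xU 3 • weylAct he hf m) = 0 := h3' _
        simpa [Fin.rev] using this
      · have : φ (xU 2 • weylAct he hf m) = _ := h2' _
        simpa [Fin.rev] using this
      · have : φ (xU 1 • weylAct he hf m) = 0 := h1' _
        simpa [Fin.rev] using this
      · have : φ (xU 0 • weylAct he hf m) = 0 := h0' _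
        simpa [Fin.rev] using this
    · rw [LinearMap.comp_apply, weylAct_h, map_neg, hh]
      simp

end exist

end

/-! ### Frobenius reciprocity for the coinduced module -/

section coind
variable {M : Type*} [AddCommGroup M] [Module U4 M] [Module ℂ M] [IsScalarTower ℂ U4 M]

/-- `φ` is a functional of weight `i` supported at the point of `𝔯*` with only nonzero coordinate
`v₀ = c`. -/
def IsPointFunctional (i c : ℂ) (φ : M →ₗ[ℂ] ℂ) : Prop :=
  (∀ j m, φ (xU j • m) = (if j = 2 then c else 0) * φ m) ∧ ∀ m, φ (hU • m) = i * φ m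

section
variable {i c : ℂ} {φ : M →ₗ[ℂ] ℂ} (h : IsPointFunctional i c φ)
include h

theorem IsPointFunctional.e_pow_h (j : ℕ) (m : M) :
    φ (eU ^ j • hU • m) = (i - 2 * j) * φ (eU ^ j • m) := by
  have : eU ^ j • hU • m = hU • eU ^ j • m - (2 * j : ℂ) • eU ^ j • m := by
    rw [h_e_pow]; abel
  rw [this, map_sub, h.2, φ.map_smul, smul_eq_mul]; ring

/-- The five formulas for `v₄, …, v₋₄` are proved in this order because commuting `e` past each
vector produces the preceding one. -/
theorem IsPointFunctional.e_pow_x0 (j : ℕ) : ∀ m : M, φ (eU ^ j • xU 0 • m) = 0 := by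
  induction j with
  | zero => intro m; simp [h.1]
  | succ j ih => intro m; rw [pow_succ, mul_smul, e_x0, ih]

theorem IsPointFunctional.e_pow_x1 (j : ℕ) : ∀ m : M, φ (eU ^ j • xU 1 • m) = 0 := by
  induction j with
  | zero => intro m; simp [h.1]
  | succ j ih =>
    intro m
    rw [pow_succ, mul_smul, e_x1, smul_add, map_add, ih, smul_complex_comm, φ.map_smul,
      h.e_pow_x0, smul_zero, add_zero]

theorem IsPointFunctional.e_pow_x2 (j : ℕ) :
    ∀ m : M, φ (eU ^ j • xU 2 • m) = c * φ (eU ^ j • m) := by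
  induction j with
  | zero => intro m; simp [h.1]
  | succ j ih =>
    intro m
    rw [pow_succ, mul_smul, e_x2, smul_add, map_add, ih, smul_complex_comm, φ.map_smul,
      h.e_pow_x1, smul_zero, add_zero, mul_smul (eU ^ j)]

theorem IsPointFunctional.e_pow_x3 (j : ℕ) :
    ∀ m : M, φ (eU ^ j • xU 3 • m) = 2 * c * j * φ (eU ^ (j - 1) • m) := by
  induction j with
  | zero => intro m; simp [h.1]
  | succ j ih =>
    intro m
    rw [pow_succ, mul_smul, e_x3, smul_add, map_add, ih, smul_complex_comm, φ.map_smul,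
      h.e_pow_x2, smul_eq_mul, add_tsub_cancel_right]
    rcases j with _ | j
    · simp; ring
    · rw [add_tsub_cancel_right, pow_succ, mul_smul (eU ^ j)]; push_cast; ring

/-- Exactly two of the `j` factors `e` must hit `v₋₄` to turn it into `2v₀`, the only direction seen
by the functional; there are `j(j-1)/2` choices. -/
theorem IsPointFunctional.e_pow_x4 (j : ℕ) :
    ∀ m : M, φ (eU ^ j • xU 4 • m) = c * (j * (j - 1) * φ (eU ^ (j - 2) • m)) := by
  induction j with
  | zero => intro m; simp [h.1]
  | succ j ih =>
    intro m
    rw [pow_succ, mul_smul, e_x4, smul_add, map_add, ih, h.e_pow_x3]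
    rcases j with _ | _ | j
    · simp
    · simp; ring
    · simp only [Nat.reduceSubDiff, add_tsub_cancel_right, tsub_zero]
      rw [pow_succ, mul_smul (eU ^ j)]; push_cast; ring

/-- The homomorphism to the coinduced module defined by a functional. -/
noncomputable def IsPointFunctional.toSeries : M →ₗ[U4] Series i c :=
  homOfGens
    -- These are the Taylor coefficients, in divided powers, of `φ(exp(se) exp(tf) m)`.
    { toFun := fun m => (fun j k => φ (eU ^ j • fU ^ k • m) : Series i c)
      map_add' := fun m m' => by
        funext j k
        change φ (eU ^ j • fU ^ k • (m + m')) = φ (eU ^ j • fU ^ k • m) + φ (eU ^ j • fU ^ k • m')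
        simp only [smul_add, map_add]
      map_smul' := fun r m => by
        funext j k
        change φ (eU ^ j • fU ^ k • r • m) = r * φ (eU ^ j • fU ^ k • m)
        rw [smul_complex_comm, smul_complex_comm, φ.map_smul, smul_eq_mul] }
    (fun m => by
      funext j k
      rw [Series.e_apply]
      change φ (eU ^ j • fU ^ k • eU • m) = φ (eU ^ (j + 1) • fU ^ k • m)
        - k * (i - 2 * j + k - 1) * φ (eU ^ j • fU ^ (k - 1) • m)
      rw [f_pow_e, smul_sub, smul_sub, map_sub, map_sub, smul_complex_comm (eU ^ j),
        smul_complex_comm (eU ^ j), φ.map_smul, φ.map_smul, h.e_pow_h, pow_succ eU,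
        mul_smul (eU ^ j), smul_eq_mul, smul_eq_mul]
      ring)
    (fun m => by
      funext j k
      rw [Series.f_apply]
      change φ (eU ^ j • fU ^ k • fU • m) = φ (eU ^ j • fU ^ (k + 1) • m)
      rw [pow_succ fU, mul_smul])
    (fun m => by
      have hfx : ∀ k, fU ^ k • xU 4 • m = xU 4 • fU ^ k • m := by
        intro k
        induction k with
        | zero => simp
        | succ k ih => rw [pow_succ', mul_smul, ih, f_x4, mul_smul fU]
      funext j k
      rw [Series.x4_apply]
      change φ (eU ^ j • fU ^ k • xU 4 • m) = c * (j * (j - 1) * φ (eU ^ (j - 2) • fU ^ k • m))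
      rw [hfx, h.e_pow_x4])

theorem IsPointFunctional.toSeries_apply (m : M) (j k : ℕ) :
    h.toSeries m j k = φ (eU ^ j • fU ^ k • m) := rfl

theorem IsPointFunctional.toSeries_ne_zero (hφ : φ ≠ 0) : h.toSeries ≠ 0 := by
  intro h0
  apply hφ
  ext m
  have := congrFun (congrFun (LinearMap.congr_fun h0 m) 0) 0
  rw [h.toSeries_apply, pow_zero, pow_zero, one_smul, one_smul] at this
  exact this

end

end coind

/-! ### Character and lowest weight vectors of the coinduced module -/

section series
variable {i c : ℂ}

/-- The constant term of a power series. -/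
def Series.constTerm (i c : ℂ) : Series i c →ₗ[ℂ] ℂ where
  toFun a := a 0 0
  map_add' _ _ := rfl
  map_smul' _ _ := rfl

theorem seriesOps_X_apply_zero (c : ℂ) (j : Fin 5) (a : ℕ → ℕ → ℂ) :
    seriesOps.X c j a 0 0 = (if j = 2 then c else 0) * a 0 0 := by
  have hS : ∀ (a : ℕ → ℕ → ℂ) k, seriesOps.S a 0 k = 0 := fun a k => by simp [seriesOps]
  have hT : ∀ (a : ℕ → ℕ → ℂ) j, seriesOps.T a j 0 = 0 := fun a j => by simp [seriesOps]
  fin_cases j <;> simp [WeylOps.X, Module.End.mul_apply, hS, hT]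

theorem Series.isPointFunctional_constTerm : IsPointFunctional i c (Series.constTerm i c) := by
  refine ⟨fun j a => ?_, fun a => ?_⟩
  · change (xU j • a) 0 0 = _ * a 0 0
    rw [Series.smul_def, L4Ops.rep_xU]
    exact seriesOps_X_apply_zero c j a
  · change (hU • a) 0 0 = _ * a 0 0
    rw [Series.h_apply]; simp

theorem Series.constTerm_e_f (a : Series i c) (j k : ℕ) :
    Series.constTerm i c (eU ^ j • fU ^ k • a) = a j k := by
  have hf : ∀ k (a : Series i c) j l, (fU ^ k • a) j l = a j (l + k) := by
    intro k
    induction k with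
    | zero => intro a j l; simp
    | succ k ih => intro a j l; rw [pow_succ, mul_smul, ih, Series.f_apply]; rfl
  have he : ∀ j (a : Series i c) l, (eU ^ j • a) l 0 = a (l + j) 0 := by
    intro j
    induction j with
    | zero => intro a l; simp
    | succ j ih => intro a l; rw [pow_succ, mul_smul, ih, Series.e_apply]; simp; rfl
  change (eU ^ j • fU ^ k • a) 0 0 = _
  rw [he, hf, zero_add, zero_add]

/-- Each coefficient is the constant term after applying `eʲfᵏ`. A central element moves past these
to the constant term, where `𝔯` acts by the chosen point. -/
theorem Series.hasCharacter (i c : ℂ) : HasCharacter c (Series i c) := by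
  have h := Series.isPointFunctional_constTerm (i := i) (c := c)
  constructor
  · intro a
    rw [algebraMap_smul_eq]
    funext j k
    refine (Series.constTerm_e_f _ j k).symm.trans (Eq.trans ?_
      (congrArg (c ^ 2 * ·) (Series.constTerm_e_f a j k)))
    have : eU ^ j • fU ^ k • C2 • a = C2 • eU ^ j • fU ^ k • a := by
      simp only [← mul_smul, ← mul_assoc]
      rw [mul_assoc, C2_central, ← mul_assoc, C2_central]
    rw [this, C2_smul]
    simp [h.1]
    ring
  · intro a
    rw [algebraMap_smul_eq]
    funext j k
    refine (Series.constTerm_e_f _ j k).symm.trans (Eq.trans ?_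
      (congrArg (c ^ 3 * ·) (Series.constTerm_e_f a j k)))
    have : eU ^ j • fU ^ k • C3 • a = C3 • eU ^ j • fU ^ k • a := by
      simp only [← mul_smul, ← mul_assoc]
      rw [mul_assoc, C3_central, ← mul_assoc, C3_central]
    rw [this, C3_smul]
    simp [h.1]
    ring

theorem Series.xU_smul_eq_zero (j : Fin 5) (a : Series i 0) : xU j • a = 0 := by
  rw [Series.smul_def, L4Ops.rep_xU]
  have : (seriesOps.toL4Ops i 0).X j = 0 := by
    change seriesOps.X 0 j = 0
    fin_cases j <;> simp [WeylOps.X]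
  rw [this]; rfl

/-- The lowest weight vectors of `Series i c`. -/
theorem Series.exists_mono_of_isLowest {N : ℂ} {a : Series i c} (ha : IsLowest N a) (h0 : a ≠ 0) :
    ∃ (j : ℕ) (r : ℂ), r ≠ 0 ∧ N = 2 * j - i ∧ a = r • mono i c j 0 := by
  -- Being killed by `f = ∂/∂t` leaves only powers of `s`; the weights `i - 2j` then allow a single
  -- exponent.
  have hz : ∀ j k, a j (k + 1) = 0 := by
    intro j k
    exact (Series.f_apply a j k).symm.trans (by rw [ha.1]; rfl)
  obtain ⟨j, hj⟩ : ∃ j, a j 0 ≠ 0 := by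
    by_contra hcon
    push Not at hcon
    apply h0
    funext j k
    rcases k with _ | k
    · exact hcon j
    · exact hz j k
  have hw : ∀ j, a j 0 ≠ 0 → N = 2 * j - i := by
    intro j hj
    have h1 := congrFun (congrFun ha.2 j) 0
    rw [Series.h_apply, Series.complex_smul_apply] at h1
    have := mul_right_cancel₀ hj h1
    push_cast at this
    linear_combination this
  have hfac : (j.factorial : ℂ) ≠ 0 := by exact_mod_cast j.factorial_ne_zero
  refine ⟨j, a j 0 / j.factorial, div_ne_zero hj hfac, hw j hj, ?_⟩
  funext j' k'
  rw [Series.complex_smul_apply]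
  by_cases h : j' = j ∧ k' = 0
  · rw [h.1, h.2]
    simp [mono, hfac]
  · simp only [mono, h, if_false, mul_zero]
    rcases k' with _ | k'
    · by_contra hcon
      have h1 := (hw j' hcon).symm.trans (hw j hj)
      apply h
      refine ⟨?_, rfl⟩
      have h2 : (j' : ℂ) = j := by linear_combination h1 / 2
      exact_mod_cast h2
    · exact hz _ _

end series

/-! ### Integrable modules -/

section integrable

/-- A module on which `e`, `f` act locally nilpotently and `h` is diagonalizable. -/
structure Integrable (M : Type*) [AddCommGroup M] [Module U4 M] [Module ℂ M]
    [IsScalarTower ℂ U4 M] : Prop where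
  e : ∀ m : M, ∃ n, eU ^ n • m = 0
  f : ∀ m : M, ∃ n, fU ^ n • m = 0
  h : ⨆ μ : ℂ, Module.End.eigenspace (act hU : Module.End ℂ M) μ = ⊤

variable {M : Type*} [AddCommGroup M] [Module U4 M] [Module ℂ M] [IsScalarTower ℂ U4 M]

theorem iSup_eigenspace_of_surjective
    (hM : ⨆ μ : ℂ, Module.End.eigenspace (act hU : Module.End ℂ M) μ = ⊤)
    {M' : Type*} [AddCommGroup M'] [Module U4 M'] [Module ℂ M'] [IsScalarTower ℂ U4 M']
    (g : M →ₗ[U4] M') (hg : Function.Surjective g) :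
    ⨆ μ : ℂ, Module.End.eigenspace (act hU : Module.End ℂ M') μ = ⊤ := by
  rw [eq_top_iff]
  rintro m -
  obtain ⟨m, rfl⟩ := hg m
  have hm : m ∈ ⨆ μ : ℂ, Module.End.eigenspace (act hU : Module.End ℂ M) μ :=
    hM ▸ Submodule.mem_top
  induction hm using Submodule.iSup_induction' with
  | mem p m hm =>
    have h : hU • m = p • m := Module.End.mem_eigenspace_iff.1 hm
    refine Submodule.mem_iSup_of_mem p (Module.End.mem_eigenspace_iff.2 ?_)
    rw [act_apply, ← map_smul, h]
    exact LinearMap.map_smul_of_tower g p m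
  | zero => rw [map_zero]; exact zero_mem _
  | add a b _ _ ha hb => rw [map_add]; exact add_mem ha hb

theorem Integrable.of_surjective (hM : Integrable M) {M' : Type*} [AddCommGroup M'] [Module U4 M']
    [Module ℂ M'] [IsScalarTower ℂ U4 M'] (g : M →ₗ[U4] M') (hg : Function.Surjective g) :
    Integrable M' := by
  refine ⟨fun m => ?_, fun m => ?_, iSup_eigenspace_of_surjective hM.h g hg⟩
  · obtain ⟨m, rfl⟩ := hg m
    obtain ⟨n, hn⟩ := hM.e m
    exact ⟨n, by rw [← map_smul, hn, map_zero]⟩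
  · obtain ⟨m, rfl⟩ := hg m
    obtain ⟨n, hn⟩ := hM.f m
    exact ⟨n, by rw [← map_smul, hn, map_zero]⟩

/-- Modulo a stable subspace the components still are eigenvectors for distinct eigenvalues with sum
zero, so each of them vanishes there. This gives weight decompositions of submodules. -/
theorem mem_of_sum_eigenvectors_mem {V : Type*} [AddCommGroup V] [Module ℂ V] (T : Module.End ℂ V)
    {N : Submodule ℂ V} (hN : ∀ x ∈ N, T x ∈ N) {s : Finset ℂ} {v : ℂ → V}
    (hv : ∀ μ ∈ s, T (v μ) = μ • v μ) (hs : ∑ μ ∈ s, v μ ∈ N) : ∀ μ ∈ s, v μ ∈ N := by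
  have h := (iSupIndep_iff_finsetSum_eq_zero_imp_eq_zero _).1
    (Module.End.eigenspaces_iSupIndep (N.mapQ N T hN)) s (fun μ => N.mkQ (v μ)) (fun μ hμ => by
      rw [Module.End.mem_eigenspace_iff]
      change N.mkQ (T (v μ)) = _
      rw [hv μ hμ, map_smul]) (by
      rw [← map_sum]
      exact (Submodule.Quotient.mk_eq_zero N).2 hs)
  intro μ hμ
  exact (Submodule.Quotient.mk_eq_zero N).1 (h μ hμ)

theorem iSup_eigenspace_submodule (hM : ⨆ μ : ℂ, Module.End.eigenspace (act hU : Module.End ℂ M) μ = ⊤)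
    (N : Submodule U4 M) :
    ⨆ μ : ℂ, Module.End.eigenspace (act hU : Module.End ℂ N) μ = ⊤ := by
  rw [eq_top_iff]
  rintro ⟨m, hm⟩ -
  have h : m ∈ ⨆ μ : ℂ, Module.End.eigenspace (act hU : Module.End ℂ M) μ :=
    hM ▸ Submodule.mem_top
  obtain ⟨v, hv, rfl⟩ := (Submodule.mem_iSup_iff_exists_finsupp _ _).1 h
  have hmem := mem_of_sum_eigenvectors_mem (act hU : Module.End ℂ M) (N := N.restrictScalars ℂ)
    (fun m hm => N.smul_mem hU hm) (s := v.support) (v := v)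
    (fun μ _ => Module.End.mem_eigenspace_iff.1 (hv μ)) hm
  rw [Submodule.mem_iSup_iff_exists_finsupp]
  classical
  have hmem' : ∀ μ, v μ ∈ N := fun μ => by
    by_cases hμ : μ ∈ v.support
    · exact hmem μ hμ
    · rw [Finsupp.notMem_support_iff.1 hμ]; exact zero_mem _
  refine ⟨Finsupp.onFinset v.support (fun μ => ⟨v μ, hmem' μ⟩) fun μ h => ?_, fun μ => ?_, ?_⟩
  · rw [Finsupp.mem_support_iff]
    intro h0
    exact h (Subtype.ext h0)
  · rw [Module.End.mem_eigenspace_iff]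
    exact Subtype.ext (Module.End.mem_eigenspace_iff.1 (hv μ))
  · apply Subtype.ext
    rw [Finsupp.onFinset_sum _ (fun _ => rfl)]
    exact (AddSubmonoidClass.coe_finsetSum _ _)

theorem Integrable.submodule (hM : Integrable M) (N : Submodule U4 M) : Integrable N := by
  refine ⟨fun m => ?_, fun m => ?_, iSup_eigenspace_submodule hM.h N⟩
  · obtain ⟨n, hn⟩ := hM.e m
    exact ⟨n, Subtype.ext hn⟩
  · obtain ⟨n, hn⟩ := hM.f m
    exact ⟨n, Subtype.ext hn⟩

/-- Apply `f` to a weight vector until the last nonzero `y`, and `e` to `y` until `e^(l+1) y = 0`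
with `eˡy ≠ 0`. Then `f e^(l+1) y = 0` forces the lowest weight to be `-l`, so it is automatically
integral. -/
theorem Integrable.exists_lowest (hM : Integrable M) [Nontrivial M] :
    ∃ (N : ℕ) (y : M), y ≠ 0 ∧ IsLowest (N : ℂ) y ∧ eU ^ (N + 1) • y = 0 := by
  classical
  obtain ⟨μ, z, hz, hz0⟩ : ∃ (μ : ℂ) (z : M), hU • z = μ • z ∧ z ≠ 0 := by
    by_contra hcon
    push Not at hcon
    have : (⊤ : Submodule ℂ M) = ⊥ := by
      rw [← hM.h, iSup_eq_bot]
      intro μ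
      rw [Submodule.eq_bot_iff]
      intro z hz
      exact hcon μ z (Module.End.mem_eigenspace_iff.1 hz)
    exact absurd this top_ne_bot
  have hk := Nat.find_spec (hM.f z)
  have hmin := fun k => Nat.find_min (hM.f z) (m := k)
  obtain ⟨k, hkk⟩ : ∃ k, Nat.find (hM.f z) = k + 1 := by
    refine Nat.exists_eq_succ_of_ne_zero fun h0 => hz0 ?_
    rw [h0] at hk; simpa using hk
  rw [hkk] at hk hmin
  have hy0 : fU ^ k • z ≠ 0 := hmin k (by omega)
  obtain ⟨ν, hν⟩ : ∃ ν : ℂ, IsLowest ν (fU ^ k • z) := by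
    refine ⟨2 * k - μ, by rw [← mul_smul, ← pow_succ', hk], ?_⟩
    rw [h_f_pow, hz, smul_complex_comm, ← sub_smul]
    congr 1; ring
  set y := fU ^ k • z
  have hl := Nat.find_spec (hM.e y)
  have hlmin := fun k => Nat.find_min (hM.e y) (m := k)
  obtain ⟨l, hll⟩ : ∃ l, Nat.find (hM.e y) = l + 1 := by
    refine Nat.exists_eq_succ_of_ne_zero fun h0 => hy0 ?_
    rw [h0] at hl; simpa using hl
  rw [hll] at hl hlmin
  have h1 := hν.f_e_pow l
  rw [hl, smul_zero] at h1
  have h2 : ν = l := by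
    rcases smul_eq_zero.1 h1.symm with h3 | h3
    · rcases mul_eq_zero.1 h3 with h4 | h4
      · exact absurd h4 (Nat.cast_add_one_ne_zero l)
      · linear_combination h4
    · exact absurd h3 (hlmin l (by omega))
  exact ⟨l, y, hy0, h2 ▸ hν, hl⟩

theorem Integrable.of_lowest {ι : Type*} (t : ι → ℕ) (y : ι → M)
    (hy : ∀ k, IsLowest (t k : ℂ) (y k)) (he : ∀ k, eU ^ (t k + 1) • y k = 0)
    (hspan : Submodule.span ℂ {m | ∃ k a, m = eU ^ a • y k} = ⊤) : Integrable M := by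
  have nil : ∀ u : U4, (∀ k a, ∃ n, u ^ n • eU ^ a • y k = 0) → ∀ m : M, ∃ n, u ^ n • m = 0 := by
    intro u hu m
    have hm : m ∈ Submodule.span ℂ {m | ∃ k a, m = eU ^ a • y k} := hspan ▸ Submodule.mem_top
    induction hm using Submodule.span_induction with
    | mem m hm =>
      obtain ⟨k, a, rfl⟩ := hm
      exact hu k a
    | zero => exact ⟨0, by simp⟩
    | add a b _ _ ha hb =>
      obtain ⟨p, hp⟩ := ha
      obtain ⟨q, hq⟩ := hb
      refine ⟨p + q, ?_⟩
      rw [smul_add, pow_add, mul_smul, mul_smul, hq, smul_zero, add_zero, ← mul_smul, ← pow_add,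
        add_comm, pow_add, mul_smul, hp, smul_zero]
    | smul r m _ h =>
      obtain ⟨n, hn⟩ := h
      exact ⟨n, by rw [smul_complex_comm, hn, smul_zero]⟩
  refine ⟨nil _ fun k a => ⟨t k + 1, ?_⟩, nil _ fun k a => ⟨a + 1, ?_⟩, ?_⟩
  · rw [← mul_smul, ← pow_add, add_comm, pow_add, mul_smul, he, smul_zero]
  · induction a with
    | zero => simpa using (hy k).1
    | succ a ih =>
      rw [pow_succ, mul_smul, (hy k).f_e_pow, smul_complex_comm, ih, smul_zero]
  · rw [eq_top_iff, ← hspan, Submodule.span_le]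
    rintro _ ⟨k, a, rfl⟩
    exact Submodule.mem_iSup_of_mem _ (Module.End.mem_eigenspace_iff.2 ((hy k).h_e_pow a))

/-- An integrable module with a central character, generated by a lowest weight vector, has a
nonzero map to a coinduced module. -/
theorem Integrable.exists_toSeries (hM : Integrable M) {c : ℂ} (hc : HasCharacter c M) {N : ℕ}
    {y : M} (hy : IsLowest (N : ℂ) y) (heN : eU ^ (N + 1) • y = 0)
    (hgen : Submodule.span U4 {y} = ⊤) (hy0 : y ≠ 0) :
    ∃ (n : ℕ) (g : M →ₗ[U4] Series (-n) c), g y ≠ 0 := by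
  obtain ⟨n, φ, hφ, h1, h2⟩ := exists_functional hy heN hgen hy0 hM.e hM.f hc
  have h : IsPointFunctional (-n) c φ := ⟨h1, h2⟩
  refine ⟨n, h.toSeries, fun h0 => h.toSeries_ne_zero hφ ?_⟩
  have hker : LinearMap.ker h.toSeries = ⊤ := by
    rw [eq_top_iff, ← hgen, Submodule.span_singleton_le_iff_mem]
    exact h0
  exact LinearMap.ker_eq_top.1 hker

theorem HasCharacter.of_surjective {c : ℂ} (hM : HasCharacter c M) {M' : Type*} [AddCommGroup M']
    [Module U4 M'] (g : M →ₗ[U4] M') (hg : Function.Surjective g) : HasCharacter c M' := by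
  constructor <;> intro m <;> obtain ⟨m, rfl⟩ := hg m
  · rw [← map_smul, hM.1, map_smul]
  · rw [← map_smul, hM.2, map_smul]

theorem HasCharacter.submodule {c : ℂ} (hM : HasCharacter c M) (N : Submodule U4 M) :
    HasCharacter c N :=
  ⟨fun m => Subtype.ext (hM.1 m), fun m => Subtype.ext (hM.2 m)⟩

theorem IsLowest.map {N : ℂ} {y : M} (hy : IsLowest N y) {M' : Type*} [AddCommGroup M']
    [Module U4 M'] [Module ℂ M'] [IsScalarTower ℂ U4 M'] (g : M →ₗ[U4] M') : IsLowest N (g y) := by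
  refine ⟨by rw [← map_smul, hy.1, map_zero], ?_⟩
  rw [← map_smul, hy.2]
  exact LinearMap.map_smul_of_tower g _ y

end integrable

/-! ### The subspaces generated under `e` by powers of `s` -/

section mono
variable {i c : ℂ}

theorem e_mono_zero (k : ℕ) : eU • mono i c 0 k = (-i - k) • mono i c 0 (k + 1) := by
  rw [e_mono]; simp

theorem e_mono_succ (j k : ℕ) : eU • mono i c (j + 1) k
    = ((j : ℂ) + 1) • mono i c j k + (2 * (j + 1) - i - k) • mono i c (j + 1) (k + 1) := by
  rw [e_mono]; simp

theorem isLowest_mono (n j : ℕ) : IsLowest ((n + 2 * j : ℕ) : ℂ) (mono (-(n : ℂ)) c j 0) := by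
  refine ⟨by rw [f_mono]; simp, ?_⟩
  rw [h_mono]; congr 1; push_cast; ring

theorem mono_ne_zero (j k : ℕ) : mono i c j k ≠ 0 := by
  intro h
  have := congrFun (congrFun h j) k
  change (if j = j ∧ k = k then (j.factorial * k.factorial : ℂ) else 0) = 0 at this
  simp [Nat.factorial_ne_zero] at this

/-- Otherwise this vector would be killed by `f` and have the positive weight `n + 2j + 2`, whereas
all lowest weight vectors `s^(j')` have weight `-n - 2j' ≤ 0`. -/
theorem e_pow_mono (n j : ℕ) : eU ^ (n + 2 * j + 1) • mono (-(n : ℂ)) c j 0 = 0 := by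
  have hy := isLowest_mono (c := c) n j
  by_contra h0
  have hl : IsLowest (-(n + 2 * j + 2 : ℂ)) (eU ^ (n + 2 * j + 1) • mono (-(n : ℂ)) c j 0) := by
    constructor
    · rw [hy.f_e_pow, sub_self, mul_zero, zero_smul]
    · rw [hy.h_e_pow]; congr 1; push_cast; ring
  obtain ⟨j', r, -, h1, -⟩ := Series.exists_mono_of_isLowest hl h0
  have h2 : ((2 * j' + n + (n + 2 * j + 2) : ℕ) : ℂ) = 0 := by
    push_cast; linear_combination -h1
  have := Nat.cast_eq_zero.1 h2
  omega

end mono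

section stable
variable {M : Type*} [AddCommGroup M] [Module U4 M] [Module ℂ M] [IsScalarTower ℂ U4 M]

/-- Commuting `e` past one `v` produces the next higher one, so stability under `𝔯` need only be
checked on the generating vector. All five elements are carried along for the induction. -/
theorem xU_e_pow_mem (N : Submodule ℂ M) (hE : ∀ m ∈ N, eU • m ∈ N) {y : M}
    (hy : ∀ j, xU j • y ∈ N) (k : ℕ) : ∀ j, xU j • eU ^ k • y ∈ N := by
  induction k with
  | zero => intro j; simpa using hy j
  | succ k ih =>
    have key : ∀ (j : Fin 5) (w : M), w ∈ N →
        eU • xU j • eU ^ k • y = xU j • eU • eU ^ k • y + w →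
        xU j • eU ^ (k + 1) • y ∈ N := by
      intro j w hw h
      rw [pow_succ', mul_smul eU, eq_sub_of_add_eq h.symm]
      exact N.sub_mem (hE _ (ih j)) hw
    intro j
    fin_cases j
    · exact key 0 0 N.zero_mem (by rw [e_x0, add_zero])
    · exact key 1 _ (N.smul_mem _ (ih 0)) (e_x1 _)
    · exact key 2 _ (N.smul_mem _ (ih 1)) (e_x2 _)
    · exact key 3 _ (N.smul_mem _ (ih 2)) (e_x3 _)
    · exact key 4 _ (ih 3) (e_x4 _)

variable {n : ℕ} {c : ℂ}

/-- Induction on `k` through `e · sʲtᵏ = j sʲ⁻¹tᵏ + (2j + n - k) sʲtᵏ⁺¹`: the last coefficient is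
positive when `k + 1 ≤ n + j`, and then `sʲ⁻¹tᵏ` is still in the range. -/
theorem mono_mem_of_le (N : Submodule ℂ (Series (-(n : ℂ)) c))
    (hE : ∀ m ∈ N, eU • m ∈ N) (hy : ∀ j, mono (-(n : ℂ)) c j 0 ∈ N) (k : ℕ) :
    ∀ j, k ≤ n + j → mono (-(n : ℂ)) c j k ∈ N := by
  induction k with
  | zero => intro j _; exact hy j
  | succ k ih =>
    intro j hj
    have h0 : (2 * j - -(n : ℂ) - k) ≠ 0 := by
      obtain ⟨d, hd⟩ := Nat.exists_eq_add_of_le hj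
      have h1 : (n : ℂ) + j = k + 1 + d := by exact_mod_cast hd
      have h2 : (2 * j - -(n : ℂ) - k) = ((j + d + 1 : ℕ) : ℂ) := by
        push_cast; linear_combination h1
      rw [h2]
      exact_mod_cast (by omega : j + d + 1 ≠ 0)
    have h1 := hE _ (ih j (by omega))
    rw [e_mono] at h1
    rw [← N.smul_mem_iff h0]
    refine (N.add_mem_iff_right ?_).1 h1
    rcases j with _ | j
    · simp
    · exact N.smul_mem _ (ih j (by omega))

/-- For `n > 0` every monomial occurring in `v_k · sʲ` satisfies the bound of `mono_mem_of_le`,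
except `t²` in `v₄ · 1` when `n = 1`. -/
theorem xU_mono_mem_of_pos (hn : 0 < n) (N : Submodule ℂ (Series (-(n : ℂ)) c))
    (hE : ∀ m ∈ N, eU • m ∈ N) (hy : ∀ j, mono (-(n : ℂ)) c j 0 ∈ N) (j : ℕ) (a : Fin 5) :
    xU a • mono (-(n : ℂ)) c j 0 ∈ N := by
  have hm := mono_mem_of_le N hE hy
  fin_cases a
  · by_cases h : 2 ≤ n + j
    · refine (congrArg (· ∈ N) (x0_mono j 0)).mpr ?_
      exact N.smul_mem _ (N.add_mem (N.add_mem (hm _ _ (by omega))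
        (N.smul_mem _ (hm _ _ (by omega)))) (hm _ _ (by omega)))
    · obtain rfl : n = 1 := by omega
      obtain rfl : j = 0 := by omega
      have h1 := hE _ (hm 2 1 (by omega))
      have h2 := hE _ (hm 3 2 (by omega))
      -- Although `t²` alone is out of reach, the combination needed is `e` applied to `st² +
      -- s²t³/2`.
      have : xU 0 • mono (-((1 : ℕ) : ℂ)) c 0 0 = c • (eU • mono (-((1 : ℕ) : ℂ)) c 1 2
          + (1 / 2 : ℂ) • eU • mono (-((1 : ℕ) : ℂ)) c 2 3) := by
        rw [x0_mono, e_mono_succ 0, e_mono_succ 1]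
        match_scalars <;> ring
      refine (congrArg (· ∈ N) this).mpr ?_
      exact N.smul_mem _ (N.add_mem h1 (N.smul_mem _ h2))
  · refine (congrArg (· ∈ N) (x1_mono j 0)).mpr ?_
    exact N.smul_mem _ (N.add_mem (N.add_mem (N.smul_mem _ (hm _ _ (by omega)))
      (N.smul_mem _ (hm _ _ (by omega)))) (N.smul_mem _ (hm _ _ (by omega))))
  · refine (congrArg (· ∈ N) (x2_mono j 0)).mpr ?_
    exact N.smul_mem _ (N.add_mem (N.add_mem (hm _ _ (by omega))
      (N.smul_mem _ (hm _ _ (by omega)))) (N.smul_mem _ (hm _ _ (by omega))))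
  · refine (congrArg (· ∈ N) (x3_mono j 0)).mpr ?_
    exact N.smul_mem _ (N.add_mem (N.smul_mem _ (hm _ _ (by omega)))
      (N.smul_mem _ (hm _ _ (by omega))))
  · refine (congrArg (· ∈ N) (x4_mono j 0)).mpr ?_
    exact N.smul_mem _ (hm _ _ (by omega))

/-- For `n = 0` and powers of `s` of one parity the separate monomials are not available; this
combination is, because `e² s^(j+2)` equals a multiple of it plus a multiple of `sʲ`. -/
theorem mono_add_mono_mem (N : Submodule ℂ (Series 0 c)) (hE : ∀ m ∈ N, eU • m ∈ N) {j : ℕ}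
    (h0 : mono 0 c j 0 ∈ N) (h2 : mono 0 c (j + 2) 0 ∈ N) :
    mono 0 c (j + 1) 1 + mono 0 c (j + 2) 2 ∈ N := by
  have hne : ((j : ℂ) + 2) * (4 * j + 6) ≠ 0 := by
    exact_mod_cast (by positivity : (j + 2) * (4 * j + 6) ≠ 0)
  have key : (((j : ℂ) + 2) * (4 * j + 6)) • (mono 0 c (j + 1) 1 + mono 0 c (j + 2) 2)
      = eU • eU • mono 0 c (j + 2) 0 - (((j : ℂ) + 2) * (j + 1)) • mono 0 c j 0 := by
    rw [e_mono_succ (j + 1), smul_add eU, smul_complex_comm eU, smul_complex_comm eU,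
      e_mono_succ j, e_mono_succ (j + 1)]
    match_scalars <;> ring
  rw [← N.smul_mem_iff hne, key]
  exact N.sub_mem (hE _ (hE _ h2)) (N.smul_mem _ h0)

/-- The same combination one step below, where the term in `sʲ` is absent; it is needed for `v₄ ·
s`. -/
theorem mono_add_mono_mem_one (N : Submodule ℂ (Series 0 c)) (hE : ∀ m ∈ N, eU • m ∈ N)
    (h1 : mono 0 c 1 0 ∈ N) : mono 0 c 0 1 + mono 0 c 1 2 ∈ N := by
  have key : (2 : ℂ) • (mono 0 c 0 1 + mono 0 c 1 2) = eU • eU • mono 0 c 1 0 := by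
    rw [e_mono_succ 0, smul_add eU, smul_complex_comm eU, smul_complex_comm eU, e_mono_succ 0,
      e_mono_zero]
    match_scalars <;> ring
  rw [← N.smul_mem_iff (two_ne_zero : (2 : ℂ) ≠ 0), key]
  exact hE _ (hE _ h1)

/-- With `A = s^(j+1)t + s^(j+2)t²`, each `v_k · sʲ` is written through `A`, the allowed powers of
`s` and their images under `e`. Only exponents of the parity of `j` enter, which is why `V'(0)` and
`V'(2)` are separate modules. -/
theorem xU_mono_mem_of_zero (N : Submodule ℂ (Series 0 c)) (hE : ∀ m ∈ N, eU • m ∈ N)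
    (J : Set ℕ) (hJ : ∀ j, j ∈ J ↔ j + 2 ∈ J) (hy : ∀ j ∈ J, mono 0 c j 0 ∈ N) (j : ℕ)
    (hjJ : j ∈ J) (a : Fin 5) : xU a • mono 0 c j 0 ∈ N := by
  have hj := hy j hjJ
  have hj2 := hy _ ((hJ j).1 hjJ)
  have hA := mono_add_mono_mem N hE hj hj2
  have hj1 : (j : ℂ) + 1 ≠ 0 := Nat.cast_add_one_ne_zero j
  have hjj : (j : ℂ) + 2 ≠ 0 := by exact_mod_cast (by omega : j + 2 ≠ 0)
  have e1 : xU 1 • mono 0 c j 0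
      = (2 * c / (j + 1)) • eU • (mono 0 c (j + 1) 1 + mono 0 c (j + 2) 2) := by
    rw [x1_mono, smul_add eU, e_mono_succ j, e_mono_succ (j + 1)]
    match_scalars <;> field_simp <;> ring
  have m1 : xU 1 • mono 0 c j 0 ∈ N :=
    (congrArg (· ∈ N) e1).mpr (N.smul_mem _ (hE _ hA))
  fin_cases a
  · have hne : (4 * j + 2 : ℂ) ≠ 0 := by exact_mod_cast (by omega : 4 * j + 2 ≠ 0)
    change xU 0 • mono 0 c j 0 ∈ N
    rw [← N.smul_mem_iff hne]
    -- Half of `e v₂ sʲ` equals `(4j + 2) v₄ sʲ` plus `cj (s^(j-1)t + sʲt²)`. The cases `j = 0`, `j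
    -- = 1` and `j ≥ 2` differ in how this correction is known to lie in `N`.
    have hE1 := N.smul_mem (1 / 2 : ℂ) (hE _ m1)
    rcases j with _ | _ | j
    · have : (4 * (0 : ℕ) + 2 : ℂ) • xU 0 • mono 0 c 0 0 = (1 / 2 : ℂ) • eU • xU 1 • mono 0 c 0 0 := by
        rw [x0_mono, x1_mono, smul_complex_comm eU, smul_add eU, smul_add eU, smul_complex_comm eU,
          smul_complex_comm eU, smul_complex_comm eU, e_mono_zero, e_mono_succ, e_mono_succ]
        match_scalars <;> ring
      rw [this]; exact hE1
    · have : (4 * (0 + 1 : ℕ) + 2 : ℂ) • xU 0 • mono 0 c (0 + 1) 0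
          = (1 / 2 : ℂ) • eU • xU 1 • mono 0 c (0 + 1) 0 - c • (mono 0 c 0 1 + mono 0 c 1 2) := by
        rw [x0_mono, x1_mono, smul_complex_comm eU, smul_add eU, smul_add eU, smul_complex_comm eU,
          smul_complex_comm eU, smul_complex_comm eU, e_mono_succ, e_mono_succ, e_mono_succ]
        match_scalars <;> ring
      rw [this]
      exact N.sub_mem hE1 (N.smul_mem _ (mono_add_mono_mem_one N hE hj))
    · have : (4 * (j + 1 + 1 : ℕ) + 2 : ℂ) • xU 0 • mono 0 c (j + 1 + 1) 0
          = (1 / 2 : ℂ) • eU • xU 1 • mono 0 c (j + 1 + 1) 0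
            - (c * (j + 2)) • (mono 0 c (j + 1) 1 + mono 0 c (j + 2) 2) := by
        rw [x0_mono, x1_mono, smul_complex_comm eU, smul_add eU, smul_add eU, smul_complex_comm eU,
          smul_complex_comm eU, smul_complex_comm eU, e_mono_succ, e_mono_succ, e_mono_succ]
        match_scalars <;> ring
      rw [this]
      exact N.sub_mem hE1 (N.smul_mem _ (mono_add_mono_mem N hE (hy _ ((hJ j).2 hjJ)) hj))
  · exact m1
  · have : xU 2 • mono 0 c j 0 = c • (mono 0 c j 0
        + (6 : ℂ) • (mono 0 c (j + 1) 1 + mono 0 c (j + 2) 2)) := by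
      rw [x2_mono]; module
    change xU 2 • mono 0 c j 0 ∈ N
    rw [this]
    exact N.smul_mem _ (N.add_mem hj (N.smul_mem _ hA))
  · have : xU 3 • mono 0 c j 0 = (2 * c / (j + 2)) • eU • mono 0 c (j + 2) 0 := by
      rw [x3_mono, e_mono_succ (j + 1)]
      match_scalars <;> field_simp <;> ring
    change xU 3 • mono 0 c j 0 ∈ N
    rw [this]
    exact N.smul_mem _ (hE _ hj2)
  · change xU 4 • mono 0 c j 0 ∈ N
    rw [x4_mono]
    exact N.smul_mem _ hj2

end stable

/-! ### The modules `V(i, c)`, `V'(0, c)`, `V'(2, c)` inside the coinduced modules -/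

/-- The weight of the functional defining the family. -/
def Label.n : Label → ℕ
  | .V i => i
  | .V'0 => 0
  | .V'2 => 0

/-- The degrees of the lowest weight vectors. -/
def Label.J : Label → ℕ → ℕ
  | .V _, k => k
  | .V'0, k => 2 * k
  | .V'2, k => 2 * k + 1

theorem Label.gTypes_eq (a : Label) (k : ℕ) : a.gTypes k = a.n + 2 * a.J k := by
  cases a <;> simp [Label.gTypes, Label.n, Label.J] <;> ring

theorem Label.J_injective (a : Label) : Function.Injective a.J := by
  intro k l h
  cases a <;> simp [Label.J] at h <;> exact h

/-- The span of the `𝔤`-submodules generated by the lowest weight vectors. -/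
noncomputable def lowSpan (a : Label) (c : ℂ) : Submodule ℂ (Series (-(a.n : ℂ)) c) :=
  Submodule.span ℂ {m | ∃ k l, m = eU ^ l • mono (-(a.n : ℂ)) c (a.J k) 0}

theorem mono_mem_lowSpan (a : Label) (c : ℂ) (k : ℕ) :
    mono (-(a.n : ℂ)) c (a.J k) 0 ∈ lowSpan a c :=
  Submodule.subset_span ⟨k, 0, by simp⟩

theorem lowSpan_e (a : Label) (c : ℂ) (m : Series (-(a.n : ℂ)) c) (hm : m ∈ lowSpan a c) :
    eU • m ∈ lowSpan a c := by
  have : lowSpan a c ≤ (lowSpan a c).comap (act eU) := by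
    refine Submodule.span_le.2 ?_
    rintro _ ⟨k, l, rfl⟩
    refine Submodule.subset_span ⟨k, l + 1, ?_⟩
    rw [act_apply, pow_succ', mul_smul]
  exact this hm

theorem lowSpan_f (a : Label) (c : ℂ) (m : Series (-(a.n : ℂ)) c) (hm : m ∈ lowSpan a c) :
    fU • m ∈ lowSpan a c := by
  have : lowSpan a c ≤ (lowSpan a c).comap (act fU) := by
    refine Submodule.span_le.2 ?_
    rintro _ ⟨k, l, rfl⟩
    change fU • eU ^ l • _ ∈ lowSpan a c
    have hy := isLowest_mono (c := c) a.n (a.J k)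
    rcases l with _ | l
    · rw [pow_zero, one_smul, hy.1]; exact zero_mem _
    · rw [hy.f_e_pow]
      exact Submodule.smul_mem _ _ (Submodule.subset_span ⟨k, l, rfl⟩)
  exact this hm

theorem xU_mono_mem_lowSpan (a : Label) (c : ℂ) (k : ℕ) (l : Fin 5) :
    xU l • mono (-(a.n : ℂ)) c (a.J k) 0 ∈ lowSpan a c := by
  have hE := lowSpan_e a c
  have hy := mono_mem_lowSpan a c
  -- For the two labels with `n = 0` the weight is the cast `-(0 : ℕ)`, not literally `0`;
  -- quantifying over `i = 0` allows the substitution.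
  have zero : ∀ (i : ℂ), i = 0 → ∀ N : Submodule ℂ (Series i c), (∀ m ∈ N, eU • m ∈ N) →
      ∀ J : Set ℕ, (∀ j, j ∈ J ↔ j + 2 ∈ J) → (∀ j ∈ J, mono i c j 0 ∈ N) → ∀ j ∈ J,
        xU l • mono i c j 0 ∈ N := by
    rintro i rfl N hE J hJ hy j hj
    exact xU_mono_mem_of_zero N hE J hJ hy j hj l
  cases a with
  | V i => exact xU_mono_mem_of_pos i.2 _ hE hy k l
  | V'0 =>
    refine zero _ (by simp [Label.n]) _ hE {j | j % 2 = 0}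
      (fun j => by simp) (fun j hj => ?_) _ (by simp [Label.J])
    have := hy (j / 2)
    rwa [show Label.V'0.J (j / 2) = j by have : j % 2 = 0 := hj; simp only [Label.J]; omega] at this
  | V'2 =>
    refine zero _ (by simp [Label.n]) _ hE {j | j % 2 = 1}
      (fun j => by simp) (fun j hj => ?_) _ (by simp [Label.J])
    have := hy (j / 2)
    rwa [show Label.V'2.J (j / 2) = j by have : j % 2 = 1 := hj; simp only [Label.J]; omega] at this

/-- The modules `V(i, c)`, `V'(0, c)` and `V'(2, c)`. -/
noncomputable def repV (a : Label) (c : ℂ) : Submodule U4 (Series (-(a.n : ℂ)) c) :=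
  submoduleOfGens (lowSpan a c) (lowSpan_e a c) (lowSpan_f a c) (by
    have : lowSpan a c ≤ (lowSpan a c).comap (act (xU 4)) := by
      refine Submodule.span_le.2 ?_
      rintro _ ⟨k, l, rfl⟩
      exact xU_e_pow_mem _ (lowSpan_e a c) (xU_mono_mem_lowSpan a c k) l 4
    exact fun m hm => this hm)

/-- The lowest weight vectors of `repV a c`. -/
noncomputable def repV.low (a : Label) (c : ℂ) (k : ℕ) : repV a c :=
  ⟨mono (-(a.n : ℂ)) c (a.J k) 0, mono_mem_lowSpan a c k⟩

theorem repV.isLowest_low (a : Label) (c : ℂ) (k : ℕ) :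
    IsLowest (a.gTypes k : ℂ) (repV.low a c k) := by
  have h := isLowest_mono (c := c) a.n (a.J k)
  rw [a.gTypes_eq]
  exact ⟨Subtype.ext h.1, Subtype.ext h.2⟩

theorem repV.low_ne_zero (a : Label) (c : ℂ) (k : ℕ) : repV.low a c k ≠ 0 :=
  fun h => mono_ne_zero _ _ (congrArg Subtype.val h)

theorem repV.e_pow_low (a : Label) (c : ℂ) (k : ℕ) :
    eU ^ (a.gTypes k + 1) • repV.low a c k = 0 := by
  rw [a.gTypes_eq]
  exact Subtype.ext (e_pow_mono _ _)

theorem repV.span_low (a : Label) (c : ℂ) :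
    Submodule.span ℂ {m | ∃ k l, m = eU ^ l • repV.low a c k} = ⊤ := by
  rw [eq_top_iff]
  rintro ⟨m, hm⟩ -
  refine Submodule.span_induction (p := fun m (hm : m ∈ lowSpan a c) =>
    (⟨m, hm⟩ : repV a c) ∈ Submodule.span ℂ {m | ∃ k l, m = eU ^ l • repV.low a c k})
    ?_ ?_ ?_ ?_ hm
  · rintro _ ⟨k, l, rfl⟩
    exact Submodule.subset_span ⟨k, l, rfl⟩
  · exact zero_mem _
  · intro x y _ _ hx hy
    exact add_mem hx hy
  · intro r x _ hx
    exact Submodule.smul_mem _ r hx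

theorem repV.integrable (a : Label) (c : ℂ) : Integrable (repV a c) :=
  Integrable.of_lowest a.gTypes (repV.low a c) (repV.isLowest_low a c) (repV.e_pow_low a c)
    (repV.span_low a c)

theorem Label.gTypes_injective (a : Label) : Function.Injective a.gTypes := by
  intro k l h
  rw [a.gTypes_eq, a.gTypes_eq] at h
  exact a.J_injective (by omega)

theorem repV.hasGTypes (a : Label) (c : ℂ) : HasGTypes a.gTypes (repV a c) :=
  hasGTypes_of_lowest a.gTypes a.gTypes_injective (repV.low a c) (repV.isLowest_low a c)
    (repV.low_ne_zero a c) (repV.e_pow_low a c) (repV.span_low a c)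

theorem repV.hasCharacter (a : Label) (c : ℂ) : HasCharacter c (repV a c) :=
  (Series.hasCharacter _ c).submodule _

/-! ### Simplicity for nonzero character -/

section simple
variable {c : ℂ}

theorem x4_pow_mono {i : ℂ} (j p : ℕ) :
    xU 4 ^ p • mono i c j 0 = c ^ p • mono i c (j + 2 * p) 0 := by
  induction p with
  | zero => simp
  | succ p ih =>
    rw [pow_succ', mul_smul, ih, smul_complex_comm, x4_mono, smul_smul, ← pow_succ]
    rfl

theorem mono_add_two_mem (hc : c ≠ 0) {i : ℂ} (N : Submodule U4 (Series i c)) {j : ℕ}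
    (hj : mono i c j 0 ∈ N) (p : ℕ) : mono i c (j + 2 * p) 0 ∈ N := by
  have h := N.smul_mem (xU 4 ^ p) hj
  rw [x4_pow_mono] at h
  exact ((N.restrictScalars ℂ).smul_mem_iff (pow_ne_zero p hc)).1 h

/-- Eliminating `s^(j+2)t` between `v₋₂ sʲ` and `e s^(j+2)` leaves `s^(j+1)` with a coefficient
proportional to `cn`. It is nonzero for `n > 0` and vanishes for `n = 0`, where the two parities
separate. -/
theorem mono_add_one_mem (hc : c ≠ 0) {n : ℕ} (hn : 0 < n)
    (N : Submodule U4 (Series (-(n : ℂ)) c)) {j : ℕ} (hj : mono (-(n : ℂ)) c j 0 ∈ N) :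
    mono (-(n : ℂ)) c (j + 1) 0 ∈ N := by
  have h2 := N.smul_mem eU (mono_add_two_mem hc N hj 1)
  have h3 := N.smul_mem (xU 3) hj
  have hn0 : (n : ℂ) ≠ 0 := by exact_mod_cast hn.ne'
  have hn1 : (n : ℂ) + 2 * j + 4 ≠ 0 := by exact_mod_cast (by omega : n + 2 * j + 4 ≠ 0)
  have key : (2 * c * n / (n + 2 * j + 4)) • mono (-(n : ℂ)) c (j + 1) 0
      = xU 3 • mono (-(n : ℂ)) c j 0
        - (4 * c / (n + 2 * j + 4)) • eU • mono (-(n : ℂ)) c (j + 2 * 1) 0 := by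
    rw [x3_mono, e_mono_succ (j + 1)]
    match_scalars <;> field_simp <;> ring
  have h4 : (2 * c * n / (n + 2 * j + 4)) • mono (-(n : ℂ)) c (j + 1) 0 ∈ N.restrictScalars ℂ := by
    rw [key]
    exact sub_mem h3 ((N.restrictScalars ℂ).smul_mem _ h2)
  exact ((N.restrictScalars ℂ).smul_mem_iff (div_ne_zero (by simp [hc, hn0]) hn1)).1 h4

/-- The exponent `J l + 2k` is chosen so that, up to a scalar, the vector is `v₋₄ᵏ s^(J l)`: one
lowest weight vector in a submodule puts a `v₋₄`-power multiple of every other one into it. -/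
theorem exists_mono_mem (hc : c ≠ 0) (a : Label) (N : Submodule U4 (Series (-(a.n : ℂ)) c)) {k : ℕ}
    (hk : mono (-(a.n : ℂ)) c (a.J k) 0 ∈ N) (l : ℕ) :
    mono (-(a.n : ℂ)) c (a.J l + 2 * k) 0 ∈ N := by
  cases a with
  | V i =>
    have : ∀ q, mono (-((Label.V i).n : ℂ)) c (k + q) 0 ∈ N := by
      intro q
      induction q with
      | zero => exact hk
      | succ q ih => exact mono_add_one_mem hc i.2 N ih
    have h := this (l + k)
    rwa [show k + (l + k) = (Label.V i).J l + 2 * k by simp only [Label.J]; omega] at h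
  | V'0 =>
    have h := mono_add_two_mem hc N hk l
    rwa [show Label.V'0.J k + 2 * l = Label.V'0.J l + 2 * k by simp only [Label.J]; omega] at h
  | V'2 =>
    have h := mono_add_two_mem hc N hk l
    rwa [show Label.V'2.J k + 2 * l = Label.V'2.J l + 2 * k by simp only [Label.J]; omega] at h

/-- A nonzero submodule `N` contains some `s^(J k)`. If it is proper, some `s^(J l)` is nonzero
modulo `N` but killed by `v₋₄ᵏ`. The submodule it generates in the quotient maps nontrivially to a
coinduced module of the same `c`, where `v₋₄` is injective: a contradiction. -/
theorem repV.isSimpleModule (hc : c ≠ 0) (a : Label) : IsSimpleModule U4 (repV a c) := by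
  rw [isSimpleModule_iff]
  have : Nontrivial (repV a c) := ⟨_, _, repV.low_ne_zero a c 0⟩
  refine ⟨fun N => or_iff_not_imp_left.2 fun hbot => ?_⟩
  by_contra htop
  have hI := repV.integrable a c
  -- `N` is integrable, so it has a lowest weight vector; that is a multiple of a power of `s`,
  -- whose exponent must be among the `J k` because its weight is a `𝔤`-type.
  obtain ⟨k, hk⟩ : ∃ k, repV.low a c k ∈ N := by
    have : Nontrivial N := Submodule.nontrivial_iff_ne_bot.2 hbot
    obtain ⟨t, y, hy0, hy, -⟩ := (hI.submodule N).exists_lowest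
    have hy1 : IsLowest (t : ℂ) (y : repV a c) := hy.map N.subtype
    have hy10 : (y : repV a c) ≠ 0 := fun h => hy0 (Subtype.ext h)
    have hy2 : IsLowest (t : ℂ) ((y : repV a c) : Series (-(a.n : ℂ)) c) :=
      hy1.map (repV a c).subtype
    obtain ⟨k, hk⟩ := ((repV.hasGTypes a c).exists_lowest_iff t).1 ⟨y, hy10, hy1⟩
    obtain ⟨j, r, hr, h1, h2⟩ := Series.exists_mono_of_isLowest hy2 (fun h => hy10 (Subtype.ext h))
    have hj : j = a.J k := by
      rw [← hk, a.gTypes_eq] at h1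
      push_cast at h1
      have h3 : (j : ℂ) = a.J k := by linear_combination -h1 / 2
      exact_mod_cast h3
    refine ⟨k, ((N.restrictScalars ℂ).smul_mem_iff hr).1 ?_⟩
    have : r • repV.low a c k = y := Subtype.ext (by rw [h2, hj]; rfl)
    rw [this]
    exact y.2
  obtain ⟨l, hl⟩ : ∃ l, repV.low a c l ∉ N := by
    by_contra hcon
    push Not at hcon
    apply htop
    rw [eq_top_iff]
    intro m _
    have hm : m ∈ Submodule.span ℂ {m | ∃ k l, m = eU ^ l • repV.low a c k} := by
      rw [repV.span_low]; trivial
    have hle : Submodule.span ℂ {m | ∃ k l, m = eU ^ l • repV.low a c k}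
        ≤ N.restrictScalars ℂ := by
      refine Submodule.span_le.2 ?_
      rintro _ ⟨k, l, rfl⟩
      exact N.smul_mem _ (hcon k)
    exact hle hm
  have hmem : xU 4 ^ k • repV.low a c l ∈ N := by
    have h2 := exists_mono_mem hc a (N.map (repV a c).subtype) (k := k)
      ⟨repV.low a c k, hk, rfl⟩ l
    obtain ⟨z, hz, hz2⟩ := h2
    have h3 : xU 4 ^ k • repV.low a c l = c ^ k • z := by
      apply Subtype.ext
      change xU 4 ^ k • mono _ c _ 0 = c ^ k • z.1
      rw [x4_pow_mono]
      exact congrArg (c ^ k • ·) hz2.symm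
    rw [h3]
    exact (N.restrictScalars ℂ).smul_mem _ hz
  let z : repV a c ⧸ N := N.mkQ (repV.low a c l)
  have hz0 : z ≠ 0 := fun h => hl ((Submodule.Quotient.mk_eq_zero N).1 h)
  let Q := Submodule.span U4 {z}
  let z' : Q := ⟨z, Submodule.mem_span_singleton_self z⟩
  have hz'0 : z' ≠ 0 := fun h => hz0 (congrArg Subtype.val h)
  have hzl := (repV.isLowest_low a c l).map N.mkQ
  have hz' : IsLowest (a.gTypes l : ℂ) z' := ⟨Subtype.ext hzl.1, Subtype.ext hzl.2⟩
  have hez' : eU ^ (a.gTypes l + 1) • z' = 0 := by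
    apply Subtype.ext
    change eU ^ (a.gTypes l + 1) • N.mkQ (repV.low a c l) = 0
    rw [← map_smul, repV.e_pow_low, map_zero]
  have hgen : Submodule.span U4 {z'} = ⊤ := by
    rw [eq_top_iff]
    rintro ⟨m, hm⟩ -
    obtain ⟨u, rfl⟩ := Submodule.mem_span_singleton.1 hm
    exact Submodule.mem_span_singleton.2 ⟨u, rfl⟩
  have hQI : Integrable Q := (hI.of_surjective N.mkQ N.mkQ_surjective).submodule Q
  have hQc : HasCharacter c Q :=
    ((repV.hasCharacter a c).of_surjective N.mkQ N.mkQ_surjective).submodule Q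
  -- The weight `n` of this coinduced module may differ from `a.n`; only the value `c` matters for
  -- the action of `v₋₄` on powers of `s`.
  obtain ⟨n, g, hg⟩ := hQI.exists_toSeries hQc hz' hez' hgen hz'0
  obtain ⟨j, r, hr, -, hgz⟩ := Series.exists_mono_of_isLowest (hz'.map g) hg
  have h0 : xU 4 ^ k • z' = 0 := by
    apply Subtype.ext
    change xU 4 ^ k • N.mkQ (repV.low a c l) = 0
    rw [← map_smul]
    exact (Submodule.Quotient.mk_eq_zero N).2 hmem
  have h1 : xU 4 ^ k • g z' = 0 := by rw [← map_smul, h0, map_zero]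
  rw [hgz, smul_complex_comm, x4_pow_mono, smul_smul] at h1
  rcases smul_eq_zero.1 h1 with h2 | h2
  · exact mul_ne_zero hr (pow_ne_zero k hc) h2
  · exact mono_ne_zero _ _ h2

end simple

/-! ### Simple integrable modules with a given character -/

section classification
variable {W : Type*} [AddCommGroup W] [Module U4 W] [Module ℂ W] [IsScalarTower ℂ U4 W]

/-- A simple module is generated by any of its lowest weight vectors, so the main existence result
applies; the map is injective by simplicity and carries that vector to a multiple of a power of `s`.
-/
theorem Integrable.exists_injective_toSeries (hW : Integrable W) [IsSimpleModule U4 W] {c : ℂ}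
    (hc : HasCharacter c W) : ∃ (n j : ℕ) (g : W →ₗ[U4] Series (-n) c),
      Function.Injective g ∧ mono (-n) c j 0 ∈ LinearMap.range g := by
  have : Nontrivial W := IsSimpleModule.nontrivial U4 W
  obtain ⟨t, y, hy0, hy, he⟩ := hW.exists_lowest
  have hgen : Submodule.span U4 {y} = ⊤ := IsSimpleModule.span_singleton_eq_top U4 hy0
  obtain ⟨n, g, hg⟩ := hW.exists_toSeries hc hy he hgen hy0
  obtain ⟨j, r, hr, -, hgz⟩ := Series.exists_mono_of_isLowest (hy.map g) hg
  refine ⟨n, j, g, ?_, ?_⟩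
  · refine g.injective_or_eq_zero.resolve_right fun h => hg ?_
    rw [h]; rfl
  · refine (((LinearMap.range g).restrictScalars ℂ).smul_mem_iff hr).1 ?_
    rw [← hgz]
    exact ⟨y, rfl⟩

/-- The image in the coinduced module and the matching `repV` are both minimal nonzero submodules,
and they share a power of `s`, so they are equal. -/
theorem Integrable.exists_equiv_repV (hW : Integrable W) [IsSimpleModule U4 W] {c : ℂ} (hc0 : c ≠ 0)
    (hc : HasCharacter c W) : ∃ a, Nonempty (W ≃ₗ[U4] repV a c) := by
  obtain ⟨n, j, g, hg, hj⟩ := hW.exists_injective_toSeries hc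
  -- For `n = 0` the parity of `j` decides between `V'(0)` and `V'(2)`.
  obtain ⟨a, k, rfl, rfl⟩ : ∃ (a : Label) (k : ℕ), a.n = n ∧ a.J k = j := by
    rcases Nat.eq_zero_or_pos n with rfl | hn
    · rcases Nat.even_or_odd' j with ⟨k, rfl | rfl⟩
      · exact ⟨.V'0, k, rfl, rfl⟩
      · exact ⟨.V'2, k, rfl, rfl⟩
    · exact ⟨.V ⟨n, hn⟩, j, rfl, rfl⟩
  let ε := LinearEquiv.ofInjective g hg
  have : IsSimpleModule U4 (LinearMap.range g) := IsSimpleModule.congr ε.symm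
  have h1 : IsAtom (LinearMap.range g) := isSimpleModule_iff_isAtom.1 this
  have h2 : IsAtom (repV a c) := isSimpleModule_iff_isAtom.1 (repV.isSimpleModule hc0 a)
  have heq : LinearMap.range g = repV a c := by
    by_contra hne
    have h3 := h1.disjoint_of_ne h2 hne
    exact mono_ne_zero _ _ (Submodule.disjoint_def.1 h3 _ hj (mono_mem_lowSpan a c k))
  exact ⟨a, ⟨ε.trans (LinearEquiv.ofEq _ _ heq)⟩⟩

/-- For `c = 0` all functions through which `𝔯` acts on the coinduced module vanish, and `W` embeds
there. This excludes the zero character for modules on which `𝔯` acts nontrivially. -/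
theorem Integrable.rU_smul_eq_zero (hW : Integrable W) [IsSimpleModule U4 W]
    (hc : HasCharacter 0 W) (x : Irrep 4) (w : W) : rU x • w = 0 := by
  obtain ⟨n, j, g, hg, -⟩ := hW.exists_injective_toSeries hc
  apply hg
  rw [map_smul, map_zero, rU_eq_sum, Finset.sum_smul]
  refine Finset.sum_eq_zero fun j _ => ?_
  rw [smul_assoc, Series.xU_smul_eq_zero, smul_zero]

end classification

/-! ### The simple module of distributions -/

section laurent

theorem laurentMono_apply (a : ℕ) (b : ℤ) (p : ℕ × ℤ) :
    laurentMono a b p = if (a, b) = p then 1 else 0 := by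
  rw [laurentMono, Finsupp.single_apply]

theorem laurent_functional_ext {A B : (ℕ × ℤ →₀ ℂ) →ₗ[ℂ] ℂ}
    (h : ∀ a b, A (laurentMono a b) = B (laurentMono a b)) : A = B :=
  Finsupp.lhom_ext' fun ⟨a, b⟩ => LinearMap.ext_ring (h a b)

theorem laurentS_apply_zero (v : ℕ × ℤ →₀ ℂ) (b : ℤ) : laurentS v (0, b) = 0 := by
  have : Finsupp.lapply (R := ℂ) (0, b) ∘ₗ laurentS = 0 := laurent_functional_ext fun a b => by
    simp [laurentS_mono, laurentMono_apply]
  exact LinearMap.congr_fun this v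

theorem laurentS_apply_succ (v : ℕ × ℤ →₀ ℂ) (a : ℕ) (b : ℤ) :
    laurentS v (a + 1, b) = v (a, b) := by
  have : Finsupp.lapply (R := ℂ) (a + 1, b) ∘ₗ laurentS = Finsupp.lapply (a, b) :=
    laurent_functional_ext fun a b => by
      simp [laurentS_mono, laurentMono_apply]
  exact LinearMap.congr_fun this v

theorem laurentP_apply (v : ℕ × ℤ →₀ ℂ) (a : ℕ) (b : ℤ) :
    laurentP v (a, b) = (a + 1) * v (a + 1, b) := by
  have : Finsupp.lapply (R := ℂ) (a, b) ∘ₗ laurentP = ((a : ℂ) + 1) • Finsupp.lapply (a + 1, b) :=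
    laurent_functional_ext fun a' b' => by
      simp only [LinearMap.comp_apply, laurentP_mono, map_smul, Finsupp.lapply_apply,
        laurentMono_apply, LinearMap.smul_apply, smul_eq_mul, Prod.mk.injEq]
      rcases a' with _ | a'
      · simp
      · simp only [add_tsub_cancel_right, add_left_inj]
        split_ifs with h
        · rw [h.1]; push_cast; ring
        · simp
  exact LinearMap.congr_fun this v

theorem laurentT_apply (v : ℕ × ℤ →₀ ℂ) (a : ℕ) (b : ℤ) :
    laurentT v (a, b) = -(b + 1) * v (a, b + 1) := by
  have : Finsupp.lapply (R := ℂ) (a, b) ∘ₗ laurentT = (-(b + 1 : ℂ)) • Finsupp.lapply (a, b + 1) :=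
    laurent_functional_ext fun a' b' => by
      simp only [LinearMap.comp_apply, laurentT_mono, map_smul, Finsupp.lapply_apply,
        laurentMono_apply, LinearMap.smul_apply, smul_eq_mul, Prod.mk.injEq, sub_eq_iff_eq_add]
      split_ifs with h
      · rw [h.2]; push_cast; ring
      · simp
  exact LinearMap.congr_fun this v

theorem laurentQ_apply (v : ℕ × ℤ →₀ ℂ) (a : ℕ) (b : ℤ) :
    laurentQ v (a, b) = v (a, b - 1) := by
  have : Finsupp.lapply (R := ℂ) (a, b) ∘ₗ laurentQ = Finsupp.lapply (a, b - 1) :=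
    laurent_functional_ext fun a' b' => by
      simp only [LinearMap.comp_apply, laurentQ_mono, Finsupp.lapply_apply,
        laurentMono_apply, Prod.mk.injEq, eq_sub_iff_add_eq]
  exact LinearMap.congr_fun this v

variable {i c : ℂ}

/-- The coefficient of `sᵃ yᵇ`. -/
def Laurent.coeff (a : ℕ) (b : ℤ) (v : Laurent i c) : ℂ :=
  let w : ℕ × ℤ →₀ ℂ := v
  w (a, b)

theorem Laurent.ext {v w : Laurent i c} (h : ∀ a b, v.coeff a b = w.coeff a b) : v = w :=
  Finsupp.ext fun ⟨a, b⟩ => h a b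

theorem Laurent.coeff_zero (a : ℕ) (b : ℤ) : (0 : Laurent i c).coeff a b = 0 := rfl

/-- The monomial `sᵃ yᵇ`. -/
noncomputable def Laurent.monomial (i c : ℂ) (a : ℕ) (b : ℤ) : Laurent i c := laurentMono a b

theorem Laurent.coeff_monomial (a a' : ℕ) (b b' : ℤ) :
    (Laurent.monomial i c a b).coeff a' b' = if a = a' ∧ b = b' then 1 else 0 := by
  change laurentMono a b (a', b') = _
  rw [laurentMono_apply]; simp

theorem Laurent.coeff_smul (r : ℂ) (v : Laurent i c) (a : ℕ) (b : ℤ) :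
    (r • v).coeff a b = r * v.coeff a b := rfl

theorem Laurent.coeff_f (v : Laurent i c) (a : ℕ) (b : ℤ) :
    (fU • v).coeff a b = v.coeff a (b - 1) := by
  rw [Laurent.smul_def, L4Ops.rep_fU]
  exact laurentQ_apply _ _ _

theorem Laurent.coeff_h (v : Laurent i c) (a : ℕ) (b : ℤ) :
    (hU • v).coeff a b = (i - 2 * a - 2 * b - 2) * v.coeff a b := by
  rw [Laurent.smul_def, L4Ops.rep_hU]
  set w : ℕ × ℤ →₀ ℂ := v
  change i * w (a, b) - 2 * (laurentS (laurentP w)) (a, b) + 2 * (laurentT (laurentQ w)) (a, b)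
    = _ * w (a, b)
  rw [laurentT_apply, laurentQ_apply, add_sub_cancel_right]
  rcases a with _ | a
  · rw [laurentS_apply_zero]; push_cast; ring
  · rw [laurentS_apply_succ, laurentP_apply]; push_cast; ring

theorem Laurent.coeff_e (v : Laurent i c) (a : ℕ) (b : ℤ) :
    (eU • v).coeff a b = (a + 1) * v.coeff (a + 1) b
      + (b + 1) * (i - 2 * a - b - 2) * v.coeff a (b + 1) := by
  rw [Laurent.smul_def, L4Ops.rep_eU]
  set w : ℕ × ℤ →₀ ℂ := v
  change laurentP w (a, b) - i * laurentT w (a, b) + 2 * (laurentS (laurentT (laurentP w))) (a, b)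
    - (laurentT (laurentT (laurentQ w))) (a, b) = _ * w (a + 1, b) + _ * w (a, b + 1)
  rw [laurentP_apply, laurentT_apply, laurentT_apply, laurentT_apply, laurentQ_apply,
    add_sub_cancel_right]
  rcases a with _ | a
  · rw [laurentS_apply_zero]; push_cast; ring
  · rw [laurentS_apply_succ, laurentT_apply, laurentP_apply]; push_cast; ring

theorem Laurent.x3_monomial_zero (a : ℕ) :
    xU 3 • Laurent.monomial i c a 0 = (c * 2) • Laurent.monomial i c (a + 1) 0 := by
  rw [Laurent.smul_def, L4Ops.rep_xU]
  change c • ((2 : ℂ) • laurentS (laurentMono a 0)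
    + (4 : ℂ) • laurentS (laurentS (laurentT (laurentMono a 0)))) = _
  rw [laurentS_mono, laurentT_mono, Int.cast_zero, neg_zero, zero_smul, map_zero, map_zero,
    smul_zero, add_zero, smul_smul]; rfl

/-- Of the three terms of `v₂` only `2t = -2∂/∂y` reaches the top degree in `y`; the others
differentiate more often. -/
theorem Laurent.coeff_x1 (v : Laurent i c) (b : ℤ) (h : ∀ a, v.coeff a (b + 2) = 0)
    (h' : ∀ a, v.coeff a (b + 3) = 0) (a : ℕ) :
    (xU 1 • v).coeff a b = -(2 * c * (b + 1)) * v.coeff a (b + 1) := by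
  rw [Laurent.smul_def, L4Ops.rep_xU]
  set w : ℕ × ℤ →₀ ℂ := v
  replace h : ∀ a, w (a, b + 2) = 0 := h
  replace h' : ∀ a, w (a, b + 3) = 0 := h'
  change c * (2 * laurentT w (a, b) + 6 * (laurentS (laurentT (laurentT w))) (a, b)
    + 4 * (laurentS (laurentS (laurentT (laurentT (laurentT w))))) (a, b)) = _ * w (a, b + 1)
  have e2 : b + 1 + 1 = b + 2 := by ring
  have e3 : b + 2 + 1 = b + 3 := by ring
  rcases a with _ | _ | a <;> simp only [laurentS_apply_zero, laurentS_apply_succ, laurentT_apply,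
    e2, e3, h, h'] <;> ring

theorem Laurent.f_pow_monomial (a : ℕ) (b : ℤ) (k : ℕ) :
    fU ^ k • Laurent.monomial i c a b = Laurent.monomial i c a (b + k) := by
  induction k with
  | zero => simp
  | succ k ih =>
    rw [pow_succ', mul_smul, ih, Laurent.smul_def, L4Ops.rep_fU]
    refine (laurentQ_mono _ _).trans ?_
    push_cast; rw [← add_assoc]; rfl

/-- The coefficient of `y⁻¹`. -/
noncomputable def Laurent.residue (i c : ℂ) : Laurent i c →ₗ[ℂ] ℂ :=
  (Finsupp.lapply (0, -1) : (ℕ × ℤ →₀ ℂ) →ₗ[ℂ] ℂ)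

theorem Laurent.residue_apply (v : Laurent i c) : Laurent.residue i c v = v.coeff 0 (-1) := rfl

theorem laurentOps_X_apply (j : Fin 5) (v : ℕ × ℤ →₀ ℂ) :
    laurentOps.X c j v (0, -1) = (if j = 2 then c else 0) * v (0, -1) := by
  have hT : ∀ (v : ℕ × ℤ →₀ ℂ) a, laurentT v (a, -1) = 0 := fun v a => by
    rw [laurentT_apply]; simp
  fin_cases j <;> simp [WeylOps.X, Module.End.mul_apply, laurentOps, hT, laurentS_apply_zero]

theorem Laurent.isPointFunctional_residue : IsPointFunctional i c (Laurent.residue i c) := by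
  refine ⟨fun j v => ?_, fun v => ?_⟩
  · change (xU j • v).coeff 0 (-1) = _ * (v.coeff 0 (-1))
    rw [Laurent.smul_def, L4Ops.rep_xU]
    exact laurentOps_X_apply j _
  · rw [Laurent.residue_apply, Laurent.coeff_h, Laurent.residue_apply]
    push_cast; ring

/-- The principal part of a Laurent polynomial. -/
noncomputable def Laurent.principal (i c : ℂ) : Laurent i c →ₗ[U4] Series i c :=
  Laurent.isPointFunctional_residue.toSeries

theorem Laurent.coeff_f_pow (v : Laurent i c) (k a : ℕ) (b : ℤ) :
    (fU ^ k • v).coeff a b = v.coeff a (b - k) := by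
  induction k generalizing b with
  | zero => simp
  | succ k ih =>
    rw [pow_succ', mul_smul, Laurent.coeff_f, ih]; push_cast; ring_nf

/-- On the coefficient of `y⁻¹` the second term of `e` has the factor `b + 1 = 0`, so `e` acts there
as `∂/∂s`. -/
theorem Laurent.coeff_e_pow (v : Laurent i c) (k a : ℕ) :
    (eU ^ k • v).coeff a (-1) * a.factorial = (a + k).factorial * v.coeff (a + k) (-1) := by
  induction k generalizing a with
  | zero => simp [mul_comm]
  | succ k ih =>
    have := ih (a + 1)
    rw [pow_succ', mul_smul, Laurent.coeff_e, show a + (k + 1) = a + 1 + k by ring, ← this,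
      Nat.factorial_succ]
    push_cast; ring

theorem Laurent.principal_apply (v : Laurent i c) (j k : ℕ) :
    Laurent.principal i c v j k = j.factorial * v.coeff j (-1 - k) := by
  rw [Laurent.principal, IsPointFunctional.toSeries_apply, Laurent.residue_apply]
  have h := Laurent.coeff_e_pow (fU ^ k • v) j 0
  rw [zero_add, Nat.factorial_zero, Nat.cast_one, mul_one, Laurent.coeff_f_pow] at h
  exact h

theorem Laurent.f_injective : Function.Injective fun v : Laurent i c => fU • v := by
  intro v w h
  refine Laurent.ext fun a b => ?_
  have := congrArg (Laurent.coeff a (b + 1)) h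
  simpa only [Laurent.coeff_f, add_sub_cancel_right] using this

theorem Laurent.f_surjective : Function.Surjective fun v : Laurent i c => fU • v := by
  intro v
  let R : Module.End ℂ (ℕ × ℤ →₀ ℂ) :=
    Finsupp.linearCombination ℂ fun p => laurentMono p.1 (p.2 - 1)
  refine ⟨R v, ?_⟩
  have : laurentQ * R = 1 := laurent_ext fun a b => by
    have hR : R (laurentMono a b) = laurentMono a (b - 1) := by
      simp only [R]
      conv_lhs => rw [laurentMono, Finsupp.linearCombination_single, one_smul]
    rw [Module.End.mul_apply, hR, laurentQ_mono, sub_add_cancel]; rfl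
  have hf : (laurentOps.toL4Ops i c).rep fU = laurentQ := L4Ops.rep_fU _
  exact (LinearMap.congr_fun hf (R v)).trans (LinearMap.congr_fun this v)

/-- The polynomials in `s` and `y`. -/
noncomputable def Poly (i c : ℂ) : Submodule U4 (Laurent i c) :=
  LinearMap.ker (Laurent.principal i c)

theorem mem_Poly {v : Laurent i c} : v ∈ Poly i c ↔ ∀ a (k : ℕ), v.coeff a (-1 - k) = 0 := by
  rw [Poly, LinearMap.mem_ker]
  constructor
  · intro h a k
    have := congrFun (congrFun h a) k
    rw [Laurent.principal_apply] at this
    exact (mul_eq_zero.1 this).resolve_left (by exact_mod_cast a.factorial_ne_zero)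
  · intro h
    funext a k
    rw [Laurent.principal_apply, h, mul_zero]; rfl

theorem Poly.coeff_of_neg {v : Laurent i c} (h : v ∈ Poly i c) (a : ℕ) {b : ℤ} (hb : b < 0) :
    v.coeff a b = 0 := by
  have := mem_Poly.1 h a (-1 - b).toNat
  rwa [Int.toNat_of_nonneg (by omega), sub_sub_cancel] at this

theorem monomial_mem_Poly (a b : ℕ) : Laurent.monomial i c a b ∈ Poly i c :=
  mem_Poly.2 fun a' k => by
    rw [Laurent.coeff_monomial, if_neg]; omega

/-- On powers of `s` the operator `t = -∂/∂y` vanishes, so `v₋₂` multiplies by `2cs`; powers of `f =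
y` then supply the rest. -/
theorem monomial_mem_of_one_mem (hc : c ≠ 0) (N : Submodule U4 (Laurent i c))
    (h : Laurent.monomial i c 0 0 ∈ N) (a b : ℕ) : Laurent.monomial i c a b ∈ N := by
  have hs : ∀ a, Laurent.monomial i c a 0 ∈ N := by
    intro a
    induction a with
    | zero => exact h
    | succ a ih =>
      refine ((N.restrictScalars ℂ).smul_mem_iff (mul_ne_zero hc two_ne_zero)).1 ?_
      rw [← Laurent.x3_monomial_zero]
      exact N.smul_mem _ ih
  have := N.smul_mem (fU ^ b) (hs a)
  rwa [Laurent.f_pow_monomial, zero_add] at this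

theorem laurent_eq_sum (v : ℕ × ℤ →₀ ℂ) : v = v.sum fun p r => r • laurentMono p.1 p.2 := by
  refine (Finsupp.sum_single v).symm.trans (Finsupp.sum_congr fun p _ => ?_)
  rw [laurentMono, Finsupp.smul_single, smul_eq_mul, mul_one]

theorem Poly_le_of_one_mem (hc : c ≠ 0) (N : Submodule U4 (Laurent i c))
    (h : Laurent.monomial i c 0 0 ∈ N) : Poly i c ≤ N := by
  intro v hv
  let w : ℕ × ℤ →₀ ℂ := v
  have hsum : v = w.sum fun p r => r • Laurent.monomial i c p.1 p.2 := laurent_eq_sum w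
  rw [hsum]
  refine (N.restrictScalars ℂ).sum_mem fun p hp => ?_
  refine (N.restrictScalars ℂ).smul_mem _ ?_
  have hp2 : 0 ≤ p.2 := by
    by_contra hcon
    exact Finsupp.mem_support_iff.1 hp (Poly.coeff_of_neg hv p.1 (not_le.1 hcon))
  obtain ⟨b, hb⟩ := Int.eq_ofNat_of_zero_le hp2
  change Laurent.monomial i c p.1 p.2 ∈ N
  rw [hb]
  exact monomial_mem_of_one_mem hc N h p.1 b

theorem exists_coeff_bound (v : Laurent i c) :
    ∃ n : ℕ, ∀ (a : ℕ) (b : ℤ), (n ≤ a ∨ n ≤ b) → v.coeff a b = 0 := by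
  let w : ℕ × ℤ →₀ ℂ := v
  refine ⟨(w.support.sup fun p => p.1 + p.2.toNat) + 1, fun a b h => ?_⟩
  by_contra hcon
  have hmem : (a, b) ∈ w.support := Finsupp.mem_support_iff.2 hcon
  have := Finset.le_sup (f := fun p : ℕ × ℤ => p.1 + p.2.toNat) hmem
  simp only at this
  omega

/-- Applying `v₂` lowers the degree in `y` until only `y⁰` is left; on polynomials in `s` alone, `e`
is `∂/∂s` and lowers the degree in `s` down to a constant. If an operator kills the vector, the
degree was already smaller than assumed. -/
theorem one_mem_of_ne_zero (hc : c ≠ 0) {N : Submodule U4 (Laurent i c)} (hN : N ≤ Poly i c)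
    {v : Laurent i c} (hv : v ∈ N) (hv0 : v ≠ 0) : Laurent.monomial i c 0 0 ∈ N := by
  have hy : ∀ n : ℕ, ∀ v ∈ N, v ≠ 0 → (∀ (a : ℕ) (b : ℤ), (n + 1 : ℕ) ≤ b → v.coeff a b = 0) →
      ∃ v ∈ N, v ≠ 0 ∧ ∀ (a : ℕ) (b : ℤ), 1 ≤ b → v.coeff a b = 0 := by
    intro n
    induction n with
    | zero => exact fun v hv hv0 h => ⟨v, hv, hv0, fun a b hb => h a b (by simpa using hb)⟩
    | succ n ih =>
      intro v hv hv0 h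
      have h1 : ∀ (a : ℕ) (b : ℤ), (n : ℤ) ≤ b → (xU 1 • v).coeff a b
          = -(2 * c * (b + 1)) * v.coeff a (b + 1) := fun a b hb =>
        Laurent.coeff_x1 v b (fun a => h a _ (by push_cast; omega))
          (fun a => h a _ (by push_cast; omega)) a
      by_cases h0 : xU 1 • v = 0
      · refine ih v hv hv0 fun a b hb => ?_
        have h2 := h1 a (b - 1) (by push_cast at hb; omega)
        rw [h0, Laurent.coeff_zero, sub_add_cancel] at h2
        refine (mul_eq_zero.1 h2.symm).resolve_left ?_
        refine neg_ne_zero.2 ?_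
        refine mul_ne_zero (mul_ne_zero two_ne_zero hc) ?_
        have hb0 : b ≠ 0 := by push_cast at hb; omega
        push_cast
        rw [sub_add_cancel]
        exact_mod_cast hb0
      · refine ih _ (N.smul_mem _ hv) h0 fun a b hb => ?_
        rw [h1 a b (by push_cast at hb; omega), h a (b + 1) (by push_cast at hb ⊢; omega), mul_zero]
  have hs : ∀ n : ℕ, ∀ v ∈ N, v ≠ 0 → (∀ (a : ℕ) (b : ℤ), 1 ≤ b → v.coeff a b = 0) →
      (∀ (a : ℕ) (b : ℤ), n + 1 ≤ a → v.coeff a b = 0) → Laurent.monomial i c 0 0 ∈ N := by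
    intro n
    induction n with
    | zero =>
      intro v hv hv0 h h'
      have hveq : v = v.coeff 0 0 • Laurent.monomial i c 0 0 := by
        refine Laurent.ext fun a b => ?_
        rw [Laurent.coeff_smul, Laurent.coeff_monomial]
        split_ifs with hab
        · rw [← hab.1, ← hab.2, mul_one]
        · rw [mul_zero]
          rcases lt_trichotomy b 0 with hb | hb | hb
          · exact Poly.coeff_of_neg (hN hv) a hb
          · exact h' a b (by by_contra; exact hab ⟨by omega, hb.symm⟩)
          · exact h a b hb
      rw [hveq] at hv
      refine ((N.restrictScalars ℂ).smul_mem_iff fun h0 => hv0 ?_).1 hv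
      rw [hveq, h0, zero_smul]
    | succ n ih =>
      intro v hv hv0 h h'
      have h1 : ∀ a b, (eU • v).coeff a b = (a + 1) * v.coeff (a + 1) b := by
        intro a b
        rw [Laurent.coeff_e]
        by_cases hb : b + 1 = 0
        · have : (b : ℂ) + 1 = 0 := by exact_mod_cast hb
          rw [this]; ring
        · have : v.coeff a (b + 1) = 0 := by
            rcases lt_or_ge b 0 with hb' | hb'
            · exact Poly.coeff_of_neg (hN hv) a (by omega)
            · exact h a _ (by omega)
          rw [this]; ring
      by_cases h0 : eU • v = 0
      · refine ih v hv hv0 h fun a b ha => ?_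
        have h2 := h1 (a - 1) b
        rw [h0, Laurent.coeff_zero, Nat.sub_add_cancel (by omega)] at h2
        exact (mul_eq_zero.1 h2.symm).resolve_left (Nat.cast_add_one_ne_zero _)
      · refine ih _ (N.smul_mem _ hv) h0 (fun a b hb => ?_) fun a b ha => ?_
        · rw [h1, h _ _ hb, mul_zero]
        · rw [h1, h' _ _ (by omega), mul_zero]
  obtain ⟨n, hn⟩ := exists_coeff_bound v
  obtain ⟨w, hw, hw0, hwy⟩ := hy n v hv hv0 fun a b hb => hn a b (Or.inr (by push_cast at hb; omega))
  obtain ⟨m, hm⟩ := exists_coeff_bound w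
  exact hs m w hw hw0 hwy fun a b ha => hm a b (Or.inl (by omega))

theorem Poly.isSimpleModule (hc : c ≠ 0) : IsSimpleModule U4 (Poly i c) := by
  rw [isSimpleModule_iff_isAtom]
  refine ⟨fun h => ?_, fun N hN => ?_⟩
  · have h1 : Laurent.monomial i c 0 0 ∈ (⊥ : Submodule U4 (Laurent i c)) :=
      h ▸ monomial_mem_Poly 0 0
    have h2 := Laurent.coeff_monomial (i := i) (c := c) 0 0 0 0
    rw [(Submodule.mem_bot U4).1 h1, Laurent.coeff_zero] at h2
    simp at h2
  · by_contra hne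
    obtain ⟨v, hv, hv0⟩ := Submodule.exists_mem_ne_zero_of_ne_bot hne
    exact hN.not_ge (Poly_le_of_one_mem hc N (one_mem_of_ne_zero hc hN.le hv hv0))

/-- The constant `1` is a highest weight vector with `h = i - 2` and `v₀ = c`, and it generates the
polynomials. -/
theorem exists_verma_hom (hc : c ≠ 0) : ∃ ψ : Verma (i - 2, c) →ₗ[U4] Laurent i c,
    LinearMap.range ψ = Poly i c := by
  have hcoef : ∀ a b, (Laurent.monomial i c 0 0).coeff a b ≠ 0 → a = 0 ∧ b = 0 := by
    intro a b h
    rw [Laurent.coeff_monomial] at h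
    by_contra hcon
    exact h (if_neg fun h' => hcon ⟨h'.1.symm, h'.2.symm⟩)
  have hle : vermaIdeal (i - 2, c)
      ≤ LinearMap.ker (LinearMap.toSpanSingleton U4 _ (Laurent.monomial i c 0 0)) := by
    refine Submodule.span_le.2 ?_
    have hT : laurentT (laurentMono 0 0) = 0 := by
      rw [laurentT_mono, Int.cast_zero, neg_zero, zero_smul]
    have hX : ∀ j, xU j • Laurent.monomial i c 0 0 = laurentOps.X c j (laurentMono 0 0) := by
      intro j
      rw [Laurent.smul_def, L4Ops.rep_xU]; rfl
    rintro u (rfl | rfl | rfl | rfl | rfl) <;> rw [SetLike.mem_coe, LinearMap.mem_ker,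
      LinearMap.toSpanSingleton_apply]
    · refine Laurent.ext fun a b => ?_
      rw [Laurent.coeff_e, Laurent.coeff_monomial, Laurent.coeff_monomial, if_neg (by omega),
        Laurent.coeff_zero, mul_zero, zero_add]
      split_ifs with h
      · have : (b : ℂ) + 1 = 0 := by exact_mod_cast h.2.symm
        rw [this]; ring
      · ring
    · refine (hX 1).trans ?_
      simp [WeylOps.X, laurentOps, Module.End.mul_apply, hT]
      rfl
    · refine (hX 0).trans ?_
      simp [WeylOps.X, laurentOps, Module.End.mul_apply, hT]
      rfl
    · rw [sub_smul, algebraMap_smul_eq, sub_eq_zero]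
      refine Laurent.ext fun a b => ?_
      rw [Laurent.coeff_h, Laurent.coeff_smul, Laurent.coeff_monomial]
      split_ifs with h
      · rw [← h.1, ← h.2]; push_cast; ring
      · simp
    · rw [sub_smul, algebraMap_smul_eq, sub_eq_zero]
      refine (hX 2).trans ?_
      simp [WeylOps.X, laurentOps, Module.End.mul_apply, hT]
      rfl
  refine ⟨(vermaIdeal (i - 2, c)).liftQ _ hle, ?_⟩
  rw [Submodule.range_liftQ, LinearMap.range_toSpanSingleton]
  refine le_antisymm ?_ (Poly_le_of_one_mem hc _ (Submodule.mem_span_singleton_self _))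
  rw [Submodule.span_singleton_le_iff_mem]
  exact monomial_mem_Poly 0 0

end laurent

/-! ### Localization at `f` -/

section loc
variable {M : Type*} [AddCommGroup M] [Module U4 M]

theorem LocF.f_pow_injective (n : ℕ) : Function.Injective fun x : LocF M => fU ^ n • x := by
  have hs : fU ^ n ∈ Submonoid.powers fU := ⟨n, rfl⟩
  intro x y h
  beta_reduce at h
  have key : ∀ x : LocF M, ((1 : U4) /ₒ (⟨fU ^ n, hs⟩ : Submonoid.powers fU)) • fU ^ n • x = x := by
    intro x
    rw [← OreLocalization.oreDiv_one_smul (fU ^ n) x, ← mul_smul]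
    have : ((1 : U4) /ₒ (⟨fU ^ n, hs⟩ : Submonoid.powers fU)) * (fU ^ n /ₒ 1) = 1 :=
      OreLocalization.mul_inv (1 : Submonoid.powers fU) ⟨fU ^ n, hs⟩
    rw [this, one_smul]
  rw [← key x, h, key]

theorem LocF.exists_f_pow_smul (x : LocF M) : ∃ n m, fU ^ n • x = locMap M m := by
  induction x using OreLocalization.ind with
  | _ m s =>
    obtain ⟨_, n, rfl⟩ := s
    refine ⟨n, m, ?_⟩
    rw [← OreLocalization.oreDiv_one_smul]
    exact OreLocalization.smul_cancel (s := (⟨fU ^ n, ⟨n, rfl⟩⟩ : Submonoid.powers fU)) (t := 1)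

theorem LocF.exists_f_pow_smul_eq (n : ℕ) (m : M) : ∃ x : LocF M, fU ^ n • x = locMap M m := by
  refine ⟨m /ₒ ⟨fU ^ n, ⟨n, rfl⟩⟩, ?_⟩
  rw [← OreLocalization.oreDiv_one_smul]
  exact OreLocalization.smul_cancel (s := (⟨fU ^ n, ⟨n, rfl⟩⟩ : Submonoid.powers fU)) (t := 1)

theorem exists_of_locMap_eq_zero {m : M} (h : locMap M m = 0) : ∃ n, fU ^ n • m = 0 := by
  replace h : 0 = m /ₒ (1 : Submonoid.powers fU) := h.symm
  rw [OreLocalization.zero_def, OreLocalization.oreDiv_eq_iff] at h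
  obtain ⟨⟨_, n, rfl⟩, v, h1, -⟩ := h
  exact ⟨n, h1.trans (smul_zero v)⟩

variable {N : Type*} [AddCommGroup N] [Module U4 N]

/-- The universal property of localization: if `fⁿx` is the image of `m`, then `L x` must be the
unique `z` with `fⁿz = ψ m`. Two presentations agree after multiplying by a further power of `f`,
which is injective on `N`. -/
theorem exists_locF_hom (hN : Function.Bijective fun x : N => fU • x) (ψ : M →ₗ[U4] N) :
    ∃ L : LocF M →ₗ[U4] N, ∀ m, L (locMap M m) = ψ m := by
  have hpow : ∀ n, Function.Bijective fun x : N => fU ^ n • x := by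
    intro n
    induction n with
    | zero =>
      simp only [pow_zero, one_smul]
      exact Function.bijective_id
    | succ n ih =>
      have := ih.comp hN
      simpa [Function.comp_def, ← mul_smul, ← pow_succ] using this
  have key : ∀ x : LocF M, ∃ z : N, ∀ n m, fU ^ n • x = locMap M m → fU ^ n • z = ψ m := by
    intro x
    obtain ⟨n, m, h⟩ := LocF.exists_f_pow_smul x
    obtain ⟨z, hz⟩ := (hpow n).2 (ψ m)
    beta_reduce at hz
    refine ⟨z, fun n' m' h' => ?_⟩
    have h1 : locMap M (fU ^ n' • m - fU ^ n • m') = 0 := by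
      rw [map_sub, map_smul, map_smul, ← h, ← h', ← mul_smul, ← mul_smul, ← pow_add, ← pow_add,
        add_comm, sub_self]
    obtain ⟨k, hk⟩ := exists_of_locMap_eq_zero h1
    have h2 := congrArg ψ hk
    rw [map_smul, map_sub, map_smul, map_smul, map_zero, ← hz, smul_sub, sub_eq_zero] at h2
    refine (hpow (k + n)).1 ?_
    beta_reduce
    rw [pow_add, mul_smul, mul_smul, ← h2, ← mul_smul (fU ^ n), ← mul_smul (fU ^ n'), ← pow_add,
      ← pow_add, add_comm]
  choose L hL using key
  refine ⟨{ toFun := L, map_add' := fun x y => ?_, map_smul' := fun u x => ?_ }, fun m => ?_⟩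
  · obtain ⟨n, m, h⟩ := LocF.exists_f_pow_smul x
    obtain ⟨n', m', h'⟩ := LocF.exists_f_pow_smul y
    refine (hpow (n + n')).1 ?_
    have e1 : fU ^ (n + n') • x = locMap M (fU ^ n' • m) := by
      rw [map_smul, ← h, ← mul_smul, ← pow_add, add_comm]
    have e2 : fU ^ (n + n') • y = locMap M (fU ^ n • m') := by
      rw [map_smul, ← h', ← mul_smul, ← pow_add]
    beta_reduce
    rw [smul_add, hL x _ _ e1, hL y _ _ e2,
      hL (x + y) (n + n') (fU ^ n' • m + fU ^ n • m') (by rw [smul_add, e1, e2, map_add]), map_add]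
  · obtain ⟨n, m, h⟩ := LocF.exists_f_pow_smul x
    obtain ⟨K, hK⟩ := innerDer_fU_locally_nilpotent u
    -- The Ore relation `f^(K+n) u = w fⁿ` transports the action of `u` to numerators.
    obtain ⟨w, hw⟩ := exists_pow_mul_eq fU K u hK n
    refine (hpow (K + n)).1 ?_
    beta_reduce
    rw [RingHom.id_apply, hL (u • x) (K + n) (w • m) (by
      rw [← mul_smul, hw, mul_smul, h, map_smul]), ← mul_smul _ u, hw, mul_smul, hL x n m h,
      map_smul]
  · have := hL (locMap M m) 0 m (by simp)
    simpa using this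

theorem locF_hom_injective {L : LocF M →ₗ[U4] N} {ψ : M →ₗ[U4] N} (hψ : Function.Injective ψ)
    (h : ∀ m, L (locMap M m) = ψ m) : Function.Injective L := by
  rw [← LinearMap.ker_eq_bot, LinearMap.ker_eq_bot']
  intro x hx
  obtain ⟨n, m, hm⟩ := LocF.exists_f_pow_smul x
  have h1 : ψ m = 0 := by rw [← h, ← hm, map_smul, hx, smul_zero]
  have h2 : m = 0 := hψ (h1.trans (map_zero ψ).symm)
  apply LocF.f_pow_injective n
  beta_reduce
  rw [hm, h2, map_zero, smul_zero]

end loc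

/-! ### The modules `repV` occur in completions of highest weight modules -/

section membership

theorem isLocFinite_of_pow_smul_eq_zero {M : Type*} [AddCommGroup M] [Module U4 M] {x : U4} {m : M}
    {n : ℕ} (h : x ^ n • m = 0) : IsLocFinite x m := by
  let _ : Module ℂ M := Module.restrictScalars ℂ U4 M
  change FiniteDimensional ℂ (Submodule.span ℂ (Set.range fun k : ℕ => x ^ k • m))
  refine FiniteDimensional.span_of_finite ℂ ?_
  refine ((Set.finite_lt_nat n).image (fun k => x ^ k • m) |>.union (Set.finite_singleton 0)).subset ?_
  rintro _ ⟨k, rfl⟩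
  rcases lt_or_ge k n with hk | hk
  · exact Or.inl ⟨k, hk, rfl⟩
  · refine Or.inr ?_
    obtain ⟨d, rfl⟩ := Nat.exists_eq_add_of_le' hk
    simp [pow_add, mul_smul, h]

/-- The localization of `R ≅ ℂ[s, y]` embeds into `ℂ[s, y, y⁻¹]`, and taking principal parts embeds
its quotient by `R` into the coinduced module. What maps into `repV` is `e`-nilpotent, so it lies in
the completion; by simplicity a nonzero image is all of `repV`. -/
theorem exists_EA_hom_repV {c : ℂ} (hc : c ≠ 0) (a : Label) {R : Type*} [AddCommGroup R]
    [Module U4 R] {ψ : R →ₗ[U4] Laurent (-(a.n : ℂ)) c} (hinj : Function.Injective ψ)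
    (hψ : LinearMap.range ψ = Poly (-(a.n : ℂ)) c) :
    ∃ (P : Submodule U4 (EA R)) (φ : P →ₗ[U4] repV a c), Function.Surjective φ := by
  have hsimple := repV.isSimpleModule hc a
  obtain ⟨L, hL⟩ := exists_locF_hom ⟨Laurent.f_injective, Laurent.f_surjective⟩ ψ
  have hLinj := locF_hom_injective hinj hL
  -- Elements with zero principal part are polynomials, that is, they come from `R`; this makes the
  -- induced map `Λ` on the quotient injective.
  have hker : LinearMap.ker (Laurent.principal (-(a.n : ℂ)) c ∘ₗ L)
      = LinearMap.range (locMap R) := by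
    ext x
    rw [LinearMap.mem_ker, LinearMap.comp_apply]
    change L x ∈ Poly (-(a.n : ℂ)) c ↔ _
    rw [← hψ]
    constructor
    · rintro ⟨r, hr⟩
      exact ⟨r, hLinj ((hL r).trans hr)⟩
    · rintro ⟨r, rfl⟩
      exact ⟨r, (hL r).symm⟩
  obtain ⟨Λ, hΛ, hΛL⟩ : ∃ Λ : Comp R →ₗ[U4] Series (-(a.n : ℂ)) c, Function.Injective Λ ∧
      ∀ x : LocF R, Λ (Submodule.Quotient.mk x) = Laurent.principal (-(a.n : ℂ)) c (L x) :=
    ⟨(LinearMap.range (locMap R)).liftQ (Laurent.principal (-(a.n : ℂ)) c ∘ₗ L) hker.ge,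
      LinearMap.ker_eq_bot.1 (Submodule.ker_liftQ_eq_bot _ _ _ hker.le), fun x => rfl⟩
  have hEA : ∀ x, Λ x ∈ repV a c → x ∈ EA R := by
    intro x hx
    obtain ⟨n, hn⟩ := (repV.integrable a c).e ⟨Λ x, hx⟩
    refine isLocFinite_of_pow_smul_eq_zero (n := n) (hΛ ?_)
    rw [map_smul, map_zero]
    exact congrArg Subtype.val hn
  obtain ⟨x, hx⟩ : ∃ x, Λ x ∈ repV a c ∧ Λ x ≠ 0 := by
    have hmem : Laurent.monomial (-(a.n : ℂ)) c (a.J 0) 0 ∈ LinearMap.range ψ := by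
      rw [hψ]; exact monomial_mem_Poly (a.J 0) 0
    obtain ⟨r, hr⟩ := hmem
    obtain ⟨x, hx⟩ := LocF.exists_f_pow_smul_eq 1 r
    rw [pow_one] at hx
    -- Dividing `sʲ` by `f = y` gives `sʲy⁻¹`, whose principal part is the power `sʲ` in the
    -- coinduced module.
    have hLx : L x = Laurent.monomial (-(a.n : ℂ)) c (a.J 0) (-1) := by
      apply Laurent.f_injective
      beta_reduce
      have := Laurent.f_pow_monomial (i := -(a.n : ℂ)) (c := c) (a.J 0) (-1) 1
      rw [pow_one] at this
      rw [this, ← map_smul, hx, hL, hr]; rfl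
    have hval : Λ (Submodule.Quotient.mk x) = mono (-(a.n : ℂ)) c (a.J 0) 0 := by
      rw [hΛL, hLx]
      funext j k
      rw [Laurent.principal_apply, Laurent.coeff_monomial]
      by_cases h : j = a.J 0 ∧ k = 0
      · rw [h.1, h.2]; simp [mono]
      · rw [if_neg (by omega)]
        simp [mono, h]
    exact ⟨Submodule.Quotient.mk x, by rw [hval]; exact mono_mem_lowSpan a c 0,
      by rw [hval]; exact mono_ne_zero _ _⟩
  let Λ' : EA R →ₗ[U4] Series (-(a.n : ℂ)) c := Λ ∘ₗ (EA R).subtype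
  let φ : (repV a c).comap Λ' →ₗ[U4] repV a c :=
    (Λ' ∘ₗ Submodule.subtype _).codRestrict (repV a c) fun y => y.2
  have hφ : φ ≠ 0 := fun h0 => hx.2 <| by
    exact congrArg Subtype.val (LinearMap.congr_fun h0 ⟨⟨x, hEA x hx.1⟩, hx.1⟩)
  exact ⟨_, φ, LinearMap.range_eq_top.1
    ((eq_bot_or_eq_top (LinearMap.range φ)).resolve_left fun h => hφ (LinearMap.range_eq_bot.1 h))⟩

/-- The highest weight is `λ(h) = -n - 2`, `λ(v₀) = c`; the maximal submodule of the Verma module is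
the kernel of its map onto `ℂ[s, y]`. -/
theorem repV.isSimpleSubquotientEA {c : ℂ} (hc : c ≠ 0) (a : Label) {S : Type*} [AddCommGroup S]
    [Module U4 S] (ε : repV a c ≃ₗ[U4] S) : IsSimpleSubquotientEA S := by
  have hsimple := repV.isSimpleModule hc a
  obtain ⟨ψ, hψ⟩ := exists_verma_hom (i := -(a.n : ℂ)) hc
  have := Poly.isSimpleModule (i := -(a.n : ℂ)) hc
  have hR : IsSimpleModule U4 (Verma (-(a.n : ℂ) - 2, c) ⧸ LinearMap.ker ψ) :=
    IsSimpleModule.congr (ψ.quotKerEquivRange.trans (LinearEquiv.ofEq _ _ hψ))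
  obtain ⟨P, φ, hφ⟩ := exists_EA_hom_repV hc a (ψ := (LinearMap.ker ψ).liftQ ψ le_rfl)
    (LinearMap.ker_eq_bot.1 (Submodule.ker_liftQ_eq_bot' _ _ rfl))
    (by rw [Submodule.range_liftQ, hψ])
  exact ⟨IsSimpleModule.congr ε.symm, _, LinearMap.ker ψ, isSimpleModule_iff_isCoatom.1 hR, P, ε.toLinearMap ∘ₗ φ,
    ε.surjective.comp hφ⟩

end membership

/-! ### Subquotients of completions of highest weight modules -/

section diag
variable {M : Type*} [AddCommGroup M] [Module U4 M] [Module ℂ M] [IsScalarTower ℂ U4 M]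

theorem smul_mem_iSup_eigenspace {u : U4} {r : ℂ}
    (hu : ∀ m : M, hU • u • m = u • hU • m + r • u • m) {m : M}
    (hm : m ∈ ⨆ μ : ℂ, Module.End.eigenspace (act hU : Module.End ℂ M) μ) :
    u • m ∈ ⨆ μ : ℂ, Module.End.eigenspace (act hU : Module.End ℂ M) μ := by
  induction hm using Submodule.iSup_induction' with
  | mem p m hm =>
    have h : hU • m = p • m := Module.End.mem_eigenspace_iff.1 hm
    refine Submodule.mem_iSup_of_mem (p + r) (Module.End.mem_eigenspace_iff.2 ?_)
    rw [act_apply, hu, h, smul_complex_comm, add_smul]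
  | zero => rw [smul_zero]; exact zero_mem _
  | add a b _ _ ha hb => rw [smul_add]; exact add_mem ha hb

theorem iSup_eigenspace_of_generator {v : M} {μ : ℂ} (hv : hU • v = μ • v)
    (hgen : ∀ m : M, ∃ u : U4, m = u • v) :
    ⨆ μ : ℂ, Module.End.eigenspace (act hU : Module.End ℂ M) μ = ⊤ := by
  set T := ⨆ μ : ℂ, Module.End.eigenspace (act hU : Module.End ℂ M) μ
  have step : ∀ (u : U4) (r : ℂ), (∀ m : M, hU • u • m = u • hU • m + r • u • m) →
      ∀ m ∈ T, u • m ∈ T := fun u r hu m hm => smul_mem_iSup_eigenspace hu hm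
  let N := submoduleOfGens T (step eU 2 h_e) (step fU (-2) fun m => by
    have := h_f_pow 1 m
    simp only [pow_one, Nat.cast_one, mul_one] at this
    rw [this, neg_smul, sub_eq_add_neg]) (step (xU 4) (-4) fun m => by
      rw [h_x]; norm_num)
  rw [eq_top_iff]
  rintro m -
  obtain ⟨u, rfl⟩ := hgen m
  exact N.smul_mem u (Submodule.mem_iSup_of_mem μ (Module.End.mem_eigenspace_iff.2 hv))

/-- If `fⁿx` comes from a vector of weight `p`, then `x` has weight `p + 2n`; this is verified after
applying `fⁿ`, which is injective. -/
theorem iSup_eigenspace_locF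
    (hM : ⨆ μ : ℂ, Module.End.eigenspace (act hU : Module.End ℂ M) μ = ⊤) :
    ⨆ μ : ℂ, Module.End.eigenspace (act hU : Module.End ℂ (LocF M)) μ = ⊤ := by
  rw [eq_top_iff]
  rintro x -
  obtain ⟨n, m, hx⟩ := LocF.exists_f_pow_smul x
  have hm : m ∈ ⨆ μ : ℂ, Module.End.eigenspace (act hU : Module.End ℂ M) μ :=
    hM ▸ Submodule.mem_top
  induction hm using Submodule.iSup_induction' generalizing x with
  | mem p m hm =>
    have h : hU • m = p • m := Module.End.mem_eigenspace_iff.1 hm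
    refine Submodule.mem_iSup_of_mem (p + 2 * n) (Module.End.mem_eigenspace_iff.2 ?_)
    rw [act_apply]
    apply LocF.f_pow_injective n
    beta_reduce
    have h1 := h_f_pow n x
    rw [hx, ← map_smul, h, LinearMap.map_smul_of_tower, ← hx] at h1
    rw [smul_complex_comm, add_smul, h1, sub_add_cancel]
  | zero =>
    have : x = 0 := LocF.f_pow_injective n (by beta_reduce; rw [hx, map_zero, smul_zero])
    rw [this]; exact zero_mem _
  | add a b _ _ ha hb =>
    obtain ⟨y, hy⟩ := LocF.exists_f_pow_smul_eq n a
    obtain ⟨z, hz⟩ := LocF.exists_f_pow_smul_eq n b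
    have : x = y + z := LocF.f_pow_injective n (by
      beta_reduce; rw [hx, map_add, smul_add, hy, hz])
    rw [this]
    exact add_mem (ha hy) (hb hz)

/-- On a weight vector the nonzero `uᵏm` would have distinct weights, hence be independent. So local
finiteness together with a nonzero weight shift gives local nilpotency. -/
theorem exists_pow_smul_eq_zero {u : U4} {d : ℂ} (hd : d ≠ 0)
    (hu : ∀ (k : ℕ) (m : M), hU • u ^ k • m = u ^ k • hU • m + (d * k) • u ^ k • m)
    (hM : ⨆ μ : ℂ, Module.End.eigenspace (act hU : Module.End ℂ M) μ = ⊤)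
    (he : ∀ m : M, FiniteDimensional ℂ (Submodule.span ℂ (Set.range fun k : ℕ => u ^ k • m)))
    (m : M) : ∃ n, u ^ n • m = 0 := by
  have hm : m ∈ ⨆ μ : ℂ, Module.End.eigenspace (act hU : Module.End ℂ M) μ :=
    hM ▸ Submodule.mem_top
  induction hm using Submodule.iSup_induction' with
  | mem p m hm =>
    have h : hU • m = p • m := Module.End.mem_eigenspace_iff.1 hm
    by_contra hcon
    push Not at hcon
    have hli : LinearIndependent ℂ fun k : ℕ => u ^ k • m := by
      refine Module.End.eigenvectors_linearIndependent' (act hU : Module.End ℂ M)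
        (fun k : ℕ => p + d * k) (fun k l hkl => ?_) _ fun k => ⟨?_, hcon k⟩
      · have h1 : (k : ℂ) = l := by
          have := add_left_cancel hkl
          exact mul_left_cancel₀ hd this
        exact_mod_cast h1
      · rw [Module.End.mem_eigenspace_iff, act_apply, hu, h, smul_complex_comm, add_smul]
    have := he m
    have hli2 := linearIndependent_span hli
    have := hli2.finite
    exact not_finite ℕ
  | zero => exact ⟨0, by simp⟩
  | add a b _ _ ha hb =>
    obtain ⟨p, hp⟩ := ha
    obtain ⟨q, hq⟩ := hb
    refine ⟨p + q, ?_⟩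
    rw [smul_add, pow_add, mul_smul, mul_smul, hq, smul_zero, add_zero, ← mul_smul, ← pow_add,
      add_comm, pow_add, mul_smul, hp, smul_zero]

theorem isLocFinite_iff_finDim (x : U4) (m : M) : IsLocFinite x m ↔
    FiniteDimensional ℂ (Submodule.span ℂ (Set.range fun k : ℕ => x ^ k • m)) := by
  have h : ‹Module ℂ M› = Module.restrictScalars ℂ U4 M :=
    Module.ext' _ _ fun r m => (algebraMap_smul_eq r m).symm
  subst h
  rfl

end diag

section char
variable {M : Type*} [AddCommGroup M] [Module U4 M]

theorem HasCharacter.locF {c : ℂ} (h : HasCharacter c M) : HasCharacter c (LocF M) := by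
  have key : ∀ (u : U4) (r : ℂ), (∀ a, a * u = u * a) → (∀ m : M, u • m = algebraMap ℂ U4 r • m) →
      ∀ x : LocF M, u • x = algebraMap ℂ U4 r • x := by
    intro u r hu hr x
    obtain ⟨n, m, hx⟩ := LocF.exists_f_pow_smul x
    apply LocF.f_pow_injective n
    beta_reduce
    rw [← mul_smul, hu, mul_smul, hx, ← map_smul, hr, map_smul, ← hx, ← mul_smul, ← mul_smul,
      Algebra.commutes]
  exact ⟨key C2 _ C2_central h.1, key C3 _ C3_central h.2⟩

theorem Verma.smul_mk_one {l : ℂ × ℂ} {u : U4} (hu : u ∈ vermaIdeal l) :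
    u • (Submodule.Quotient.mk 1 : Verma l) = 0 := by
  rw [← Submodule.Quotient.mk_smul, smul_eq_mul, mul_one]
  exact (Submodule.Quotient.mk_eq_zero _).2 hu

theorem Verma.exists_eq_smul {l : ℂ × ℂ} (m : Verma l) :
    ∃ u : U4, m = u • (Submodule.Quotient.mk 1 : Verma l) := by
  obtain ⟨u, rfl⟩ := Submodule.Quotient.mk_surjective _ m
  exact ⟨u, by rw [← Submodule.Quotient.mk_smul, smul_eq_mul, mul_one]⟩

theorem Verma.h_mk_one (l : ℂ × ℂ) :
    hU • (Submodule.Quotient.mk 1 : Verma l) = l.1 • (Submodule.Quotient.mk 1 : Verma l) := by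
  have := Verma.smul_mk_one (l := l) (u := hU - algebraMap ℂ U4 l.1)
    (Submodule.subset_span (by simp))
  rwa [sub_smul, algebraMap_smul_eq, sub_eq_zero] at this

theorem Verma.hasCharacter (l : ℂ × ℂ) : HasCharacter l.2 (Verma l) := by
  set v : Verma l := Submodule.Quotient.mk 1
  have h0 : xU 0 • v = 0 := Verma.smul_mk_one (Submodule.subset_span (by simp [xU, v4]))
  have h1 : xU 1 • v = 0 := Verma.smul_mk_one (Submodule.subset_span (by simp [xU, v2]))
  have h2 : xU 2 • v = l.2 • v := by
    have := Verma.smul_mk_one (l := l) (u := v0 - algebraMap ℂ U4 l.2)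
      (Submodule.subset_span (by simp))
    rwa [sub_smul, algebraMap_smul_eq, sub_eq_zero] at this
  have key : ∀ (u : U4) (r : ℂ), (∀ a, a * u = u * a) → u • v = r • v →
      ∀ m : Verma l, u • m = algebraMap ℂ U4 r • m := by
    intro u r hu hr m
    obtain ⟨a, rfl⟩ := Verma.exists_eq_smul m
    rw [← mul_smul, ← hu, mul_smul, algebraMap_smul_eq, ← smul_complex_comm]
    exact congrArg (a • ·) hr
  refine ⟨key C2 _ C2_central ?_, key C3 _ C3_central ?_⟩
  · rw [C2_smul]
    simp only [h0, h1, h2, smul_zero, smul_complex_comm, smul_smul]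
    simp [pow_two]
  · rw [C3_smul]
    simp only [h0, h1, h2, smul_zero, smul_complex_comm, smul_smul]
    simp [pow_succ]

/-- Weights survive localization, quotients and submodules. Local nilpotency of `e` follows from the
local finiteness that defines the completion, and that of `f` because some `fⁿ` clears the
denominator and lands in the image of `M`. -/
theorem integrable_of_EA [Module ℂ M] [IsScalarTower ℂ U4 M]
    (hM : ⨆ μ : ℂ, Module.End.eigenspace (act hU : Module.End ℂ M) μ = ⊤) : Integrable (EA M) := by
  have hC : ⨆ μ : ℂ, Module.End.eigenspace (act hU : Module.End ℂ (Comp M)) μ = ⊤ :=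
    iSup_eigenspace_of_surjective (iSup_eigenspace_locF hM) (LinearMap.range (locMap M)).mkQ
      (Submodule.mkQ_surjective _)
  have hE := iSup_eigenspace_submodule hC (EA M)
  refine ⟨exists_pow_smul_eq_zero two_ne_zero h_e_pow hE fun m => ?_, fun m => ?_, hE⟩
  · have h1 : FiniteDimensional ℂ (Submodule.span ℂ (Set.range fun k : ℕ => eU ^ k • (m : Comp M))) :=
      (isLocFinite_iff_finDim eU (m : Comp M)).1 m.2
    let ι : EA M →ₗ[ℂ] Comp M := (EA M).subtype.restrictScalars ℂ
    have hι : Function.Injective ι := Subtype.val_injective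
    have h2 : (Submodule.span ℂ (Set.range fun k : ℕ => eU ^ k • m)).map ι
        = Submodule.span ℂ (Set.range fun k : ℕ => eU ^ k • (m : Comp M)) := by
      rw [Submodule.map_span, ← Set.range_comp]; rfl
    rw [← h2] at h1
    exact Module.Finite.equiv (Submodule.equivMapOfInjective ι hι _).symm
  · obtain ⟨x, hx⟩ := Submodule.Quotient.mk_surjective _ (m : Comp M)
    obtain ⟨n, r, hr⟩ := LocF.exists_f_pow_smul x
    refine ⟨n, Subtype.ext ?_⟩
    change fU ^ n • (m : Comp M) = 0
    rw [← hx, ← Submodule.Quotient.mk_smul, hr]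
    exact (Submodule.Quotient.mk_eq_zero _).2 ⟨r, rfl⟩

theorem HasCharacter.EA [Module ℂ M] [IsScalarTower ℂ U4 M] {c : ℂ} (h : HasCharacter c M) : HasCharacter c (EA M) :=
  (h.locF.of_surjective (LinearMap.range (locMap M)).mkQ (Submodule.mkQ_surjective _)).submodule _

theorem IsSimpleSubquotientEA.exists_integrable {S : Type*} [AddCommGroup S] [Module U4 S]
    [Module ℂ S] [IsScalarTower ℂ U4 S] (h : IsSimpleSubquotientEA S) :
    Integrable S ∧ ∃ c, HasCharacter c S := by
  obtain ⟨l, h⟩ := h.2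
  obtain ⟨N, h⟩ := h
  obtain ⟨P, h⟩ := h.2
  obtain ⟨φ, hφ⟩ := h
  have hR := iSup_eigenspace_of_surjective
    (iSup_eigenspace_of_generator (Verma.h_mk_one l) Verma.exists_eq_smul) N.mkQ N.mkQ_surjective
  have hc : HasCharacter l.2 (Verma l ⧸ N) :=
    (Verma.hasCharacter l).of_surjective N.mkQ N.mkQ_surjective
  exact ⟨((integrable_of_EA hR).submodule P).of_surjective φ hφ, l.2,
    (hc.EA.submodule P).of_surjective φ hφ⟩

end char

/-! ### Harish-Chandra modules -/

section hc

theorem isFinDim_iff {A : Type*} [Ring A] [Algebra ℂ A] {W : Type*} [AddCommGroup W] [Module A W]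
    [Module ℂ W] [IsScalarTower ℂ A W] : IsFinDim A W ↔ FiniteDimensional ℂ W := by
  have h : ‹Module ℂ W› = Module.restrictScalars ℂ A W :=
    Module.ext' _ _ fun r m => (algebraMap_smul A r m).symm
  subst h
  rfl

variable {M : Type*} [AddCommGroup M] [Module U4 M] [Module ℂ M] [IsScalarTower ℂ U4 M]

/-- The sum of the weight spaces, as a `𝔤`-submodule. -/
def weightSum (M : Type*) [AddCommGroup M] [Module U4 M] [Module ℂ M] [IsScalarTower ℂ U4 M] :
    Submodule Ug (ResG M) where
  carrier := {m | (toResG M).symm m ∈ ⨆ μ : ℂ, Module.End.eigenspace (act hU : Module.End ℂ M) μ}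
  add_mem' ha hb := Submodule.add_mem
    (⨆ μ : ℂ, Module.End.eigenspace (act hU : Module.End ℂ M) μ) ha hb
  zero_mem' := Submodule.zero_mem (⨆ μ : ℂ, Module.End.eigenspace (act hU : Module.End ℂ M) μ)
  smul_mem' u m hm := by
    let S : Subalgebra ℂ Ug :=
      { carrier := {u | ∀ m : ResG M, (toResG M).symm m ∈
          ⨆ μ : ℂ, Module.End.eigenspace (act hU : Module.End ℂ M) μ → (toResG M).symm (u • m) ∈
          ⨆ μ : ℂ, Module.End.eigenspace (act hU : Module.End ℂ M) μ}
        mul_mem' := fun {u v} hu hv m hm => by rw [mul_smul]; exact hu _ (hv _ hm)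
        add_mem' := fun {u v} hu hv m hm => by
          rw [add_smul, map_add]; exact add_mem (hu _ hm) (hv _ hm)
        algebraMap_mem' := fun a m hm => by
          rw [algebraMap_smul, map_smul]; exact Submodule.smul_mem _ a hm }
    have step : ∀ (x : Sl2) (r : ℂ), (∀ m : M, hU • gU x • m = gU x • hU • m + r • gU x • m) →
        (ι ℂ x : Ug) ∈ S := by
      intro x r hx m hm
      have h : (toResG M).symm ((ι ℂ x : Ug) • m) = gU x • (toResG M).symm m := by
        rw [LinearEquiv.symm_apply_eq, toResG_gU_smul, LinearEquiv.apply_symm_apply]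
      rw [h]
      generalize (toResG M).symm m = m at hm
      exact smul_mem_iSup_eigenspace hx hm
    refine mem_of_gens_sl2 S (step sl2E 2 h_e) (step sl2F (-2) fun m => ?_) u m hm
    have := h_f_pow 1 m
    simp only [pow_one, Nat.cast_one, mul_one] at this
    exact this.trans (by rw [neg_smul, sub_eq_add_neg]; rfl)

theorem mem_weightSum {m : ResG M} : m ∈ weightSum M ↔
    (toResG M).symm m ∈ ⨆ μ : ℂ, Module.End.eigenspace (act hU : Module.End ℂ M) μ := Iff.rfl

/-- A simple finite-dimensional summand contains an `h`-eigenvector and therefore lies in the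
`𝔤`-submodule `weightSum`, so `h` is diagonalizable. Local finiteness of `e` and `f` comes from
finite-dimensionality of the summands, and their nilpotency from the weight shift. -/
theorem IsHarishChandra.integrable {M : Type u} [AddCommGroup M] [Module U4 M] [Module ℂ M]
    [IsScalarTower ℂ U4 M] (h : IsHarishChandra M) : Integrable M := by
  obtain ⟨I, W, -, hsup, hsimple, hfin, -⟩ := h
  have hfin' : ∀ i, FiniteDimensional ℂ (W i) := fun i => isFinDim_iff.1 (hfin i)
  have hW : ∀ i, W i ≤ weightSum M := by
    intro i
    have := hsimple i
    have : Nontrivial (W i) := IsSimpleModule.nontrivial Ug (W i)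
    have hatom : IsAtom (W i) := isSimpleModule_iff_isAtom.1 (hsimple i)
    obtain ⟨μ, hμ⟩ := Module.End.exists_eigenvalue
      (Algebra.lsmul ℂ ℂ (W i) (ι ℂ sl2H : Ug) : Module.End ℂ (W i))
    obtain ⟨v, hv, hv0⟩ := hμ.exists_hasEigenvector
    have hvm : (v : ResG M) ∈ weightSum M := by
      have h1 : (ι ℂ sl2H : Ug) • (v : ResG M) = μ • (v : ResG M) :=
        congrArg Subtype.val (Module.End.mem_eigenspace_iff.1 hv)
      have h2 : (toResG M).symm v ∈ Module.End.eigenspace (act hU : Module.End ℂ M) μ := by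
        rw [Module.End.mem_eigenspace_iff, act_apply]
        apply (toResG M).injective
        rw [hU, toResG_gU_smul, map_smul, LinearEquiv.apply_symm_apply, h1]
      exact mem_weightSum.2 (Submodule.mem_iSup_of_mem μ h2)
    -- A simple submodule not contained in `weightSum` would meet it trivially, contrary to the
    -- eigenvector `v`.
    by_contra hle
    have hdis := (hatom.not_le_iff_disjoint).1 hle
    exact hv0 (Subtype.ext (Submodule.disjoint_def.1 hdis v v.2 hvm))
  have htop : ⨆ μ : ℂ, Module.End.eigenspace (act hU : Module.End ℂ M) μ = ⊤ := by
    rw [eq_top_iff]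
    intro m _
    have : toResG M m ∈ weightSum M := by
      have h1 : (⊤ : Submodule Ug (ResG M)) ≤ weightSum M := hsup ▸ iSup_le hW
      exact h1 trivial
    exact mem_weightSum.1 this
  have hloc : ∀ (x : Sl2) (m : M),
      FiniteDimensional ℂ (Submodule.span ℂ (Set.range fun k : ℕ => gU x ^ k • m)) := by
    intro x m
    rw [← isLocFinite_iff_finDim]
    have hm : toResG M m ∈ ⨆ i, W i := hsup ▸ trivial
    obtain ⟨m, rfl⟩ := (toResG M).symm.surjective m
    rw [LinearEquiv.apply_symm_apply] at hm
    induction hm using Submodule.iSup_induction' with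
    | mem i m hm =>
      rw [isLocFinite_iff_finDim, finDim_span_iff]
      refine ⟨((W i).restrictScalars ℂ).map (toResG M).symm.toLinearMap, ?_, ⟨m, hm, rfl⟩, ?_⟩
      · have : FiniteDimensional ℂ ((W i).restrictScalars ℂ) := hfin' i
        infer_instance
      · rintro _ ⟨w, hw, rfl⟩
        refine ⟨(ι ℂ x : Ug) • w, (W i).smul_mem _ hw, ?_⟩
        apply (toResG M).injective
        rw [toResG_gU_smul]; rfl
    | zero =>
      rw [map_zero]
      exact isLocFinite_of_pow_smul_eq_zero (n := 0) (smul_zero _)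
    | add a b _ _ ha hb => rw [map_add]; exact ha.add hb
  refine ⟨exists_pow_smul_eq_zero two_ne_zero h_e_pow htop (hloc sl2E),
    exists_pow_smul_eq_zero (d := -2) (by norm_num) (fun k m => ?_) htop (hloc sl2F), htop⟩
  rw [h_f_pow, neg_mul, neg_smul, sub_eq_add_neg]

end hc

/-! ### The classification -/

section classification

theorem InF.of_equiv_repV {c : ℂ} (hc : c ≠ 0) (a : Label) {V : Type*} [AddCommGroup V]
    [Module U4 V] (ε : V ≃ₗ[U4] repV a c) : InF V :=
  ⟨1, fun _ => ⊤, iSupIndep_subsingleton _, iSup_const, fun _ =>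
    repV.isSimpleSubquotientEA hc a (ε.symm.trans Submodule.topEquiv.symm)⟩

theorem IsSimpleObjectF.exists_integrable {V : Type*} [AddCommGroup V] [Module U4 V] [Module ℂ V]
    [IsScalarTower ℂ U4 V] (h : IsSimpleObjectF V) : Integrable V ∧ ∃ c, HasCharacter c V := by
  obtain ⟨⟨n, W, -, hsup, hW⟩, hs⟩ := h
  have : Nontrivial V := IsSimpleModule.nontrivial U4 V
  obtain ⟨i, hi⟩ : ∃ i, W i ≠ ⊥ := by
    by_contra hcon
    push Not at hcon
    rw [iSup_eq_bot.2 hcon] at hsup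
    exact bot_ne_top hsup
  have htop : W i = ⊤ := (eq_bot_or_eq_top (W i)).resolve_left hi
  have hsurj : Function.Surjective (W i).subtype := by
    rw [← LinearMap.range_eq_top, Submodule.range_subtype, htop]
  obtain ⟨h1, c, h2⟩ := (hW i).exists_integrable
  exact ⟨h1.of_surjective _ hsurj, c, h2.of_surjective _ hsurj⟩

theorem HasGTypes.range_eq {V V' : Type*} [AddCommGroup V] [Module U4 V] [Module ℂ V]
    [IsScalarTower ℂ U4 V] [AddCommGroup V'] [Module U4 V'] [Module ℂ V'] [IsScalarTower ℂ U4 V']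
    {t t' : ℕ → ℕ} (h : HasGTypes t V) (h' : HasGTypes t' V') (ε : V ≃ₗ[U4] V') :
    Set.range t = Set.range t' := by
  ext N
  rw [← h.exists_lowest_iff, ← h'.exists_lowest_iff]
  constructor
  · rintro ⟨m, hm, hl⟩
    exact ⟨ε m, ε.map_ne_zero_iff.2 hm, hl.map ε.toLinearMap⟩
  · rintro ⟨m, hm, hl⟩
    exact ⟨ε.symm m, ε.symm.map_ne_zero_iff.2 hm, hl.map ε.symm.toLinearMap⟩

/-- The first two `𝔤`-types already determine the label. -/
theorem Label.eq_of_range_gTypes {a b : Label} (h : Set.range a.gTypes = Set.range b.gTypes) :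
    a = b := by
  have h1 : ∀ k, ∃ l, b.gTypes l = a.gTypes k := fun k => Set.mem_range.1 (h ▸ Set.mem_range_self k)
  have h2 : ∀ k, ∃ l, a.gTypes l = b.gTypes k := fun k => Set.mem_range.1 (h ▸ Set.mem_range_self k)
  obtain ⟨l0, h10⟩ := h1 0
  obtain ⟨l1, h11⟩ := h1 1
  obtain ⟨k0, h20⟩ := h2 0
  obtain ⟨k1, h21⟩ := h2 1
  cases a <;> cases b <;> simp only [Label.gTypes] at h10 h11 h20 h21 <;>
    first | rfl | (congr 1; apply PNat.eq; omega) | (exfalso; omega)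

/-- The ratio `c³ / c²` recovers `c`, which is why the squares and cubes together separate
characters. -/
theorem HasCharacter.eq {V : Type*} [AddCommGroup V] [Module U4 V] [Module ℂ V]
    [IsScalarTower ℂ U4 V] [Nontrivial V] {c d : ℂ} (hc0 : c ≠ 0) (hc : HasCharacter c V)
    (hd : HasCharacter d V) : c = d := by
  obtain ⟨v, hv⟩ := exists_ne (0 : V)
  have h2 : c ^ 2 = d ^ 2 := by
    have := (hc.1 v).symm.trans (hd.1 v)
    rw [algebraMap_smul_eq, algebraMap_smul_eq] at this
    exact smul_left_injective ℂ hv this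
  have h3 : c ^ 3 = d ^ 3 := by
    have := (hc.2 v).symm.trans (hd.2 v)
    rw [algebraMap_smul_eq, algebraMap_smul_eq] at this
    exact smul_left_injective ℂ hv this
  refine mul_left_cancel₀ (pow_ne_zero 2 hc0) ?_
  rw [← pow_succ, h3, h2, ← pow_succ]

end classification
end ConformalGalilei


theorem theorem7p6 :
    ∃ 𝒱 : Label → ℂˣ → ModuleCat.{0} U4,
      -- each member of the list is the unique simple object of `𝓕` with its
      -- central character and its `𝔤`-types
      (∀ (a : Label) (c : ℂˣ), IsSimpleObjectFWith c a.gTypes (𝒱 a c) ∧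
        ∀ (W : Type u) [AddCommGroup W] [Module U4 W],
          IsSimpleObjectFWith c a.gTypes W → Nonempty (W ≃ₗ[U4] 𝒱 a c)) ∧
      -- completeness, for a given nonzero central character
      (∀ (c : ℂˣ) (W : Type u) [AddCommGroup W] [Module U4 W],
        IsSimpleObjectF W → HasCharacter c W → ∃ a, Nonempty (W ≃ₗ[U4] 𝒱 a c)) ∧
      -- completeness, among all simple objects of `𝓕` not annihilated by `𝔯`
      (∀ (W : Type u) [AddCommGroup W] [Module U4 W],
        IsSimpleObjectF W → (∃ (x : Irrep 4) (w : W), rU x • w ≠ 0) →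
          ∃ a c, Nonempty (W ≃ₗ[U4] 𝒱 a c)) ∧
      -- irredundancy
      (∀ (a b : Label) (c d : ℂˣ), Nonempty (𝒱 a c ≃ₗ[U4] 𝒱 b d) → a = b ∧ c = d) ∧
      -- simple Harish-Chandra modules with such a central character lie in `𝓕`
      (∀ (c : ℂˣ) (V : Type u) [AddCommGroup V] [Module U4 V],
        IsSimpleModule U4 V → IsHarishChandra V → HasCharacter c V → InF V) := by
  have complete : ∀ (c : ℂˣ) (W : Type u) [AddCommGroup W] [Module U4 W],
      IsSimpleObjectF W → HasCharacter c W → ∃ a, Nonempty (W ≃ₗ[U4] repV a c) := by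
    intro c W _ _ hW hc
    let _ : Module ℂ W := Module.restrictScalars ℂ U4 W
    have : IsScalarTower ℂ U4 W := IsScalarTower.restrictScalars ℂ U4 W
    have := hW.2
    exact hW.exists_integrable.1.exists_equiv_repV c.ne_zero hc
  refine ⟨fun a c => ModuleCat.of U4 (repV a c), fun a c => ⟨?_, ?_⟩, complete, ?_, ?_, ?_⟩
  · exact ⟨⟨InF.of_equiv_repV c.ne_zero a (LinearEquiv.refl U4 (repV a c)),
      repV.isSimpleModule c.ne_zero a⟩, repV.hasCharacter a c, repV.hasGTypes a c⟩
  · intro W _ _ hW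
    obtain ⟨b, ⟨ε⟩⟩ := complete c W hW.1 hW.2.1
    let _ : Module ℂ W := Module.restrictScalars ℂ U4 W
    have : IsScalarTower ℂ U4 W := IsScalarTower.restrictScalars ℂ U4 W
    obtain rfl := Label.eq_of_range_gTypes (hW.2.2.range_eq (repV.hasGTypes b c) ε)
    exact ⟨ε⟩
  · rintro W _ _ hW ⟨x, w, hx⟩
    let _ : Module ℂ W := Module.restrictScalars ℂ U4 W
    have : IsScalarTower ℂ U4 W := IsScalarTower.restrictScalars ℂ U4 W
    have := hW.2
    obtain ⟨hI, c, hc⟩ := hW.exists_integrable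
    -- The zero character would force `𝔯` to act by zero.
    have hc0 : c ≠ 0 := by
      rintro rfl
      exact hx (hI.rU_smul_eq_zero hc x w)
    obtain ⟨a, ha⟩ := complete (Units.mk0 c hc0) W hW hc
    exact ⟨a, _, ha⟩
  · rintro a b c d ⟨ε⟩
    have ε' : repV a c ≃ₗ[U4] repV b d := ε
    have := repV.isSimpleModule c.ne_zero a
    have : Nontrivial (repV a (c : ℂ)) := IsSimpleModule.nontrivial U4 _
    exact ⟨Label.eq_of_range_gTypes ((repV.hasGTypes a c).range_eq (repV.hasGTypes b d) ε'),
      Units.ext (HasCharacter.eq c.ne_zero (repV.hasCharacter a c)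
        ((repV.hasCharacter b d).of_surjective ε'.symm.toLinearMap ε'.symm.surjective))⟩
  · intro c V _ _ hs hV hc
    let _ : Module ℂ V := Module.restrictScalars ℂ U4 V
    have : IsScalarTower ℂ U4 V := IsScalarTower.restrictScalars ℂ U4 V
    obtain ⟨a, ⟨ε⟩⟩ := hV.integrable.exists_equiv_repV c.ne_zero hc
    exact InF.of_equiv_repV c.ne_zero a ε
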